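/- An $r$-component virtual link diagram is the image of a generic immersion of $r$ ordered, oriented circles into the plane, considered up to isotopy of the plane, whose double points are marked as positive, negative or virtual crossings. Two such diagrams are equivalent if they are related by a finite sequence of generalized Reidemeister moves: the classical moves R1, R2, R3 and the virtual moves VR1, VR2, VR3, VR4 (with all orientations), respecting the order of the components. An $r$-component virtual link is an equivalence class of such diagrams; for $r=1$ one speaks of virtual knots and virtual knot diagrams. Let $r\ge 2$ and let $D$ be a virtual knot diagram. The $r$-multiplexing $L(D;r)$ is obtained by replacing $D$ by $r$ parallel copies, modified at the crossings as follows. The places in a bundle of $r$ parallel strands are counted from left to right with respect to the orientation. At a positive (negative) crossing of $D$, the $r^2$ crossings of the two bundles are positive (negative), with the same bundle passing over, when the two strands have the same place in their bundles, and virtual otherwise. At a virtual crossing of $D$, all $r^2$ crossings of the two bundles are virtual, and after the crossing each bundle is permuted cyclically by $r-1$ further virtual crossings: the strands of one bundle move one place to the right (the outermost one returning to the other side) and those of the other bundle move one place to the left. Which of the two moves to the right is decided by the side from which the other one comes, by one convention fixed for all diagrams (either of the two conventions is allowed). The components of $L(D;r)$ are numbered from left to right along the bundle at a chosen base point of $D$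 that is not a crossing. **Theorem 1.1.** For every $r\ge 2$ and every virtual knot diagram $D$, $L(D;r)$ is an $r$-component virtual link diagram, and up to equivalence it does not depend on the base point. If two virtual knot diagrams $D$ and $D'$ are equivalent, then $L(D;r)$ and $L(D';r)$ are equivalent. Hence there is exactly one map $K\mapsto L(K;r)$ from virtual knots to $r$-component virtual links such that $L(K;r)$ is represented by $L(D;r)$ for every diagram $D$ of $K$. -/

import Mathlib

namespace VirtualLinks

/-!
# Virtual link diagrams in the plane

A planar diagram is put in general position with respect to the height function and read from
bottom to top: it becomes a finite sequence of elementary pieces (a minimum, a maximum or a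
crossing), each sitting at some horizontal position between vertical strands.  Conversely every
such sequence that starts and ends with no strand draws a diagram in the plane.  Two sequences draw
the same diagram up to isotopy of the plane precisely if they are related by the moves
`exchange`, `zigzag₁`, `zigzag₂`, `capSlide`, `cupSlide` below.
-/

/-- A vertical strand seen on a horizontal line: its orientation (`up = true` if it is directed
upwards) and the name of the component of the link to which it belongs. -/
structure Strand (X : Type) where
  up : Bool
  comp : X

/-- The same component, directed the other way. -/
def Strand.flip {X : Type} (s : Strand X) : Strand X := ⟨!s.up, s.comp⟩

/-- The three kinds of double points.  At a crossing there is a strand running from the lower left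
to the upper right and a strand running from the lower right to the upper left (as unoriented
lines).  `over`: the former passes over the latter.  `under`: the former passes under the latter.
`virt`: a virtual crossing.  If both strands are directed upwards, or both downwards, an `over`
crossing is positive and an `under` crossing is negative; if exactly one of them is directed
upwards, it is the other way round. -/
inductive Kind
  | over
  | under
  | virt

/-- Exchange the roles of the two strands in the description of the crossing. -/
def Kind.swap : Kind → Kind
  | .over => .under
  | .under => .over
  | .virt => .virt

/-- The elementary pieces: a local minimum whose left leg is `s`, a local maximum whose left leg is
`s`, and a crossing of the given kind where `a` runs from lower left to upper right and `b` runs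
from lower right to upper left. -/
inductive Elem (X : Type)
  | cup (s : Strand X)
  | cap (s : Strand X)
  | cross (k : Kind) (a b : Strand X)

/-- The strands at the bottom of an elementary piece, from left to right. -/
def Elem.src {X : Type} : Elem X → List (Strand X)
  | .cup _ => []
  | .cap s => [s, s.flip]
  | .cross _ a b => [a, b]

/-- The strands at the top of an elementary piece, from left to right. -/
def Elem.tgt {X : Type} : Elem X → List (Strand X)
  | .cup s => [s, s.flip]
  | .cap _ => []
  | .cross _ a b => [b, a]

/-- An elementary piece with exactly `pos` vertical strands to the left of it. -/
structure Letter (X : Type) where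
  pos : ℕ
  elem : Elem X

/-- A sequence of elementary pieces, read from bottom to top. -/
abbrev Word (X : Type) := List (Letter X)

/-- `Runs s w t`: the word `w` draws a tangle diagram in a horizontal strip whose strands
on the bottom line are `s` and whose strands on the top line are `t`. -/
inductive Runs {X : Type} : List (Strand X) → Word X → List (Strand X) → Prop
  | nil (s : List (Strand X)) : Runs s [] s
  | cons (u v : List (Strand X)) (e : Elem X) (w : Word X) (t : List (Strand X)) :
      Runs (u ++ e.tgt ++ v) w t → Runs (u ++ e.src ++ v) (⟨u.length, e⟩ :: w) t

/-- `StrandAt w t p s`: on the horizontal line just above the first `t` pieces of the diagram `w`,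
the strand number `p` (counted from the left, starting with `0`) is `s`. -/
def StrandAt {X : Type} (w : Word X) (t p : ℕ) (s : Strand X) : Prop :=
  ∃ u : List (Strand X), Runs [] (w.take t) u ∧ u[p]? = some s

/-- `Joined w (t, p) (t', p')`: the strand number `p` on the line above the first `t` pieces and the
strand number `p'` on the line above the first `t'` pieces are joined by an arc inside one piece
(a curve goes straight through every crossing). -/
inductive Joined {X : Type} (w : Word X) : ℕ × ℕ → ℕ × ℕ → Prop
  | left (t p : ℕ) (l : Letter X) : w[t]? = some l → p < l.pos → Joined w (t, p) (t + 1, p)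
  | right (t d : ℕ) (l : Letter X) : w[t]? = some l →
      Joined w (t, l.pos + l.elem.src.length + d) (t + 1, l.pos + l.elem.tgt.length + d)
  | cup (t i : ℕ) (s : Strand X) : w[t]? = some ⟨i, .cup s⟩ → Joined w (t + 1, i) (t + 1, i + 1)
  | cap (t i : ℕ) (s : Strand X) : w[t]? = some ⟨i, .cap s⟩ → Joined w (t, i) (t, i + 1)
  | cross₁ (t i : ℕ) (k : Kind) (a b : Strand X) : w[t]? = some ⟨i, .cross k a b⟩ →
      Joined w (t, i) (t + 1, i + 1)
  | cross₂ (t i : ℕ) (k : Kind) (a b : Strand X) : w[t]? = some ⟨i, .cross k a b⟩ →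
      Joined w (t, i + 1) (t + 1, i)

/-- A virtual link diagram with `r` ordered and oriented components: a closed diagram together with
a numbering of its components by `Fin r`.  Strands with different numbers lie on different
circles by the way strands are joined; the last two fields say that every number is used, and that
the strands with a given number form one circle. -/
structure LinkDiagram (r : ℕ) where
  word : Word (Fin r)
  closed : Runs [] word []
  comp_nonempty : ∀ x : Fin r, ∃ t p s, StrandAt word t p s ∧ s.comp = x
  comp_connected : ∀ t p s t' p' s', StrandAt word t p s → StrandAt word t' p' s' →
    s.comp = s'.comp → Relation.EqvGen (Joined word) (t, p) (t', p')

/-- A virtual knot diagram. -/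
abbrev KnotDiagram := LinkDiagram 1

/-! ### Isotopies of the plane and generalized Reidemeister moves -/

/-- The triples of crossings that may occur in a third move, for three strands `a`, `b`, `c` that
cross each other once (`k₁` for `a`, `b`; `k₂` for `a`, `c`; `k₃` for `b`, `c`): three real
crossings such that the strands have a top, a middle and a bottom one (R3), three virtual crossings
(VR3), or two virtual crossings and a real one (VR4). -/
def AdmissibleTriple : Kind → Kind → Kind → Prop
  | .over, .under, .over => False
  | .under, .over, .under => False
  | .virt, .virt, _ => True
  | .virt, _, .virt => True
  | _, .virt, .virt => True
  | .virt, _, _ => False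
  | _, .virt, _ => False
  | _, _, .virt => False
  | _, _, _ => True

/-- The local moves: isotopies of the plane (the first five) and the generalized Reidemeister moves
(the other four), for all orientations and all components of the strands. -/
inductive LocalMove {X : Type} : Word X → Word X → Prop
  /-- pieces side by side may be performed in either order -/
  | exchange (i d : ℕ) (e f : Elem X) :
      LocalMove [⟨i, e⟩, ⟨i + e.tgt.length + d, f⟩] [⟨i + e.src.length + d, f⟩, ⟨i, e⟩]
  /-- a zigzag may be straightened -/
  | zigzag₁ (i : ℕ) (s : Strand X) :
      LocalMove [⟨i + 1, .cup s.flip⟩, ⟨i, .cap s⟩] []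
  | zigzag₂ (i : ℕ) (s : Strand X) :
      LocalMove [⟨i, .cup s⟩, ⟨i + 1, .cap s.flip⟩] []
  /-- a crossing of a strand with one leg of a maximum may slide to the other leg -/
  | capSlide (i : ℕ) (k : Kind) (x a : Strand X) :
      LocalMove [⟨i, .cross k x a⟩, ⟨i + 1, .cap x⟩]
        [⟨i + 1, .cross k.swap a x.flip⟩, ⟨i, .cap x⟩]
  /-- a crossing of a strand with one leg of a minimum may slide to the other leg -/
  | cupSlide (i : ℕ) (k : Kind) (x a : Strand X) :
      LocalMove [⟨i + 1, .cup x⟩, ⟨i, .cross k a x⟩]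
        [⟨i, .cup x⟩, ⟨i + 1, .cross k.swap x.flip a⟩]
  /-- R1, and VR1 for `k = virt`, at a maximum -/
  | curl₁ (i : ℕ) (k : Kind) (x : Strand X) :
      LocalMove [⟨i, .cross k x x.flip⟩, ⟨i, .cap x.flip⟩] [⟨i, .cap x⟩]
  /-- R1, and VR1 for `k = virt`, at a minimum -/
  | curl₂ (i : ℕ) (k : Kind) (x : Strand X) :
      LocalMove [⟨i, .cup x⟩, ⟨i, .cross k x x.flip⟩] [⟨i, .cup x.flip⟩]
  /-- R2, and VR2 for `k = virt` -/
  | bigon (i : ℕ) (k : Kind) (a b : Strand X) :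
      LocalMove [⟨i, .cross k a b⟩, ⟨i, .cross k.swap b a⟩] []
  /-- R3, VR3 and VR4 -/
  | triangle (i : ℕ) (k₁ k₂ k₃ : Kind) (a b c : Strand X) : AdmissibleTriple k₁ k₂ k₃ →
      LocalMove [⟨i, .cross k₁ a b⟩, ⟨i + 1, .cross k₂ a c⟩, ⟨i, .cross k₃ b c⟩]
        [⟨i + 1, .cross k₃ b c⟩, ⟨i, .cross k₂ a c⟩, ⟨i + 1, .cross k₁ a b⟩]

/-- Two closed diagrams differ by one local move in some part of the plane and agree outside. -/
def Move {X : Type} (w w' : Word X) : Prop :=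
  Runs [] w [] ∧ Runs [] w' [] ∧
    ∃ p q a a' : Word X, LocalMove a a' ∧ w = p ++ a ++ q ∧ w' = p ++ a' ++ q

/-- Equivalence of virtual link diagrams with ordered and oriented components.  (The moves carry the
numbers of the components along, and they change neither the number of circles nor the circles
to which the ends of the moved part belong.) -/
instance linkDiagramSetoid (r : ℕ) : Setoid (LinkDiagram r) where
  r D D' := Relation.EqvGen Move D.word D'.word
  iseqv := ⟨fun _ => .refl _, fun h => .symm _ _ h, fun h h' => .trans _ _ _ h h'⟩

/-- Virtual links with `r` ordered and oriented components. -/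
abbrev VirtualLink (r : ℕ) := Quotient (linkDiagramSetoid r)

/-- Virtual knots. -/
abbrev VirtualKnot := VirtualLink 1

/-! ### The multiplexing of a diagram -/

/-- The `r` parallel copies of `a` at the positions `j, …, j + r - 1` are permuted cyclically by
`r - 1` virtual crossings.  Read from bottom to top, for `rot = true` each of them moves one place
to the right and the last one becomes the first; `rot = false` is the inverse. -/
def rotation {X : Type} (rot : Bool) (r j : ℕ) (a : Strand X) : Word X :=
  if rot then (List.range (r - 1)).reverse.map fun p => ⟨j + p, .cross .virt a a⟩
  else (List.range (r - 1)).map fun p => ⟨j + p, .cross .virt a a⟩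

/-- The `r` parallel copies of `a`, at the positions `j, …, j + r - 1` at the bottom, cross the
`r` parallel copies of `b`, at the positions `j + r, …, j + 2 r - 1` at the bottom, in `r ^ 2`
crossings.  The crossing of a copy of `a` and a copy of `b` is of kind `k` if the two have the same
place in their bundles, counted from the left with respect to the orientation; otherwise it is
virtual. -/
def grid {X : Type} (r j : ℕ) (k : Kind) (a b : Strand X) : Word X :=
  (List.range r).reverse.flatMap fun p => (List.range r).map fun q =>
    ⟨j + p + q,
      .cross (if (if a.up = b.up then p = q else p + q + 1 = r) then k else .virt) a b⟩

/-- What replaces an elementary piece in the `r`-multiplexing.  Maxima and minima are replaced by `r`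
parallel ones, a real crossing by `r` real crossings of the same kind (and sign) and `r ^ 2 - r`
virtual crossings, a virtual crossing by `r ^ 2 + 2 * r - 2` virtual crossings: after the two
bundles of parallel strands have crossed each other, each of them is permuted cyclically, in such a
way that along the orientation the strands of one bundle move one place to the right and the
strands of the other one move one place to the left.  Which of the two bundles moves to the right
depends on the side from which the other one comes and on the convention `dir`: for `dir = false`,
it is the one that the other one crosses from right to left. -/
def multiplexLetter {X : Type} (dir : Bool) (r : ℕ) : Letter X → Word X
  | ⟨i, .cup s⟩ => (List.range r).map fun p => ⟨r * i + p, .cup s⟩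
  | ⟨i, .cap s⟩ => (List.range r).reverse.map fun p => ⟨r * i + p, .cap s⟩
  | ⟨i, .cross .virt a b⟩ =>
      let rot := xor dir (a.up == b.up)
      (if a.up then [] else rotation rot r (r * i) a) ++
      (if b.up then [] else rotation (!rot) r (r * i + r) b) ++
      grid r (r * i) .virt a b ++
      (if a.up then rotation rot r (r * i + r) a else []) ++
      (if b.up then rotation (!rot) r (r * i) b else [])
  | ⟨i, .cross k a b⟩ => grid r (r * i) k a b

/-- The `r`-multiplexing of a diagram, without a numbering of its components. -/
def multiplex {X : Type} (dir : Bool) (r : ℕ) (w : Word X) : Word X :=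
  w.flatMap (multiplexLetter dir r)

/-- Rename the components of a strand, a piece, a diagram. -/
def Strand.relabel {X Y : Type} (f : X → Y) (s : Strand X) : Strand Y := ⟨s.up, f s.comp⟩

def Elem.relabel {X Y : Type} (f : X → Y) : Elem X → Elem Y
  | .cup s => .cup (s.relabel f)
  | .cap s => .cap (s.relabel f)
  | .cross k a b => .cross k (a.relabel f) (b.relabel f)

def Word.relabel {X Y : Type} (f : X → Y) (w : Word X) : Word Y :=
  w.map fun l => ⟨l.pos, l.elem.relabel f⟩

/-- A bundle of `r` parallel strands with the given orientation, numbered in increasing order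
from left to right with respect to the orientation; the list is in the order of the page. -/
def numberedBundle (r : ℕ) (up : Bool) : List (Strand (Fin r)) :=
  if up then (List.finRange r).map fun x => ⟨true, x⟩
  else (List.finRange r).reverse.map fun x => ⟨false, x⟩

/-- `E` is a diagram `L(D; r)`: as a diagram without numbered components it is the `r`-multiplexing
of `D`, and at some point of `D` off the crossings the `r` parallel strands of `E` that run along
`D` belong, from left to right, to the components number `0, …, r - 1`. -/
def IsMultiplexing {r : ℕ} (dir : Bool) (D : KnotDiagram) (E : LinkDiagram r) : Prop :=
  Word.relabel (fun _ => (0 : Fin 1)) E.word = multiplex dir r D.word ∧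
  ∃ (t p : ℕ) (s : Strand (Fin 1)) (u v : List (Strand (Fin r))),
    StrandAt D.word t p s ∧
    Runs [] (E.word.take (multiplex dir r (D.word.take t)).length)
      (u ++ numberedBundle r s.up ++ v) ∧
    u.length = r * p

end VirtualLinks

/-!
# Multiplexing virtual knots

The multiplexing of a knot diagram `D` is studied through *coloured diagrams*.  Every strand of `D`
carries a colour, the list of the components of its `r` parallel copies from left to right with
respect to the orientation; colours stay the same at real crossings and are permuted cyclically by
`rot` or its inverse at virtual ones (`CRuns`).  The multiplexing `mul` of a coloured diagram has
named components.  So the theorem is about colourings: one is needed for every knot diagram, it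
has to be essentially unique, and it has to be carried along the moves without changing the
multiplexing up to equivalence.

**Moves.**  Virtual crossings are only a device to permute strands.  If all strands of a tangle
diagram that meet the same horizontal line have different names, then the diagram is determined up to
equivalence by its ends and the sequence of its pieces other than virtual crossings, its Gauss code
(`TEquiv.of_events_eq`).  If the bundles in a local move consist of strands with different names,
then the code of the multiplexing splits into `r` independent parts, one for each place in the
bundles, and at each place the given move (or nothing) takes place (`Reduces`).  Multiplexings with
arbitrary names result by renaming.  The exchange and the zigzags are treated directly.  This
carries a coloured diagram together with its multiplexing along an equivalence of closed diagrams
(`exists_lift_of_eqvGen`).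

**Existence.**  For a coloured diagram it is enough to count by how many places the strands have
been shifted (`KnotDiagram.exists_colouring`).  The two passages of the knot through a virtual
crossing shift the strands in opposite directions, so that the total shift along the whole knot is
zero (`CRuns.sum_sign_mul`), and each of the parallel strands closes up after one turn.

**Uniqueness.**  A knot is connected, so a colouring is determined by the colour of one strand
(`KnotDiagram.relabel_eq`).  The circles of the multiplexing give names to the strands, hence
another colouring, and the comparison shows that strands of the same component lie on the same
circle (`IsNumberedColouring.exists_classWord_eq`).  The colourings that number the components
from left to right at two base points differ by a cyclic permutation of all colours.  Such a
permutation does not change the multiplexing up to equivalence: insert virtual crossings which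
permute all bundles on a horizontal line, and move the line from one end of the diagram to the
other (`tequiv_mul_relabel_rot`).
-/

namespace VirtualLinks

variable {X Y ι C D : Type}

/-! ### Words of elementary pieces -/

/-- The word `w` drawn with `n` further vertical strands to the left. -/
def shift (n : ℕ) (w : Word X) : Word X := w.map fun l => ⟨n + l.pos, l.elem⟩

@[simp] theorem shift_nil (n : ℕ) : shift n ([] : Word X) = [] := rfl

@[simp] theorem shift_cons (n : ℕ) (l : Letter X) (w : Word X) :
    shift n (l :: w) = ⟨n + l.pos, l.elem⟩ :: shift n w := rfl

@[simp] theorem shift_append (n : ℕ) (w w' : Word X) :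
    shift n (w ++ w') = shift n w ++ shift n w' := by simp [shift]

@[simp] theorem shift_zero (w : Word X) : shift 0 w = w := by simp [shift]

@[simp] theorem shift_shift (m n : ℕ) (w : Word X) : shift m (shift n w) = shift (m + n) w := by
  simp [shift, add_assoc]

@[simp] theorem Strand.flip_flip (s : Strand X) : s.flip.flip = s := by
  cases s; simp [Strand.flip]

theorem Strand.flip_ne (s : Strand X) : s.flip ≠ s := by
  cases s; simp [Strand.flip]

theorem Strand.flip_injective : Function.Injective (Strand.flip : Strand X → Strand X) :=
  Function.LeftInverse.injective Strand.flip_flip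

@[simp] theorem Kind.swap_virt : Kind.swap .virt = .virt := rfl

theorem runs_nil_iff {s t : List (Strand X)} : Runs s [] t ↔ s = t :=
  ⟨fun h => by cases h; rfl, fun h => h ▸ .nil _⟩

theorem runs_cons_iff {s t : List (Strand X)} {l : Letter X} {w : Word X} :
    Runs s (l :: w) t ↔ ∃ u v, s = u ++ l.elem.src ++ v ∧ l.pos = u.length ∧
      Runs (u ++ l.elem.tgt ++ v) w t := by
  constructor
  · rintro ⟨⟩
    exact ⟨_, _, rfl, rfl, by assumption⟩
  · rintro ⟨u, v, rfl, h, h'⟩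
    obtain ⟨i, e⟩ := l
    obtain rfl : i = u.length := h
    exact .cons _ _ _ _ _ h'

theorem runs_append_iff {s t : List (Strand X)} {w w' : Word X} :
    Runs s (w ++ w') t ↔ ∃ m, Runs s w m ∧ Runs m w' t := by
  induction w generalizing s with
  | nil => simp [runs_nil_iff]
  | cons l w ih =>
    simp only [List.cons_append, runs_cons_iff, ih]
    constructor
    · rintro ⟨u, v, h1, h2, m, h3, h4⟩
      exact ⟨m, ⟨u, v, h1, h2, h3⟩, h4⟩
    · rintro ⟨m, ⟨u, v, h1, h2, h3⟩, h4⟩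
      exact ⟨u, v, h1, h2, m, h3, h4⟩

theorem Runs.append {s m t : List (Strand X)} {w w' : Word X} (h : Runs s w m)
    (h' : Runs m w' t) : Runs s (w ++ w') t :=
  runs_append_iff.2 ⟨m, h, h'⟩

theorem Runs.single {u v : List (Strand X)} {e : Elem X} {i : ℕ} (h : i = u.length) :
    Runs (u ++ e.src ++ v) [⟨i, e⟩] (u ++ e.tgt ++ v) :=
  h ▸ .cons _ _ _ _ _ (.nil _)

theorem Runs.single_of_eq {s t u v : List (Strand X)} {e : Elem X} {i : ℕ}
    (hs : s = u ++ e.src ++ v) (h : i = u.length) (ht : t = u ++ e.tgt ++ v) :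
    Runs s [⟨i, e⟩] t :=
  hs ▸ ht ▸ Runs.single h

theorem Runs.cons_of_eq {s t : List (Strand X)} {e : Elem X} {i : ℕ} {w : Word X}
    (u v : List (Strand X)) (hs : s = u ++ e.src ++ v) (h : i = u.length)
    (hw : Runs (u ++ e.tgt ++ v) w t) : Runs s (⟨i, e⟩ :: w) t :=
  hs ▸ h ▸ .cons _ _ _ _ _ hw

theorem Runs.frame {s t : List (Strand X)} {w : Word X} (h : Runs s w t)
    (u v : List (Strand X)) : Runs (u ++ s ++ v) (shift u.length w) (u ++ t ++ v) := by
  induction h with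
  | nil => exact .nil _
  | cons u' v' e w t _ ih =>
    rw [shift_cons, runs_cons_iff]
    exact ⟨u ++ u', v' ++ v, by simp, by simp, by simpa using ih⟩

theorem Runs.frame_right {s t : List (Strand X)} {w : Word X} (h : Runs s w t)
    (v : List (Strand X)) : Runs (s ++ v) w (t ++ v) := by
  simpa using h.frame [] v

theorem Runs.frame_left {s t : List (Strand X)} {w : Word X} (h : Runs s w t)
    (u : List (Strand X)) : Runs (u ++ s) (shift u.length w) (u ++ t) := by
  simpa using h.frame u []

theorem Runs.det {s t t' : List (Strand X)} {w : Word X} (h : Runs s w t) (h' : Runs s w t') :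
    t = t' := by
  induction h with
  | nil => exact runs_nil_iff.1 h'
  | cons u v e w t _ ih =>
    obtain ⟨u', v', h1, h2, h3⟩ := runs_cons_iff.1 h'
    simp only [List.append_assoc] at h1 h2
    obtain ⟨rfl, h4⟩ := List.append_inj h1 h2
    obtain rfl : v = v' := List.append_cancel_left h4
    exact ih h3

/-! ### Equivalence of tangle diagrams -/

/-- Two tangle diagrams with the same ends differ by one local move. -/
def TangleMove (s t : List (Strand X)) (w w' : Word X) : Prop :=
  Runs s w t ∧ Runs s w' t ∧
    ∃ p q a a' : Word X, LocalMove a a' ∧ w = p ++ a ++ q ∧ w' = p ++ a' ++ q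

/-- Equivalence of tangle diagrams with bottom ends `s` and top ends `t`.  For closed diagrams this
is the equivalence relation on links, and it is compatible with stacking and juxtaposition. -/
def TEquiv (s t : List (Strand X)) : Word X → Word X → Prop := Relation.EqvGen (TangleMove s t)

namespace TEquiv

variable {s t s' t' : List (Strand X)} {w w' w'' : Word X}

@[refl] theorem refl (w : Word X) : TEquiv s t w w := Relation.EqvGen.refl _

@[symm] theorem symm (h : TEquiv s t w w') : TEquiv s t w' w := Relation.EqvGen.symm _ _ h

theorem trans (h : TEquiv s t w w') (h' : TEquiv s t w' w'') : TEquiv s t w w'' :=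
  Relation.EqvGen.trans _ _ _ h h'

theorem of_eq (h : w = w') : TEquiv s t w w' := h ▸ Relation.EqvGen.refl _

theorem of_localMove (h : LocalMove w w') (h₁ : Runs s w t) (h₂ : Runs s w' t) :
    TEquiv s t w w' :=
  .rel _ _ ⟨h₁, h₂, [], [], w, w', h, by simp, by simp⟩

theorem append_left (h : TEquiv s t w w') {p : Word X} (hp : Runs s' p s) :
    TEquiv s' t (p ++ w) (p ++ w') := by
  induction h with
  | rel _ _ h =>
    obtain ⟨h1, h2, a, b, c, d, h3, rfl, rfl⟩ := h
    exact .rel _ _ ⟨hp.append h1, hp.append h2, p ++ a, b, c, d, h3, by simp, by simp⟩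
  | refl => exact .refl _
  | symm _ _ _ ih => exact ih.symm
  | trans _ _ _ _ _ ih1 ih2 => exact ih1.trans ih2

theorem append_right (h : TEquiv s t w w') {q : Word X} (hq : Runs t q t') :
    TEquiv s t' (w ++ q) (w' ++ q) := by
  induction h with
  | rel _ _ h =>
    obtain ⟨h1, h2, a, b, c, d, h3, rfl, rfl⟩ := h
    exact .rel _ _ ⟨h1.append hq, h2.append hq, a, b ++ q, c, d, h3, by simp, by simp⟩
  | refl => exact .refl _
  | symm _ _ _ ih => exact ih.symm
  | trans _ _ _ _ _ ih1 ih2 => exact ih1.trans ih2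

theorem congr (h : TEquiv s t w w') {p q : Word X} (hp : Runs s' p s) (hq : Runs t q t') :
    TEquiv s' t' (p ++ (w ++ q)) (p ++ (w' ++ q)) :=
  (h.append_right hq).append_left hp

end TEquiv

theorem LocalMove.shift {a a' : Word X} (h : LocalMove a a') (n : ℕ) :
    LocalMove (shift n a) (shift n a') := by
  cases h with
  | exchange i d e f => simpa [add_assoc] using LocalMove.exchange (n + i) d e f
  | zigzag₁ i s => simpa [add_assoc] using LocalMove.zigzag₁ (n + i) s
  | zigzag₂ i s => simpa [add_assoc] using LocalMove.zigzag₂ (n + i) s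
  | capSlide i k x a => simpa [add_assoc] using LocalMove.capSlide (n + i) k x a
  | cupSlide i k x a => simpa [add_assoc] using LocalMove.cupSlide (n + i) k x a
  | curl₁ i k x => simpa [add_assoc] using LocalMove.curl₁ (n + i) k x
  | curl₂ i k x => simpa [add_assoc] using LocalMove.curl₂ (n + i) k x
  | bigon i k a b => simpa [add_assoc] using LocalMove.bigon (n + i) k a b
  | triangle i k₁ k₂ k₃ a b c h =>
    simpa [add_assoc] using LocalMove.triangle (n + i) k₁ k₂ k₃ a b c h

theorem TEquiv.frame {s t : List (Strand X)} {w w' : Word X} (h : TEquiv s t w w')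
    (u v : List (Strand X)) :
    TEquiv (u ++ s ++ v) (u ++ t ++ v) (shift u.length w) (shift u.length w') := by
  induction h with
  | rel _ _ h =>
    obtain ⟨h1, h2, a, b, c, d, h3, rfl, rfl⟩ := h
    exact .rel _ _ ⟨h1.frame u v, h2.frame u v, shift u.length a, shift u.length b, _, _,
        h3.shift u.length,
      by simp only [shift_append], by simp only [shift_append]⟩
  | refl => exact .refl _
  | symm _ _ _ ih => exact ih.symm
  | trans _ _ _ _ _ ih1 ih2 => exact ih1.trans ih2

theorem TEquiv.frame_right {s t : List (Strand X)} {w w' : Word X} (h : TEquiv s t w w')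
    (v : List (Strand X)) : TEquiv (s ++ v) (t ++ v) w w' := by
  simpa using h.frame [] v

theorem TEquiv.frame_left {s t : List (Strand X)} {w w' : Word X} (h : TEquiv s t w w')
    (u : List (Strand X)) :
    TEquiv (u ++ s) (u ++ t) (shift u.length w) (shift u.length w') := by
  simpa using h.frame u []

/-- A piece may be exchanged with a tangle diagram to the right of it. -/
theorem TEquiv.exchange_piece {t t' : List (Strand X)} {w : Word X} (h : Runs t w t')
    (u m : List (Strand X)) (e : Elem X) :
    TEquiv (u ++ e.src ++ m ++ t) (u ++ e.tgt ++ m ++ t')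
      (⟨u.length, e⟩ :: shift (u ++ e.tgt ++ m).length w)
      (shift (u ++ e.src ++ m).length w ++ [⟨u.length, e⟩]) := by
  induction h with
  | nil => exact .refl _
  | cons a b f w t hw ih =>
    have r1 : Runs (u ++ e.src ++ m ++ (a ++ f.src ++ b))
        [⟨u.length, e⟩, ⟨u.length + e.tgt.length + (m ++ a).length, f⟩]
        (u ++ e.tgt ++ m ++ (a ++ f.tgt ++ b)) :=
      (Runs.single_of_eq (u := u) (v := m ++ a ++ f.src ++ b) (by simp) rfl rfl).append
        (Runs.single_of_eq (u := u ++ e.tgt ++ m ++ a) (v := b) (by simp) (by simp [add_assoc])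
          (by simp))
    have r3 : Runs (u ++ e.src ++ m ++ (a ++ f.src ++ b))
        [⟨u.length + e.src.length + (m ++ a).length, f⟩]
        (u ++ e.src ++ m ++ (a ++ f.tgt ++ b)) :=
      Runs.single_of_eq (u := u ++ e.src ++ m ++ a) (v := b) (by simp) (by simp [add_assoc])
        (by simp)
    have r2 : Runs (u ++ e.src ++ m ++ (a ++ f.src ++ b))
        [⟨u.length + e.src.length + (m ++ a).length, f⟩, ⟨u.length, e⟩]
        (u ++ e.tgt ++ m ++ (a ++ f.tgt ++ b)) :=
      r3.append (Runs.single_of_eq (u := u) (v := m ++ a ++ f.tgt ++ b) (by simp) rfl (by simp))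
    have h1 := (TEquiv.of_localMove (LocalMove.exchange u.length (m ++ a).length e f)
      r1 r2).append_right (hw.frame_left (u ++ e.tgt ++ m))
    have h2 := ih.append_left r3
    simpa [add_assoc] using h1.trans h2

/-- Tangle diagrams side by side may be exchanged. -/
theorem TEquiv.exchange {s s' t t' : List (Strand X)} {w w' : Word X} (h : Runs s w s')
    (h' : Runs t w' t') :
    TEquiv (s ++ t) (s' ++ t') (w ++ shift s'.length w') (shift s.length w' ++ w) := by
  induction h with
  | nil => simpa using TEquiv.refl _
  | cons u v e w s' hw ih =>
    have h1 := ih.append_left (s' := u ++ e.src ++ v ++ t) (p := [⟨u.length, e⟩])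
      (by simpa using Runs.single (u := u) (e := e) (v := v ++ t) rfl)
    have h2 := (TEquiv.exchange_piece h' u v e).append_right (hw.frame_right t')
    simpa using h1.trans (by simpa using h2)

/-! ### Renaming components -/

@[simp] theorem Strand.relabel_up (f : X → Y) (s : Strand X) : (s.relabel f).up = s.up := rfl

@[simp] theorem Strand.relabel_flip (f : X → Y) (s : Strand X) :
    s.flip.relabel f = (s.relabel f).flip := rfl

@[simp] theorem Elem.src_relabel (f : X → Y) (e : Elem X) :
    (e.relabel f).src = e.src.map (Strand.relabel f) := by
  cases e <;> rfl

@[simp] theorem Elem.tgt_relabel (f : X → Y) (e : Elem X) :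
    (e.relabel f).tgt = e.tgt.map (Strand.relabel f) := by
  cases e <;> rfl

@[simp] theorem relabel_nil (f : X → Y) : Word.relabel f ([] : Word X) = [] := rfl

@[simp] theorem relabel_cons (f : X → Y) (l : Letter X) (w : Word X) :
    Word.relabel f (l :: w) = ⟨l.pos, l.elem.relabel f⟩ :: Word.relabel f w := rfl

@[simp] theorem relabel_append (f : X → Y) (w w' : Word X) :
    Word.relabel f (w ++ w') = Word.relabel f w ++ Word.relabel f w' := by
  simp [Word.relabel]

theorem relabel_relabel {Z : Type} (f : X → Y) (g : Y → Z) (w : Word X) :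
    Word.relabel g (Word.relabel f w) = Word.relabel (g ∘ f) w := by
  simp only [Word.relabel, List.map_map]
  refine List.map_congr_left fun l _ => ?_
  obtain ⟨_, _ | _ | _⟩ := l <;> rfl

@[simp] theorem length_relabel (f : X → Y) (w : Word X) :
    (Word.relabel f w).length = w.length := by
  simp [Word.relabel]

@[simp] theorem relabel_shift (f : X → Y) (n : ℕ) (w : Word X) :
    Word.relabel f (shift n w) = shift n (Word.relabel f w) := by
  simp [Word.relabel, shift]

theorem Runs.relabel {s t : List (Strand X)} {w : Word X} (h : Runs s w t) (f : X → Y) :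
    Runs (s.map (Strand.relabel f)) (Word.relabel f w) (t.map (Strand.relabel f)) := by
  induction h with
  | nil => exact .nil _
  | cons u v e w t _ ih =>
    rw [relabel_cons, runs_cons_iff]
    exact ⟨u.map (Strand.relabel f), v.map (Strand.relabel f), by simp, by simp, by simpa using ih⟩

theorem LocalMove.relabel {a a' : Word X} (h : LocalMove a a') (f : X → Y) :
    LocalMove (Word.relabel f a) (Word.relabel f a') := by
  cases h with
  | exchange i d e g =>
    simpa using LocalMove.exchange i d (e.relabel f) (g.relabel f)
  | zigzag₁ i s => exact .zigzag₁ i (s.relabel f)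
  | zigzag₂ i s => exact .zigzag₂ i (s.relabel f)
  | capSlide i k x a => exact .capSlide i k (x.relabel f) (a.relabel f)
  | cupSlide i k x a => exact .cupSlide i k (x.relabel f) (a.relabel f)
  | curl₁ i k x => exact .curl₁ i k (x.relabel f)
  | curl₂ i k x => exact .curl₂ i k (x.relabel f)
  | bigon i k a b => exact .bigon i k (a.relabel f) (b.relabel f)
  | triangle i k₁ k₂ k₃ a b c h =>
    exact .triangle i k₁ k₂ k₃ (a.relabel f) (b.relabel f) (c.relabel f) h

theorem TEquiv.relabel {s t : List (Strand X)} {w w' : Word X} (h : TEquiv s t w w')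
    (f : X → Y) :
    TEquiv (s.map (Strand.relabel f)) (t.map (Strand.relabel f)) (Word.relabel f w)
      (Word.relabel f w') := by
  induction h with
  | rel _ _ h =>
    obtain ⟨h1, h2, a, b, c, d, h3, rfl, rfl⟩ := h
    exact .rel _ _ ⟨h1.relabel f, h2.relabel f, Word.relabel f a, Word.relabel f b, _, _,
        h3.relabel f,
      by simp only [relabel_append], by simp only [relabel_append]⟩
  | refl => exact .refl _
  | symm _ _ _ ih => exact ih.symm
  | trans _ _ _ _ _ ih1 ih2 => exact ih1.trans ih2

/-! ### Virtual crossings as a symmetry -/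

/-- Virtual crossings. -/
def Elem.isVirtual : Elem X → Bool
  | .cross .virt _ _ => true
  | _ => false

/-- The pieces of a diagram other than virtual crossings, from bottom to top: the Gauss code of the
diagram if all strands that occur in it have different names. -/
def events (w : Word X) : List (Elem X) := (w.map Letter.elem).filter fun e => !e.isVirtual

@[simp] theorem events_nil : events ([] : Word X) = [] := rfl

@[simp] theorem events_append (w w' : Word X) : events (w ++ w') = events w ++ events w' := by
  simp [events]

@[simp] theorem events_shift (n : ℕ) (w : Word X) : events (shift n w) = events w := by
  simp [events, shift, Function.comp_def]

theorem events_cons (l : Letter X) (w : Word X) :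
    events (l :: w) = (if l.elem.isVirtual then [] else [l.elem]) ++ events w := by
  simp only [events, List.map_cons, List.filter_cons]
  cases l.elem.isVirtual <;> simp

@[simp] theorem events_virt (i : ℕ) (a b : Strand X) (w : Word X) :
    events (⟨i, .cross .virt a b⟩ :: w) = events w := rfl

@[simp] theorem events_cup (i : ℕ) (a : Strand X) (w : Word X) :
    events (⟨i, .cup a⟩ :: w) = .cup a :: events w := rfl

@[simp] theorem events_cap (i : ℕ) (a : Strand X) (w : Word X) :
    events (⟨i, .cap a⟩ :: w) = .cap a :: events w := rfl

theorem events_cross {k : Kind} (hk : k ≠ .virt) (i : ℕ) (a b : Strand X) (w : Word X) :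
    events (⟨i, .cross k a b⟩ :: w) = .cross k a b :: events w := by
  cases k <;> first | rfl | exact absurd rfl hk

theorem events_eq_nil_cons {l : Letter X} {w : Word X} (h : events (l :: w) = []) :
    (∃ a b, l.elem = .cross .virt a b) ∧ events w = [] := by
  obtain ⟨i, e⟩ := l
  rcases e with s | s | ⟨_ | _ | _, a, b⟩ <;> simp [events_cons, Elem.isVirtual] at h ⊢
  exact h

/-- The strand `x`, to the right of the strands `u`, moves to the left of them by virtual
crossings. -/
def front : List (Strand X) → Strand X → Word X
  | [], _ => []
  | y :: u, x => shift 1 (front u x) ++ [⟨0, .cross .virt y x⟩]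

theorem runs_front (u : List (Strand X)) (x : Strand X) : Runs (u ++ [x]) (front u x) (x :: u) := by
  induction u with
  | nil => exact .nil _
  | cons y u ih =>
    exact Runs.append (ih.frame_left [y]) (Runs.single_of_eq (u := []) (v := u) rfl rfl rfl)

@[simp] theorem events_front (u : List (Strand X)) (x : Strand X) : events (front u x) = [] := by
  induction u with
  | nil => rfl
  | cons y u ih => simp [front, ih]

theorem front_append (u v : List (Strand X)) (x : Strand X) :
    front (u ++ v) x = shift u.length (front v x) ++ front u x := by
  induction u with
  | nil => simp [front]
  | cons y u ih => simp [front, ih, add_comm]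

theorem TEquiv.bigon (k : Kind) (a b : Strand X) :
    TEquiv [a, b] [a, b] [⟨0, .cross k a b⟩, ⟨0, .cross k.swap b a⟩] [] :=
  .of_localMove (.bigon 0 k a b)
    (.cons_of_eq [] [] rfl rfl (.cons_of_eq [] [] rfl rfl (.nil _))) (.nil _)

theorem TEquiv.capSlide (k : Kind) (x a : Strand X) :
    TEquiv [x, a, x.flip] [a] [⟨0, .cross k x a⟩, ⟨1, .cap x⟩]
      [⟨1, .cross k.swap a x.flip⟩, ⟨0, .cap x⟩] :=
  .of_localMove (.capSlide 0 k x a)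
    (.cons_of_eq [] [x.flip] rfl rfl (.cons_of_eq [a] [] rfl rfl (.nil _)))
    (.cons_of_eq [x] [] rfl rfl (.cons_of_eq [] [a] rfl rfl (.nil _)))

theorem TEquiv.cupSlide (k : Kind) (x a : Strand X) :
    TEquiv [a] [x, a, x.flip] [⟨1, .cup x⟩, ⟨0, .cross k a x⟩]
      [⟨0, .cup x⟩, ⟨1, .cross k.swap x.flip a⟩] :=
  .of_localMove (.cupSlide 0 k x a)
    (.cons_of_eq [a] [] rfl rfl (.cons_of_eq [] [x.flip] rfl rfl (.nil _)))
    (.cons_of_eq [] [a] rfl rfl (.cons_of_eq [x] [] rfl rfl (.nil _)))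

/-- A strand passes behind an elementary piece by virtual crossings. -/
theorem TEquiv.front_elem (e : Elem X) (x : Strand X) :
    TEquiv (e.src ++ [x]) (x :: e.tgt) (⟨0, e⟩ :: front e.tgt x) (front e.src x ++ [⟨1, e⟩]) := by
  have r1 : Runs (e.src ++ [x]) (⟨0, e⟩ :: front e.tgt x) (x :: e.tgt) :=
    .cons_of_eq [] [x] rfl rfl (runs_front e.tgt x)
  have r2 : Runs (e.src ++ [x]) (front e.src x ++ [⟨1, e⟩]) (x :: e.tgt) :=
    (runs_front e.src x).append (.single_of_eq (u := [x]) (v := []) (by simp) rfl (by simp))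
  cases e with
  | cup s =>
    have h := (TEquiv.cupSlide .virt s x).append_right (q := [⟨0, .cross .virt s x⟩])
      (.cons_of_eq [] [s.flip] rfl rfl (.nil _))
    have h' := ((TEquiv.bigon .virt x s).frame_right [s.flip]).append_left (p := [⟨1, .cup s⟩])
      (.cons_of_eq [x] [] rfl rfl (.nil _))
    exact h.symm.trans h'
  | cap s =>
    have h := (TEquiv.capSlide .virt s x).append_left (p := [⟨1, .cross .virt s.flip x⟩])
      (.cons_of_eq [s] [] rfl rfl (.nil _))
    have h' := ((TEquiv.bigon .virt s.flip x).frame_left [s]).append_right (q := [⟨0, .cap s⟩])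
      (.cons_of_eq [] [x] rfl rfl (.nil _))
    exact h'.symm.trans h.symm
  | cross k a b =>
    exact .of_localMove (.triangle 0 k .virt .virt a b x (by cases k <;> trivial)) r1 r2

/-- A strand passes behind a tangle diagram by virtual crossings. -/
theorem TEquiv.front_natural {s t : List (Strand X)} {w : Word X} (h : Runs s w t)
    (x : Strand X) : TEquiv (s ++ [x]) (x :: t) (w ++ front t x) (front s x ++ shift 1 w) := by
  induction h with
  | nil => simpa using TEquiv.refl _
  | cons u v e w t hw ih =>
    have r0 : Runs (u ++ e.src ++ v ++ [x]) [⟨u.length, e⟩] (u ++ e.tgt ++ v ++ [x]) :=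
      .single_of_eq (u := u) (v := v ++ [x]) (by simp) rfl (by simp)
    have r1 : Runs (u ++ e.src ++ v ++ [x]) (shift (u.length + e.src.length) (front v x))
        (u ++ (e.src ++ [x]) ++ v) := by
      simpa using (runs_front v x).frame_left (u ++ e.src)
    have r2 : Runs (u ++ (x :: e.tgt) ++ v) (front u x) (x :: (u ++ e.tgt ++ v)) := by
      simpa using (runs_front u x).frame_right (e.tgt ++ v)
    have r3 : Runs (u ++ e.tgt ++ [x] ++ v) (shift u.length (front e.tgt x))
        (u ++ (x :: e.tgt) ++ v) := by
      simpa using (runs_front e.tgt x).frame u v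
    have r4 : Runs (u ++ (e.src ++ [x]) ++ v) (shift u.length (front e.src x))
        (u ++ (x :: e.src) ++ v) := by
      simpa using (runs_front e.src x).frame u v
    have r5 : Runs (x :: (u ++ e.tgt ++ v)) (shift 1 w) (x :: t) := by
      simpa using hw.frame_left [x]
    have h0 := ih.append_left r0
    have h1 := (TEquiv.exchange_piece (runs_front v x) u [] e).append_right
      (by simpa using ((r3.append r2).append r5))
    have h2 := ((TEquiv.front_elem e x).frame u v).congr r1 (r2.append r5)
    have h3 := ((TEquiv.exchange (runs_front u x)
      (Runs.single (u := []) (v := []) (e := e) rfl)).frame_right v).symm.congr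
        (r1.append (by simpa using r4)) (by simpa using r5)
    simp only [front_append, shift_append, shift_shift, List.append_assoc, List.nil_append,
      List.append_nil, List.cons_append, shift_cons, shift_nil, List.length_append,
      List.length_cons, List.length_nil, Nat.add_zero, Nat.zero_add,
          Nat.add_comm 1] at h0 h1 h2 h3 ⊢
    exact h0.trans (h1.trans (h2.trans h3))

/-- Virtual diagrams in normal form: the strands are brought to their places at the top one after
the other, from left to right. -/
inductive NormalForm : List (Strand X) → Word X → List (Strand X) → Prop
  | nil : NormalForm [] [] []
  | cons (u v : List (Strand X)) (x : Strand X) (w : Word X) (t : List (Strand X)) :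
      NormalForm (u ++ v) w t → NormalForm (u ++ x :: v) (front u x ++ shift 1 w) (x :: t)

theorem runs_front_frame (u v : List (Strand X)) (x : Strand X) :
    Runs (u ++ x :: v) (front u x) (x :: (u ++ v)) := by
  simpa using (runs_front u x).frame_right v

namespace NormalForm

theorem runs {s t : List (Strand X)} {w : Word X} (h : NormalForm s w t) : Runs s w t := by
  induction h with
  | nil => exact .nil _
  | cons u v x w t _ ih => exact (runs_front_frame u v x).append (by simpa using ih.frame_left [x])

theorem eq_nil {s t : List (Strand X)} {w : Word X} (h : NormalForm s w t) (ht : t = []) :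
    w = [] := by
  cases h with
  | nil => rfl
  | cons => simp at ht

theorem unique {s t : List (Strand X)} {w w' : Word X} (h : NormalForm s w t) (hs : s.Nodup)
    (h' : NormalForm s w' t) : w = w' := by
  induction h generalizing w' with
  | nil =>
    exact (h'.eq_nil rfl).symm
  | cons u v x w t _ ih =>
    generalize hs' : u ++ x :: v = s' at h'
    cases h' with
    | cons u' v' _ w' _ h' =>
      have hx : x ∉ u := fun hx => by
        rw [List.nodup_append] at hs
        exact hs.2.2 x hx x (by simp) rfl
      have hx' : x ∉ u' := fun hx => by
        rw [hs', List.nodup_append] at hs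
        exact hs.2.2 x hx x (by simp) rfl
      obtain ⟨rfl, rfl⟩ : u = u' ∧ v = v' := by
        rcases List.append_eq_append_iff.1 hs' with ⟨a, h1, h2⟩ | ⟨a, h1, h2⟩
        · cases a with
          | nil => simp_all
          | cons y a => simp_all
        · cases a with
          | nil => simp_all
          | cons y a => simp_all
      rw [ih (by rw [List.nodup_middle] at hs; exact (List.nodup_cons.1 hs).2) h']

theorem self (s : List (Strand X)) : NormalForm s [] s := by
  induction s with
  | nil => exact .nil
  | cons x s ih => exact .cons [] s x [] s ih

end NormalForm

theorem TEquiv.cancel_front (u : List (Strand X)) (a b : Strand X) (v : List (Strand X)) :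
    TEquiv (u ++ a :: b :: v) (a :: (u ++ b :: v))
      (⟨u.length, .cross .virt a b⟩ :: front (u ++ [b]) a) (front u a) := by
  have h := ((TEquiv.bigon .virt a b).frame u v).append_right (q := front u a)
    (t' := a :: (u ++ b :: v)) (by simpa using runs_front_frame u (b :: v) a)
  simpa [front_append, front] using h

/-- A virtual crossing in front of a diagram in normal form. -/
theorem NormalForm.step {s t : List (Strand X)} {w : Word X} (h : NormalForm s w t)
    (p q : List (Strand X)) (a b : Strand X) (hs : s = p ++ b :: a :: q) :
    ∃ w', NormalForm (p ++ a :: b :: q) w' t ∧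
      TEquiv (p ++ a :: b :: q) t (⟨p.length, .cross .virt a b⟩ :: w) w' := by
  induction h generalizing p q with
  | nil => simp at hs
  | cons u v x w t hw ih =>
    have hr := hw.runs.frame_left [x]
    rcases List.append_eq_append_iff.1 hs with ⟨c, h1, h2⟩ | ⟨c, h1, h2⟩
    · -- `x` lies to the left of the crossing or is its left upper end
      cases c with
      | nil =>
        simp only [List.append_nil, List.nil_append, List.cons.injEq] at h1 h2
        obtain ⟨rfl, rfl⟩ := h2
        subst h1
        refine ⟨_, by simpa using NormalForm.cons (p ++ [a]) q x w t (by simpa using hw), ?_⟩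
        simp only [front_append, front]
        simpa using TEquiv.refl _
      | cons y c =>
        simp only [List.cons_append, List.cons.injEq] at h2
        obtain ⟨rfl, rfl⟩ := h2
        subst h1
        obtain ⟨w', h3, h4⟩ := ih (u ++ c) q (by simp)
        refine ⟨_, by simpa using NormalForm.cons u (c ++ a :: b :: q) x w' t (by simpa using h3),
            ?_⟩
        have h5 := (TEquiv.exchange (runs_front u x)
          (Runs.single (u := c) (e := .cross .virt a b) (v := q) rfl)).symm.append_right
          (q := shift 1 w) (t' := x :: t) (by simpa [Elem.tgt] using hr)
        have h6 := (h4.frame_left [x]).append_left (s' := u ++ x :: (c ++ a :: b :: q))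
          (p := front u x) (by simpa using runs_front_frame u (c ++ a :: b :: q) x)
        simp [Elem.src, add_assoc, add_comm 1] at h5 h6 ⊢
        exact h5.trans h6
    · cases c with
      | nil =>
        simp only [List.append_nil, List.nil_append, List.cons.injEq] at h1 h2
        obtain ⟨rfl, rfl⟩ := h2
        subst h1
        refine ⟨_, by simpa using NormalForm.cons (u ++ [a]) q b w t (by simpa using hw), ?_⟩
        simp only [front_append, front]
        simpa using TEquiv.refl _
      | cons y c =>
        simp only [List.cons_append, List.cons.injEq] at h2
        obtain ⟨rfl, h2⟩ := h2
        cases c with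
        | nil =>
          simp only [List.nil_append, List.cons.injEq] at h2
          obtain ⟨rfl, rfl⟩ := h2
          subst h1
          refine ⟨_, NormalForm.cons p (b :: q) a w t (by simpa using hw), ?_⟩
          have h5 := (TEquiv.cancel_front p a b q).append_right (q := shift 1 w) (t' := a :: t)
            (by simpa using hr)
          simpa using h5
        | cons z c =>
          simp only [List.cons_append, List.cons.injEq] at h2
          obtain ⟨rfl, rfl⟩ := h2
          subst h1
          obtain ⟨w', h3, h4⟩ := ih p (c ++ v) (by simp)
          refine ⟨_, by simpa using
            NormalForm.cons (p ++ a :: b :: c) v x w' t (by simpa using h3), ?_⟩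
          have h5 := ((TEquiv.front_natural (Runs.single (u := p) (e := .cross .virt a b) (v := c)
            rfl) x).frame_right v).append_right (q := shift 1 w) (t' := x :: t)
            (by simpa [Elem.tgt] using hr)
          have h6 := (h4.frame_left [x]).append_left (s' := p ++ a :: b :: (c ++ x :: v))
            (p := front (p ++ a :: b :: c) x)
            (by simpa using runs_front_frame (p ++ a :: b :: c) v x)
          simp [Elem.src, Elem.tgt, add_comm 1] at h5 h6 ⊢
          exact h5.trans h6

theorem NormalForm.exists_of_runs {s t : List (Strand X)} {w : Word X} (h : Runs s w t)
    (hw : events w = []) : ∃ w', NormalForm s w' t ∧ TEquiv s t w w' := by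
  induction h with
  | nil s => exact ⟨[], .self s, .refl _⟩
  | cons u v e w t hr ih =>
    obtain ⟨⟨a, b, rfl⟩, hw⟩ := events_eq_nil_cons hw
    obtain ⟨w', h1, h2⟩ := ih hw
    obtain ⟨w'', h3, h4⟩ := h1.step u v a b (by simp [Elem.tgt])
    refine ⟨w'', by simpa [Elem.src] using h3, ?_⟩
    have h5 := h2.append_left (p := [⟨u.length, .cross .virt a b⟩]) (Runs.single rfl)
    refine h5.trans ?_
    simpa [Elem.src] using h4

/-- Two diagrams with virtual crossings only are equivalent if they permute the strands in the same
way, that is, if they have the same ends and all strands have different names. -/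
theorem TEquiv.of_virtual {s t : List (Strand X)} {w w' : Word X} (hs : s.Nodup)
    (h : Runs s w t) (h' : Runs s w' t) (hw : events w = []) (hw' : events w' = []) :
    TEquiv s t w w' := by
  obtain ⟨v, h1, h2⟩ := NormalForm.exists_of_runs h hw
  obtain ⟨v', h3, h4⟩ := NormalForm.exists_of_runs h' hw'
  obtain rfl := h1.unique hs h3
  exact h2.trans h4.symm

theorem exists_virtual_of_perm {s t : List (Strand X)} (h : s.Perm t) :
    ∃ w, Runs s w t ∧ events w = [] := by
  induction h with
  | nil => exact ⟨[], .nil _, rfl⟩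
  | cons x _ ih =>
    obtain ⟨w, h1, h2⟩ := ih
    exact ⟨shift 1 w, h1.frame_left [x], by simpa using h2⟩
  | swap a b l =>
    exact ⟨[⟨0, .cross .virt b a⟩], .cons_of_eq [] l rfl rfl (.nil _), rfl⟩
  | trans _ _ ih1 ih2 =>
    obtain ⟨w, h1, h2⟩ := ih1
    obtain ⟨w', h3, h4⟩ := ih2
    exact ⟨w ++ w', h1.append h3, by simp [h2, h4]⟩

theorem Runs.perm_of_virtual {s t : List (Strand X)} {w : Word X} (h : Runs s w t)
    (hw : events w = []) : s.Perm t := by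
  induction h with
  | nil => rfl
  | cons u v e w t hr ih =>
    obtain ⟨⟨a, b, rfl⟩, hw⟩ := events_eq_nil_cons hw
    exact (((List.Perm.swap b a []).append_left u).append_right v).trans (ih hw)

/-! ### A diagram is determined by its Gauss code -/

/-- `Runs s w t`, where on every horizontal line all strands have different names. -/
inductive NRuns : List (Strand X) → Word X → List (Strand X) → Prop
  | nil (s : List (Strand X)) : s.Nodup → NRuns s [] s
  | cons (u v : List (Strand X)) (e : Elem X) (w : Word X) (t : List (Strand X)) :
      (u ++ e.src ++ v).Nodup → NRuns (u ++ e.tgt ++ v) w t →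
        NRuns (u ++ e.src ++ v) (⟨u.length, e⟩ :: w) t

namespace NRuns

theorem runs {s t : List (Strand X)} {w : Word X} (h : NRuns s w t) : Runs s w t := by
  induction h with
  | nil => exact .nil _
  | cons u v e w t _ _ ih => exact .cons _ _ _ _ _ ih

theorem nodup_left {s t : List (Strand X)} {w : Word X} (h : NRuns s w t) : s.Nodup := by
  cases h <;> assumption

theorem nodup_right {s t : List (Strand X)} {w : Word X} (h : NRuns s w t) : t.Nodup := by
  induction h <;> assumption

theorem append {s m t : List (Strand X)} {w w' : Word X} (h : NRuns s w m)
    (h' : NRuns m w' t) : NRuns s (w ++ w') t := by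
  induction h with
  | nil => exact h'
  | cons u v e w t hs _ ih => exact .cons _ _ _ _ _ hs (ih h')

theorem of_append {s t : List (Strand X)} {w w' : Word X} (h : NRuns s (w ++ w') t) :
    ∃ m, NRuns s w m ∧ NRuns m w' t := by
  induction w generalizing s with
  | nil => exact ⟨s, .nil _ h.nodup_left, h⟩
  | cons l w ih =>
    rw [List.cons_append] at h
    cases h with
    | cons u v e w t hs h =>
      obtain ⟨m, h1, h2⟩ := ih h
      exact ⟨m, .cons _ _ _ _ _ hs h1, h2⟩

theorem of_virtual {s t : List (Strand X)} {w : Word X} (h : Runs s w t) (hw : events w = [])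
    (hs : s.Nodup) : NRuns s w t := by
  induction h with
  | nil => exact .nil _ hs
  | cons u v e w t hr ih =>
    obtain ⟨⟨a, b, rfl⟩, hw⟩ := events_eq_nil_cons hw
    exact .cons _ _ _ _ _ hs
      (ih hw ((((List.Perm.swap b a []).append_left u).append_right v).nodup hs))

/-- The first piece that is not a virtual crossing. -/
theorem split {s t : List (Strand X)} {w : Word X} (h : NRuns s w t) {e : Elem X}
    {E : List (Elem X)} (hw : events w = e :: E) :
    ∃ (p : Word X) (u v : List (Strand X)) (w' : Word X),
      w = p ++ ⟨u.length, e⟩ :: w' ∧ events p = [] ∧ events w' = E ∧ e.isVirtual = false ∧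
      Runs s p (u ++ e.src ++ v) ∧ (u ++ e.src ++ v).Nodup ∧ NRuns (u ++ e.tgt ++ v) w' t := by
  induction h with
  | nil => simp at hw
  | cons u v f w t hs hr ih =>
    rw [events_cons] at hw
    by_cases hf : f.isVirtual
    · simp only [hf, if_true, List.nil_append] at hw
      obtain ⟨p, u', v', w', rfl, h1, h2, h3, h4, h5, h6⟩ := ih hw
      exact ⟨⟨u.length, f⟩ :: p, u', v', w', rfl, by simp [events_cons, hf, h1], h2, h3,
        .cons _ _ _ _ _ h4, h5, h6⟩
    · simp only [hf] at hw
      simp only [Bool.false_eq_true, if_false, List.cons_append, List.nil_append,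
        List.cons.injEq] at hw
      obtain ⟨rfl, rfl⟩ := hw
      exact ⟨[], u, v, w, rfl, rfl, rfl, by simpa using hf, .nil _, hs, hr⟩

end NRuns

/-- The strands `v`, to the right of the strands `s`, move to the left of them by virtual
crossings. -/
def blockSwap (s : List (Strand X)) : List (Strand X) → Word X
  | [] => []
  | x :: v => front s x ++ shift 1 (blockSwap s v)

theorem runs_blockSwap (s v : List (Strand X)) : Runs (s ++ v) (blockSwap s v) (v ++ s) := by
  induction v with
  | nil => simpa [blockSwap] using Runs.nil _
  | cons x v ih => exact (runs_front_frame s v x).append (by simpa using ih.frame_left [x])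

@[simp] theorem events_blockSwap (s v : List (Strand X)) : events (blockSwap s v) = [] := by
  induction v with
  | nil => rfl
  | cons x v ih => simp [blockSwap, ih]

theorem TEquiv.blockSwap_natural {s t : List (Strand X)} {w : Word X} (h : Runs s w t)
    (v : List (Strand X)) :
    TEquiv (s ++ v) (v ++ t) (w ++ blockSwap t v) (blockSwap s v ++ shift v.length w) := by
  induction v with
  | nil => simpa [blockSwap] using TEquiv.refl _
  | cons x v ih =>
    have h1 := ((TEquiv.front_natural h x).frame_right v).append_right
      (q := shift 1 (blockSwap t v)) (t' := x :: (v ++ t))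
      (by simpa using (runs_blockSwap t v).frame_left [x])
    have h2 := (ih.frame_left [x]).append_left (s' := s ++ x :: v) (p := front s x)
      (by simpa using runs_front_frame s v x)
    simp only [List.append_assoc, List.singleton_append, List.length_cons, List.length_nil,
      Nat.zero_add, shift_append, shift_shift, Nat.add_comm 1, blockSwap] at h1 h2 ⊢
    exact h1.trans h2

/-- A piece commutes with permutations of the other strands by virtual crossings. -/
theorem TEquiv.virtual_natural (e : Elem X) {u₁ v₁ u₂ v₂ : List (Strand X)} {p p' : Word X}
    (hs : (u₁ ++ e.src ++ v₁).Nodup) (ht : (u₁ ++ e.tgt ++ v₁).Nodup)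
    (huv : (u₁ ++ v₁).Perm (u₂ ++ v₂))
    (hp : Runs (u₁ ++ e.src ++ v₁) p (u₂ ++ e.src ++ v₂)) (hpv : events p = [])
    (hp' : Runs (u₁ ++ e.tgt ++ v₁) p' (u₂ ++ e.tgt ++ v₂)) (hpv' : events p' = []) :
    TEquiv (u₁ ++ e.src ++ v₁) (u₂ ++ e.tgt ++ v₂) (⟨u₁.length, e⟩ :: p')
      (p ++ [⟨u₂.length, e⟩]) := by
  have he : ∀ u v : List (Strand X), Runs (u ++ e.src ++ v) [⟨u.length, e⟩] (u ++ e.tgt ++ v) :=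
    fun u v => .single rfl
  have he0 : Runs e.src [⟨0, e⟩] e.tgt := by simpa using he [] []
  have heR : ∀ u : List (Strand X), Runs (u ++ e.src) [⟨u.length, e⟩] (u ++ e.tgt) :=
    fun u => by simpa using he u []
  have B : ∀ u v r : List (Strand X), Runs (u ++ r ++ v) (shift u.length (blockSwap r v))
      (u ++ v ++ r) := fun u v r => by simpa using (runs_blockSwap r v).frame_left u
  have sq : ∀ u v : List (Strand X), TEquiv (u ++ e.src ++ v) (u ++ v ++ e.tgt)
      ([⟨u.length, e⟩] ++ shift u.length (blockSwap e.tgt v))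
      (shift u.length (blockSwap e.src v) ++ [⟨(u ++ v).length, e⟩]) := fun u v => by
    simpa using (TEquiv.blockSwap_natural he0 v).frame_left u
  obtain ⟨V, hV, hVv⟩ := exists_virtual_of_perm huv
  have pr : ∀ r : List (Strand X), (u₂ ++ v₂ ++ r).Perm (u₂ ++ r ++ v₂) := fun r => by
    simpa using List.perm_append_comm.append_left u₂
  obtain ⟨R, hR, hRv⟩ := exists_virtual_of_perm (pr e.src)
  obtain ⟨R', hR', hRv'⟩ := exists_virtual_of_perm (pr e.tgt)
  have hs2 : (u₂ ++ e.src ++ v₂).Nodup := (hp.perm_of_virtual hpv).nodup hs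
  have ht2 : (u₂ ++ e.tgt ++ v₂).Nodup := (hp'.perm_of_virtual hpv').nodup ht
  have hs2' : (u₂ ++ v₂ ++ e.src).Nodup := (pr e.src).symm.nodup hs2
  -- the two ways to permute the strands agree above and below the piece
  have c1 : TEquiv (u₁ ++ e.tgt ++ v₁) (u₂ ++ e.tgt ++ v₂) p'
      (shift u₁.length (blockSwap e.tgt v₁) ++ (V ++ R')) :=
    .of_virtual ht hp' ((B _ _ _).append ((hV.frame_right e.tgt).append hR')) hpv'
      (by simp [hVv, hRv'])
  have c2 : TEquiv (u₁ ++ e.src ++ v₁) (u₂ ++ e.src ++ v₂)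
      (shift u₁.length (blockSwap e.src v₁) ++ (V ++ R)) p :=
    .of_virtual hs ((B _ _ _).append ((hV.frame_right e.src).append hR)) hp
      (by simp [hVv, hRv]) hpv
  have c3 : TEquiv (u₂ ++ v₂ ++ e.src) (u₂ ++ v₂ ++ e.src) []
      (R ++ shift u₂.length (blockSwap e.src v₂)) :=
    .of_virtual hs2' (.nil _) (hR.append (B _ _ _)) rfl (by simp [hRv])
  have c4 : TEquiv (u₂ ++ e.tgt ++ v₂) (u₂ ++ e.tgt ++ v₂)
      (shift u₂.length (blockSwap e.tgt v₂) ++ R') [] :=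
    .of_virtual ht2 ((B _ _ _).append hR') (.nil _) (by simp [hRv']) rfl
  have d : TEquiv (u₂ ++ v₂ ++ e.src) (u₂ ++ e.tgt ++ v₂) ([⟨(u₂ ++ v₂).length, e⟩] ++ R')
      (R ++ [⟨u₂.length, e⟩]) := by
    have d1 := c3.append_right ((heR (u₂ ++ v₂)).append hR')
    have d2 := (sq u₂ v₂).symm.congr hR hR'
    have d3 := c4.append_left (hR.append (he u₂ v₂))
    simp only [List.append_assoc, List.nil_append, List.append_nil] at d1 d2 d3 ⊢
    exact d1.trans (d2.trans d3)
  have f1 := c1.append_left (he u₁ v₁)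
  have f2 := (sq u₁ v₁).append_right ((hV.frame_right e.tgt).append hR')
  have f3 := (TEquiv.exchange hV he0).symm.congr (B u₁ v₁ e.src) hR'
  have f4 := d.append_left ((B u₁ v₁ e.src).append (hV.frame_right e.src))
  have f5 := c2.append_right (he u₂ v₂)
  simp only [List.append_assoc, List.nil_append, shift_cons, shift_nil, Nat.add_zero,
    List.cons_append] at f1 f2 f3 f4 f5 ⊢
  exact f1.trans (f2.trans (f3.trans (f4.trans f5)))

/-- Two diagrams with the same Gauss code and the same top ends are equivalent, up to a permutation
of the bottom ends by virtual crossings. -/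
theorem TEquiv.of_events {s₁ s₂ t : List (Strand X)} {w₁ w₂ V : Word X} (h₁ : NRuns s₁ w₁ t)
    (h₂ : NRuns s₂ w₂ t) (hV : Runs s₁ V s₂) (hVv : events V = [])
    (he : events w₁ = events w₂) : TEquiv s₁ t w₁ (V ++ w₂) := by
  generalize hE : events w₁ = E at he
  induction E generalizing s₁ s₂ w₁ w₂ V with
  | nil => exact .of_virtual h₁.nodup_left h₁.runs (hV.append h₂.runs) hE (by simp [hVv, ← he])
  | cons e E ih =>
    obtain ⟨p₁, u₁, v₁, w₁, rfl, a₁, b₁, c₁, d₁, f₁, g₁⟩ := h₁.split hE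
    obtain ⟨p₂, u₂, v₂, w₂, rfl, a₂, b₂, c₂, d₂, f₂, g₂⟩ := h₂.split he.symm
    have hs : (u₁ ++ e.src ++ v₁).Perm (u₂ ++ e.src ++ v₂) :=
      ((d₁.perm_of_virtual a₁).symm.trans (hV.perm_of_virtual hVv)).trans (d₂.perm_of_virtual a₂)
    have pr : ∀ u r v : List (Strand X), (u ++ r ++ v).Perm (r ++ (u ++ v)) := fun u r v => by
      simpa using (List.perm_append_comm (l₁ := u) (l₂ := r)).append_right v
    have huv : (u₁ ++ v₁).Perm (u₂ ++ v₂) :=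
      (List.perm_append_left_iff e.src).1 (((pr _ _ _).symm.trans hs).trans (pr _ _ _))
    have ht : (u₁ ++ e.tgt ++ v₁).Perm (u₂ ++ e.tgt ++ v₂) :=
      ((pr _ _ _).trans (huv.append_left e.tgt)).trans (pr _ _ _).symm
    obtain ⟨p, hp, hpv⟩ := exists_virtual_of_perm hs
    obtain ⟨p', hp', hpv'⟩ := exists_virtual_of_perm ht
    have k1 := (ih g₁ g₂ hp' hpv' b₁ b₂.symm).append_left
      (d₁.append (Runs.single (u := u₁) (v := v₁) (e := e) rfl))
    have k2 := (TEquiv.virtual_natural e f₁ g₁.nodup_left huv hp hpv hp' hpv').congr d₁ g₂.runs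
    have k3 := (TEquiv.of_virtual h₁.nodup_left (d₁.append hp) (hV.append d₂)
      (by simp [a₁, hpv]) (by simp [a₂, hVv])).append_right
      ((Runs.single (u := u₂) (v := v₂) (e := e) rfl).append g₂.runs)
    simp only [List.append_assoc, List.cons_append, List.nil_append] at k1 k2 k3 ⊢
    exact k1.trans (k2.trans k3)

theorem TEquiv.of_events_eq {s t : List (Strand X)} {w₁ w₂ : Word X} (h₁ : NRuns s w₁ t)
    (h₂ : NRuns s w₂ t) (he : events w₁ = events w₂) : TEquiv s t w₁ w₂ :=
  TEquiv.of_events h₁ h₂ (.nil s) rfl he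

/-! ### Moves on Gauss codes -/

theorem events_eq_append {w : Word X} {E F : List (Elem X)} (h : events w = E ++ F) :
    ∃ w₁ w₂, w = w₁ ++ w₂ ∧ events w₁ = E ∧ events w₂ = F := by
  obtain ⟨l₁, l₂, h1, h2, h3⟩ := List.filter_eq_append_iff.1 h
  obtain ⟨w₁, w₂, rfl, rfl, rfl⟩ := List.map_eq_append_iff.1 h1
  exact ⟨w₁, w₂, rfl, h2, h3⟩

/-- Every diagram with Gauss code `E` is equivalent to one with Gauss code `E'`. -/
def Reduces (E E' : List (Elem X)) : Prop :=
  ∀ s t w, NRuns s w t → events w = E → ∃ w', NRuns s w' t ∧ events w' = E' ∧ TEquiv s t w w'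

namespace Reduces

variable {E E' E'' F F' : List (Elem X)}

theorem refl (E : List (Elem X)) : Reduces E E := fun _ _ w h he => ⟨w, h, he, .refl _⟩

theorem of_eq (h : E = E') : Reduces E E' := h ▸ refl E

theorem trans (h : Reduces E E') (h' : Reduces E' E'') : Reduces E E'' := fun s t w hw he => by
  obtain ⟨w', h1, h2, h3⟩ := h s t w hw he
  obtain ⟨w'', h4, h5, h6⟩ := h' s t w' h1 h2
  exact ⟨w'', h4, h5, h3.trans h6⟩

theorem append (h : Reduces E E') (h' : Reduces F F') : Reduces (E ++ F) (E' ++ F') :=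
  fun s t w hw he => by
    obtain ⟨w₁, w₂, rfl, he1, he2⟩ := events_eq_append he
    obtain ⟨m, hw1, hw2⟩ := hw.of_append
    obtain ⟨w₁', h1, h2, h3⟩ := h s m w₁ hw1 he1
    obtain ⟨w₂', h4, h5, h6⟩ := h' m t w₂ hw2 he2
    exact ⟨w₁' ++ w₂', h1.append h4, by simp [h2, h5],
      (h3.append_right hw2.runs).trans (h6.append_left h1.runs)⟩

theorem cons (e : Elem X) (h : Reduces E E') : Reduces (e :: E) (e :: E') :=
  (refl [e]).append h

/-- By `TEquiv.of_events_eq` the choice of the diagram with Gauss code `E'` does not matter. -/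
theorem tequiv (h : Reduces E E') {s t : List (Strand X)} {w w' : Word X} (hw : NRuns s w t)
    (hw' : NRuns s w' t) (he : events w = E) (he' : events w' = E') : TEquiv s t w w' := by
  obtain ⟨v, h1, h2, h3⟩ := h s t w hw he
  exact h3.trans (.of_events_eq h1 hw' (h2.trans he'.symm))

/-- An equivalence of tangle diagrams gives a move on Gauss codes if the ends of the tangles can
always be brought together by virtual crossings. -/
theorem of_tequiv {S T : List (Strand X)} {a a' : Word X} (h : TEquiv S T a a')
    (hS : ∀ s t w, NRuns s w t → events w = events a →
      ∃ v, s.Perm (S ++ v) ∧ t.Perm (T ++ v) ∧ NRuns (S ++ v) a (T ++ v) ∧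
        NRuns (S ++ v) a' (T ++ v)) : Reduces (events a) (events a') := fun s t w hw he => by
  obtain ⟨v, h1, h2, h3, h4⟩ := hS s t w hw he
  obtain ⟨p, hp, hpv⟩ := exists_virtual_of_perm h1
  obtain ⟨q, hq, hqv⟩ := exists_virtual_of_perm h2.symm
  have np := NRuns.of_virtual hp hpv hw.nodup_left
  have nq := NRuns.of_virtual hq hqv h3.nodup_right
  refine ⟨p ++ (a' ++ q), np.append (h4.append nq), by simp [hpv, hqv], ?_⟩
  exact (TEquiv.of_events_eq hw (np.append (h3.append nq)) (by simp [hpv, hqv, he])).trans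
    ((h.frame_right v).congr hp hq)

end Reduces

namespace NRuns

variable {s t : List (Strand X)} {w : Word X}

/-- The strands taking part in the first event, and the diagram above it. -/
theorem first_event (h : NRuns s w t) {e : Elem X} {E : List (Elem X)} (he : events w = e :: E) :
    ∃ v w', s.Perm (e.src ++ v) ∧ NRuns (e.tgt ++ v) w' t ∧ events w' = E := by
  obtain ⟨p, u, v, w', rfl, h1, h2, h3, h4, h5, h6⟩ := h.split he
  have pr : ∀ r : List (Strand X), (u ++ r ++ v).Perm (r ++ (u ++ v)) := fun r => by
    simpa using (List.perm_append_comm (l₁ := u) (l₂ := r)).append_right v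
  obtain ⟨q, hq, hqv⟩ := exists_virtual_of_perm (pr e.tgt).symm
  exact ⟨u ++ v, q ++ w', (h4.perm_of_virtual h1).trans (pr _),
    (of_virtual hq hqv ((pr e.tgt).nodup h6.nodup_left)).append h6, by simp [hqv, h2]⟩

theorem perm_of_no_event (h : NRuns s w t) (he : events w = []) : s.Perm t :=
  h.runs.perm_of_virtual he

/-- Diagrams without minima can be read with distinct names if the bottom strands have distinct
names. -/
theorem of_runs (h : Runs s w t) (hs : s.Nodup) (hw : ∀ l ∈ w, ∀ x, l.elem ≠ .cup x) :
    NRuns s w t := by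
  induction h with
  | nil => exact .nil _ hs
  | cons u v e w t _ ih =>
    refine .cons _ _ _ _ _ hs (ih ?_ fun l hl => hw l (by simp [hl]))
    cases e with
    | cup x => exact absurd rfl (hw _ List.mem_cons_self x)
    | cap x => exact hs.sublist (by simp [Elem.tgt])
    | cross k a b =>
      exact (((List.Perm.swap b a []).append_left u).append_right v).nodup hs

/-- Diagrams without maxima can be read with distinct names if the top strands have distinct
names. -/
theorem of_runs' (h : Runs s w t) (ht : t.Nodup) (hw : ∀ l ∈ w, ∀ x, l.elem ≠ .cap x) :
    NRuns s w t := by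
  induction h with
  | nil => exact .nil _ ht
  | cons u v e w t _ ih =>
    have h := ih ht fun l hl => hw l (by simp [hl])
    refine .cons _ _ _ _ _ ?_ h
    have hs := h.nodup_left
    cases e with
    | cap x => exact absurd rfl (hw _ List.mem_cons_self x)
    | cup x => exact hs.sublist (by simp [Elem.src])
    | cross k a b =>
      exact (((List.Perm.swap a b []).append_left u).append_right v).nodup hs

end NRuns

/-- The strands at the ends of an elementary piece. -/
def Elem.ends (e : Elem X) : List (Strand X) := e.src ++ e.tgt

theorem exists_perm_append_of_subset {l s : List ι} (hl : l.Nodup) (h : l ⊆ s) :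
    ∃ v, s.Perm (l ++ v) := by
  obtain ⟨l', h1, h2⟩ := List.subperm_of_subset hl h
  obtain ⟨v, hv⟩ := h2.exists_perm_append
  exact ⟨v, hv.trans (h1.append_right v)⟩

theorem exists_perm_cons_of_mem {l : List ι} {a : ι} (h : a ∈ l) : ∃ v, l.Perm (a :: v) := by
  obtain ⟨s, t, rfl⟩ := List.append_of_mem h
  exact ⟨s ++ t, List.perm_middle⟩

namespace Reduces

/-- Pieces that involve different strands may be exchanged. -/
theorem comm {e f : Elem X} (h : List.Disjoint e.ends f.ends) : Reduces [e, f] [f, e] := by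
  by_cases hv : e.isVirtual ∨ f.isVirtual
  · intro s t w hw he
    exfalso
    have : ∀ g ∈ events w, g.isVirtual = false := fun g hg => by
      simpa using (List.mem_filter.1 hg).2
    simp only [he, List.mem_cons, List.not_mem_nil, or_false, forall_eq_or_imp, forall_eq] at this
    simp [this] at hv
  push Not at hv
  have hev : ∀ i j, events [⟨i, e⟩, ⟨j, f⟩] = [e, f] := fun i j => by
    simp [events_cons, hv]
  have hev' : ∀ i j, events [⟨i, f⟩, ⟨j, e⟩] = [f, e] := fun i j => by
    simp [events_cons, hv]
  have he0 : Runs e.src [⟨0, e⟩] e.tgt := by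
    simpa using Runs.single (u := []) (v := []) (e := e) rfl
  have hf0 : Runs f.src [⟨0, f⟩] f.tgt := by
    simpa using Runs.single (u := []) (v := []) (e := f) rfl
  rw [← hev 0 (e.tgt.length + 0), ← hev' (e.src.length + 0) 0]
  refine of_tequiv (by simpa using TEquiv.exchange he0 hf0) fun s t w hw he => ?_
  rw [hev] at he
  obtain ⟨R, w₁, h1, h2, h3⟩ := hw.first_event he
  obtain ⟨R', w₂, h4, h5, h6⟩ := h2.first_event h3
  have h7 := h5.perm_of_no_event h6
  have hd := h
  simp only [Elem.ends, List.disjoint_append_left, List.disjoint_append_right] at hd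
  have hsub : f.src ⊆ R := fun x hx => by
    have := h4.symm.subset (List.mem_append_left _ hx)
    rcases List.mem_append.1 this with h | h
    · exact absurd hx (hd.1.2 h)
    · exact h
  have hfn : f.src.Nodup := (h4.nodup h2.nodup_left).of_append_left
  obtain ⟨v, hv⟩ := exists_perm_append_of_subset hfn hsub
  have h8 : R'.Perm (e.tgt ++ v) := by
    refine (List.perm_append_left_iff f.src).1 (h4.symm.trans ?_)
    refine (hv.append_left e.tgt).trans ?_
    simpa using (List.perm_append_comm (l₁ := e.tgt) (l₂ := f.src)).append_right v
  have hS : s.Perm (e.src ++ f.src ++ v) := by simpa using h1.trans (hv.append_left _)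
  have hT : t.Perm (e.tgt ++ f.tgt ++ v) := by
    refine h7.symm.trans ((h8.append_left _).trans ?_)
    simpa using (List.perm_append_comm (l₁ := f.tgt) (l₂ := e.tgt)).append_right v
  have nS := hS.nodup hw.nodup_left
  have nT := hT.nodup hw.nodup_right
  have n1 : (e.tgt ++ f.src ++ v).Nodup := by
    have := (hv.append_left e.tgt).nodup h2.nodup_left
    simpa using this
  have n2 : (e.src ++ f.tgt ++ v).Nodup := by
    simp only [List.nodup_append', List.disjoint_append_left] at nS nT ⊢
    tauto
  refine ⟨v, hS, hT, ?_, ?_⟩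
  · have a1 : NRuns (e.src ++ f.src ++ v) [⟨0, e⟩] (e.tgt ++ f.src ++ v) := by
      simpa using NRuns.cons [] (f.src ++ v) e [] _ (by simpa using nS) (.nil _ (by simpa using n1))
    have a2 : NRuns (e.tgt ++ f.src ++ v) [⟨e.tgt.length + 0, f⟩] (e.tgt ++ f.tgt ++ v) :=
      NRuns.cons e.tgt v f [] _ n1 (.nil _ nT)
    exact a1.append a2
  · have a1 : NRuns (e.src ++ f.tgt ++ v) [⟨0, e⟩] (e.tgt ++ f.tgt ++ v) := by
      simpa using NRuns.cons [] (f.tgt ++ v) e [] _ (by simpa using n2) (.nil _ (by simpa using nT))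
    have a2 : NRuns (e.src ++ f.src ++ v) [⟨e.src.length + 0, f⟩] (e.src ++ f.tgt ++ v) :=
      NRuns.cons e.src v f [] _ nS (.nil _ n2)
    exact a2.append a1

theorem bigon {k : Kind} (hk : k ≠ .virt) (a b : Strand X) :
    Reduces [.cross k a b, .cross k.swap b a] [] := by
  have hk' : k.swap ≠ .virt := by cases k <;> simp [Kind.swap] at hk ⊢
  have := of_tequiv (TEquiv.bigon k a b) fun s t w hw he => by
    rw [events_cross hk, events_cross hk', events_nil] at he
    obtain ⟨R, w₁, h1, h2, h3⟩ := hw.first_event he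
    obtain ⟨R', w₂, h4, h5, h6⟩ := h2.first_event h3
    have h7 := h5.perm_of_no_event h6
    have h8 := (List.perm_append_left_iff [b, a]).1 h4
    have hn := h1.nodup hw.nodup_left
    exact ⟨R, h1, h7.symm.trans (h8.symm.append_left [a, b]),
      .of_runs (.cons_of_eq [] R rfl rfl (.cons_of_eq [] R rfl rfl (.nil _))) hn (by simp),
      .nil _ hn⟩
  rwa [events_cross hk, events_cross hk', events_nil] at this

theorem triangle {k₁ k₂ k₃ : Kind} (h : AdmissibleTriple k₁ k₂ k₃) (hk₁ : k₁ ≠ .virt)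
    (hk₂ : k₂ ≠ .virt) (hk₃ : k₃ ≠ .virt) (a b c : Strand X) :
    Reduces [.cross k₁ a b, .cross k₂ a c, .cross k₃ b c]
      [.cross k₃ b c, .cross k₂ a c, .cross k₁ a b] := by
  have hl : ∀ v, Runs ([a, b, c] ++ v)
      [⟨0, .cross k₁ a b⟩, ⟨1, .cross k₂ a c⟩, ⟨0, .cross k₃ b c⟩] ([c, b, a] ++ v) := fun v =>
    .cons_of_eq [] (c :: v) rfl rfl (.cons_of_eq [b] v rfl rfl
      (.cons_of_eq [] (a :: v) rfl rfl (.nil _)))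
  have hr : ∀ v, Runs ([a, b, c] ++ v)
      [⟨1, .cross k₃ b c⟩, ⟨0, .cross k₂ a c⟩, ⟨1, .cross k₁ a b⟩] ([c, b, a] ++ v) := fun v =>
    .cons_of_eq [a] v rfl rfl (.cons_of_eq [] (b :: v) rfl rfl
      (.cons_of_eq [c] v rfl rfl (.nil _)))
  have := of_tequiv (.of_localMove (.triangle 0 k₁ k₂ k₃ a b c h) (hl []) (hr []))
    fun s t w hw he => by
      simp only [events_cross hk₁, events_cross hk₂, events_cross hk₃, events_nil] at he
      obtain ⟨R, w₁, h1, h2, h3⟩ := hw.first_event he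
      obtain ⟨R', w₂, h4, h5, h6⟩ := h2.first_event h3
      obtain ⟨R'', w₃, h7, h8, h9⟩ := h5.first_event h6
      have h10 := h8.perm_of_no_event h9
      simp only [Elem.src, Elem.tgt] at h1 h4 h7 h10
      have hst : s.Perm t :=
        (h1.trans (((List.Perm.swap b a []).append_right R).trans
          (h4.trans (((List.Perm.swap c a []).append_right R').trans
            (h7.trans ((List.Perm.swap c b []).append_right R'')))))).trans h10
      have hn := (h7.nodup h5.nodup_left)
      have hn' := (h4.nodup h2.nodup_left)
      have hc : c ∈ R := by
        have : c ∈ [b, a] ++ R := h4.symm.subset (by simp)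
        simp only [List.nodup_append', List.nodup_cons, List.mem_cons] at hn hn'
        simp only [List.mem_append, List.mem_cons, List.not_mem_nil, or_false] at this
        rcases this with (rfl | rfl) | h
        · simp at hn
        · simp at hn'
        · exact h
      obtain ⟨v, hv⟩ := exists_perm_cons_of_mem hc
      have hs : s.Perm ([a, b, c] ++ v) := h1.trans (hv.append_left [a, b])
      refine ⟨v, hs, hst.symm.trans (hs.trans ?_), .of_runs (hl v) (hs.nodup hw.nodup_left)
          (by simp),
        .of_runs (hr v) (hs.nodup hw.nodup_left) (by simp)⟩
      exact (List.reverse_perm [c, b, a]).append_right v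
  simpa only [events_cross hk₁, events_cross hk₂, events_cross hk₃, events_nil] using this

theorem cap_slide {k : Kind} (hk : k ≠ .virt) (x a : Strand X) (ha : a ≠ x.flip) :
    Reduces [.cross k x a, .cap x] [.cross k.swap a x.flip, .cap x] := by
  have hk' : k.swap ≠ .virt := by cases k <;> simp [Kind.swap] at hk ⊢
  have := of_tequiv (TEquiv.capSlide k x a) fun s t w hw he => by
    simp only [events_cross hk, events_cap, events_nil] at he
    obtain ⟨R, w₁, h1, h2, h3⟩ := hw.first_event he
    obtain ⟨R', w₂, h4, h5, h6⟩ := h2.first_event h3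
    have h7 := h5.perm_of_no_event h6
    simp only [Elem.src, Elem.tgt, List.nil_append] at h1 h4 h7
    have hx : x.flip ∈ R := by
      have : x.flip ∈ [a, x] ++ R := h4.symm.subset (by simp)
      simpa [ha.symm, Strand.flip_ne] using this
    obtain ⟨v, hv⟩ := exists_perm_cons_of_mem hx
    have hs : s.Perm ([x, a, x.flip] ++ v) := h1.trans (hv.append_left [x, a])
    have h8 : R'.Perm (a :: v) := by
      refine (List.perm_append_left_iff [x, x.flip]).1 (h4.symm.trans ?_)
      refine (hv.append_left [a, x]).trans ?_
      exact (List.perm_append_comm (l₁ := [a]) (l₂ := [x, x.flip])).append_right v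
    have hn := hs.nodup hw.nodup_left
    exact ⟨v, hs, h7.symm.trans h8,
      .of_runs (.cons_of_eq [] (x.flip :: v) rfl rfl (.cons_of_eq [a] v rfl rfl (.nil _))) hn
        (by simp),
      .of_runs (.cons_of_eq [x] v rfl rfl (.cons_of_eq [] (a :: v) rfl rfl (.nil _))) hn
        (by simp)⟩
  simpa only [events_cross hk, events_cross hk', events_cap, events_nil] using this

theorem cup_slide {k : Kind} (hk : k ≠ .virt) (x a : Strand X) (ha : a ≠ x.flip) :
    Reduces [.cup x, .cross k a x] [.cup x, .cross k.swap x.flip a] := by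
  have hk' : k.swap ≠ .virt := by cases k <;> simp [Kind.swap] at hk ⊢
  have := of_tequiv (TEquiv.cupSlide k x a) fun s t w hw he => by
    simp only [events_cross hk, events_cup, events_nil] at he
    obtain ⟨R, w₁, h1, h2, h3⟩ := hw.first_event he
    obtain ⟨R', w₂, h4, h5, h6⟩ := h2.first_event h3
    have h7 := h5.perm_of_no_event h6
    simp only [Elem.src, Elem.tgt, List.nil_append] at h1 h4 h7
    have hn4 := h4.nodup h2.nodup_left
    have hx : a ∈ R := by
      have : a ∈ [x, x.flip] ++ R := h4.symm.subset (by simp)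
      have hax : a ≠ x := by rintro rfl; simp at hn4
      simpa [ha, hax] using this
    obtain ⟨v, hv⟩ := exists_perm_cons_of_mem hx
    have hs : s.Perm ([a] ++ v) := h1.trans hv
    have ht : t.Perm ([x, a, x.flip] ++ v) := by
      refine h7.symm.trans (((List.Perm.swap a x []).append_right R').trans
        (h4.symm.trans ((hv.append_left [x, x.flip]).trans ?_)))
      exact ((List.Perm.swap a x.flip v).cons x)
    have hn := ht.nodup hw.nodup_right
    exact ⟨v, hs, ht,
      .of_runs' (.cons_of_eq [a] v rfl rfl (.cons_of_eq [] (x.flip :: v) rfl rfl (.nil _))) hn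
        (by simp),
      .of_runs' (.cons_of_eq [] (a :: v) rfl rfl (.cons_of_eq [x] v rfl rfl (.nil _))) hn
        (by simp)⟩
  simpa only [events_cross hk, events_cross hk', events_cup, events_nil] using this

theorem runs_curl_cap (k : Kind) (x : Strand X) (v : List (Strand X)) :
    Runs ([x, x.flip] ++ v) [⟨0, .cross k x x.flip⟩, ⟨0, .cap x.flip⟩] ([] ++ v) :=
  .cons_of_eq [] v rfl rfl (.cons_of_eq [] v (by simp [Elem.src, Elem.tgt]) rfl (.nil _))

theorem runs_curl_cup (k : Kind) (x : Strand X) (v : List (Strand X)) :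
    Runs ([] ++ v) [⟨0, .cup x⟩, ⟨0, .cross k x x.flip⟩] ([x.flip, x] ++ v) :=
  .cons_of_eq [] v rfl rfl (.cons_of_eq [] v rfl rfl (.nil _))

theorem tequiv_curl_cap (k : Kind) (x : Strand X) :
    TEquiv [x, x.flip] [] [⟨0, .cross k x x.flip⟩, ⟨0, .cap x.flip⟩] [⟨0, .cap x⟩] :=
  .of_localMove (.curl₁ 0 k x) (runs_curl_cap k x []) (.cons_of_eq [] [] rfl rfl (.nil _))

theorem tequiv_curl_cup (k : Kind) (x : Strand X) :
    TEquiv [] [x.flip, x] [⟨0, .cup x⟩, ⟨0, .cross k x x.flip⟩] [⟨0, .cup x.flip⟩] :=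
  .of_localMove (.curl₂ 0 k x) (runs_curl_cup k x [])
    (.cons_of_eq [] [] rfl rfl (by simpa [Elem.tgt] using Runs.nil _))

theorem curl_cap {k : Kind} (hk : k ≠ .virt) (x : Strand X) :
    Reduces [.cross k x x.flip, .cap x.flip] [.cap x] := by
  have := of_tequiv (tequiv_curl_cap k x) fun s t w hw he => by
    simp only [events_cross hk, events_cap, events_nil] at he
    obtain ⟨R, w₁, h1, h2, h3⟩ := hw.first_event he
    obtain ⟨R', w₂, h4, h5, h6⟩ := h2.first_event h3
    have h7 := h5.perm_of_no_event h6
    simp only [Elem.src, Elem.tgt, List.nil_append, Strand.flip_flip] at h1 h4 h7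
    have hn := h1.nodup hw.nodup_left
    exact ⟨R, h1, h7.symm.trans ((List.perm_append_left_iff _).1 h4).symm,
      .of_runs (runs_curl_cap k x R) hn (by simp),
      .of_runs (.cons_of_eq [] R rfl rfl (.nil _)) hn (by simp)⟩
  simpa only [events_cross hk, events_cap, events_nil] using this

theorem curl_cup {k : Kind} (hk : k ≠ .virt) (x : Strand X) :
    Reduces [.cup x, .cross k x x.flip] [.cup x.flip] := by
  have := of_tequiv (tequiv_curl_cup k x) fun s t w hw he => by
    simp only [events_cross hk, events_cup, events_nil] at he
    obtain ⟨R, w₁, h1, h2, h3⟩ := hw.first_event he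
    obtain ⟨R', w₂, h4, h5, h6⟩ := h2.first_event h3
    have h7 := h5.perm_of_no_event h6
    simp only [Elem.src, Elem.tgt, List.nil_append] at h1 h4 h7
    have ht : t.Perm ([x.flip, x] ++ R) :=
      h7.symm.trans (((List.perm_append_left_iff _).1 h4).symm.append_left _)
    have hn := ht.nodup hw.nodup_right
    exact ⟨R, h1, ht,
      .of_runs' (runs_curl_cup k x R) hn (by simp),
      .of_runs' (.cons_of_eq [] R rfl rfl (by simpa [Elem.tgt] using Runs.nil _)) hn (by simp)⟩
  simpa only [events_cross hk, events_cup, events_nil] using this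

theorem cap_flip (x : Strand X) : Reduces [.cap x] [.cap x.flip] := by
  have := of_tequiv (tequiv_curl_cap .virt x).symm fun s t w hw he => by
    simp only [events_cap, events_nil] at he
    obtain ⟨R, w₁, h1, h2, h3⟩ := hw.first_event he
    have h7 := h2.perm_of_no_event h3
    have hn := h1.nodup hw.nodup_left
    exact ⟨R, h1, h7.symm,
      .of_runs (.cons_of_eq [] R rfl rfl (.nil _)) hn (by simp),
      .of_runs (runs_curl_cap .virt x R) hn (by simp)⟩
  simpa only [events_virt, events_cap, events_nil] using this

theorem cup_flip (x : Strand X) : Reduces [.cup x] [.cup x.flip] := by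
  have := of_tequiv (tequiv_curl_cup .virt x.flip).symm fun s t w hw he => by
    simp only [events_cup, events_nil, Strand.flip_flip] at he
    obtain ⟨R, w₁, h1, h2, h3⟩ := hw.first_event he
    have h7 := h2.perm_of_no_event h3
    simp only [Elem.src, Elem.tgt, List.nil_append] at h1 h7
    have ht : t.Perm ([x.flip.flip, x.flip] ++ R) := by simpa using h7.symm
    have hn := ht.nodup hw.nodup_right
    exact ⟨R, h1, ht,
      .of_runs' (.cons_of_eq [] R rfl rfl (by simpa [Elem.tgt] using Runs.nil _)) hn (by simp),
      .of_runs' (runs_curl_cup .virt x.flip R) hn (by simp)⟩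
  simpa only [events_virt, events_cup, events_nil, Strand.flip_flip] using this

/-- Independent pieces, at different places, may be performed in any order. -/
theorem of_perm {E E' : List (Elem X)} (h : E.Perm E')
    (hE : E.Pairwise fun e f => List.Disjoint e.ends f.ends) : Reduces E E' := by
  induction h with
  | nil => exact refl _
  | cons e _ ih => exact (ih (List.pairwise_cons.1 hE).2).cons e
  | swap e f l =>
    have := (List.pairwise_cons.1 hE).1 e (by simp)
    exact (comm this).append (refl l)
  | trans h₁ _ ih₁ ih₂ =>
    exact (ih₁ hE).trans (ih₂ ((h₁.pairwise_iff fun h => List.disjoint_symm h).1 hE))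

theorem comm_list {E F : List (Elem X)}
    (h : ∀ e ∈ E, ∀ f ∈ F, List.Disjoint e.ends f.ends) : Reduces (E ++ F) (F ++ E) := by
  induction E with
  | nil => exact of_eq (by simp)
  | cons e E ih =>
    have h1 : Reduces (e :: F) (F ++ [e]) := by
      have he := h e (by simp)
      clear ih h
      induction F with
      | nil => exact refl _
      | cons f F ih =>
        exact ((comm (he f (by simp))).append (refl F)).trans
          ((ih fun g hg => he g (by simp [hg])).cons f)
    have h2 := (ih fun e he => h e (by simp [he])).cons e
    exact h2.trans (by simpa using h1.append (refl E))

/-- All strands of the pieces `E` lie at the place `p`, with respect to the function `pl` that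
assigns places to strands. -/
def AtPlace (pl : Strand X → ι) (p : ι) (E : List (Elem X)) : Prop :=
  ∀ e ∈ E, ∀ s ∈ e.ends, pl s = p

theorem AtPlace.disjoint {pl : Strand X → ι} {p q : ι} {E F : List (Elem X)}
    (hE : AtPlace pl p E) (hF : AtPlace pl q F) (h : p ≠ q) :
    ∀ e ∈ E, ∀ f ∈ F, List.Disjoint e.ends f.ends := fun e he f hf s hs hs' =>
  h ((hE e he s hs).symm.trans (hF f hf s hs'))

theorem AtPlace.append {pl : Strand X → ι} {p : ι} {E F : List (Elem X)}
    (hE : AtPlace pl p E) (hF : AtPlace pl p F) : AtPlace pl p (E ++ F) := fun e he =>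
  (List.mem_append.1 he).elim (hE e) (hF e)

/-- Two families of moves on parallel strands may be performed one place after the other. -/
theorem merge {pl : Strand X → ι} {P : List ι} (hP : P.Nodup) {F G : ι → List (Elem X)}
    (hF : ∀ p ∈ P, AtPlace pl p (F p)) (hG : ∀ p ∈ P, AtPlace pl p (G p)) :
    Reduces (P.flatMap F ++ P.flatMap G) (P.flatMap fun p => F p ++ G p) ∧
      Reduces (P.flatMap fun p => F p ++ G p) (P.flatMap F ++ P.flatMap G) := by
  induction P with
  | nil => exact ⟨refl _, refl _⟩
  | cons p P ih =>
    obtain ⟨hp, hP⟩ := List.nodup_cons.1 hP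
    obtain ⟨h1, h2⟩ := ih hP (fun q hq => hF q (by simp [hq])) fun q hq => hG q (by simp [hq])
    have hd : ∀ e ∈ P.flatMap F, ∀ f ∈ G p, List.Disjoint e.ends f.ends := fun e he f hf => by
      obtain ⟨q, hq, he⟩ := List.mem_flatMap.1 he
      exact (hF q (by simp [hq])).disjoint (hG p (by simp)) (fun h => hp (h ▸ hq)) e he f hf
    have h3 := ((refl (F p)).append (comm_list hd)).append (refl (P.flatMap G))
    have h4 := ((refl (F p)).append
      (comm_list fun e he f hf => List.disjoint_symm (hd f hf e he))).append (refl (P.flatMap G))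
    constructor
    · simpa using h3.trans (by simpa using (refl (F p ++ G p)).append h1)
    · simp only [List.flatMap_cons, List.append_assoc] at h4 ⊢
      exact (by simpa using (refl (F p ++ G p)).append h2 : Reduces _ _).trans h4

theorem flatMap {P : List ι} {F G : ι → List (Elem X)} (h : ∀ p ∈ P, Reduces (F p) (G p)) :
    Reduces (P.flatMap F) (P.flatMap G) := by
  induction P with
  | nil => exact refl _
  | cons p P ih =>
    exact (h p (by simp)).append (ih fun q hq => h q (by simp [hq]))

theorem of_perm_map {pl : Strand X → ι} {P : List ι} (hP : P.Nodup) {f : ι → Elem X}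
    (hf : ∀ p, AtPlace pl p [f p]) {E : List (Elem X)} (hE : E.Perm (P.map f)) :
    Reduces E (P.map f) ∧ Reduces (P.map f) E := by
  have h : (P.map f).Pairwise fun e f => List.Disjoint e.ends f.ends := by
    rw [List.pairwise_map]
    exact hP.imp fun {p q} hpq => (hf p).disjoint (hf q) hpq _ (by simp) _ (by simp)
  exact ⟨of_perm hE ((hE.pairwise_iff fun h => List.disjoint_symm h).2 h), of_perm hE.symm h⟩

/-- Gauss codes that consist of two families of moves on parallel strands may be rearranged place by
place. -/
theorem two {pl : Strand X → ι} {P : List ι} (hP : P.Nodup) {f g : ι → Elem X}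
    (hf : ∀ p, AtPlace pl p [f p]) (hg : ∀ p, AtPlace pl p [g p]) {E F : List (Elem X)}
    (hE : E.Perm (P.map f)) (hF : F.Perm (P.map g)) :
    Reduces (E ++ F) (P.flatMap fun p => [f p, g p]) ∧
      Reduces (P.flatMap fun p => [f p, g p]) (E ++ F) := by
  have h1 := of_perm_map hP hf hE
  have h2 := of_perm_map hP hg hF
  have h3 := merge hP (fun p _ => hf p) fun p _ => hg p
  simp only [List.singleton_append,
    ← List.map_eq_flatMap] at h3
  exact ⟨(h1.1.append h2.1).trans h3.1, h3.2.trans (h1.2.append h2.2)⟩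

theorem three {pl : Strand X → ι} {P : List ι} (hP : P.Nodup) {f g h : ι → Elem X}
    (hf : ∀ p, AtPlace pl p [f p]) (hg : ∀ p, AtPlace pl p [g p])
    (hh : ∀ p, AtPlace pl p [h p]) {E F G : List (Elem X)}
    (hE : E.Perm (P.map f)) (hF : F.Perm (P.map g)) (hG : G.Perm (P.map h)) :
    Reduces (E ++ F ++ G) (P.flatMap fun p => [f p, g p, h p]) ∧
      Reduces (P.flatMap fun p => [f p, g p, h p]) (E ++ F ++ G) := by
  have h1 := two hP hf hg hE hF
  have h2 := of_perm_map hP hh hG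
  have h3 := merge hP (fun p _ => (hf p).append (hg p)) fun p _ => hh p
  simp only [List.cons_append, List.nil_append, ← List.map_eq_flatMap] at h3
  exact ⟨(h1.1.append h2.1).trans h3.1, h3.2.trans (h1.2.append h2.2)⟩

end Reduces

/-! ### Coloured diagrams -/

/-- `1` for a strand directed upwards, `-1` for a strand directed downwards. -/
def Strand.sign (s : Strand C) : ℤ := if s.up then 1 else -1

@[simp] theorem Strand.sign_flip (s : Strand C) : s.flip.sign = -s.sign := by
  obtain ⟨_ | _, c⟩ := s <;> rfl

/-- The strand `s` with its colour changed by the `n`-th power of `ρ`. -/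
def Strand.turn (ρ : Equiv.Perm C) (n : ℤ) (s : Strand C) : Strand C := ⟨s.up, (ρ ^ n) s.comp⟩

@[simp] theorem Strand.turn_up (ρ : Equiv.Perm C) (n : ℤ) (s : Strand C) :
    (s.turn ρ n).up = s.up := rfl

@[simp] theorem Strand.turn_sign (ρ : Equiv.Perm C) (n : ℤ) (s : Strand C) :
    (s.turn ρ n).sign = s.sign := rfl

@[simp] theorem Strand.turn_comp (ρ : Equiv.Perm C) (n : ℤ) (s : Strand C) :
    (s.turn ρ n).comp = (ρ ^ n) s.comp := rfl

@[simp] theorem Strand.turn_zero (ρ : Equiv.Perm C) (s : Strand C) : s.turn ρ 0 = s := rfl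

@[simp] theorem Strand.turn_turn (ρ : Equiv.Perm C) (m n : ℤ) (s : Strand C) :
    (s.turn ρ m).turn ρ n = s.turn ρ (n + m) := by
  simp [Strand.turn, zpow_add]

theorem Strand.turn_flip (ρ : Equiv.Perm C) (n : ℤ) (s : Strand C) :
    (s.turn ρ n).flip = s.flip.turn ρ n := rfl

/-- The power of `ρ` by which, read upwards, the colour of a strand changes when at a crossing of
kind `k` it runs from the lower left to the upper right and crosses `s`.  For `s` itself it is the
negative of the expression with the roles of the strands exchanged. -/
def twist (δ : ℤ) (k : Kind) (s : Strand C) : ℤ :=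
  match k with
  | .virt => δ * s.sign
  | _ => 0

@[simp] theorem twist_turn (δ : ℤ) (k : Kind) (ρ : Equiv.Perm C) (n : ℤ) (s : Strand C) :
    twist δ k (s.turn ρ n) = twist δ k s := by
  cases k <;> rfl

@[simp] theorem twist_flip (δ : ℤ) (k : Kind) (s : Strand C) :
    twist δ k s.flip = -twist δ k s := by
  cases k <;> simp [twist]

@[simp] theorem twist_swap (δ : ℤ) (k : Kind) (s : Strand C) :
    twist δ k.swap s = twist δ k s := by
  cases k <;> rfl

theorem twist_of_ne {k : Kind} (hk : k ≠ .virt) (δ : ℤ) (s : Strand C) : twist δ k s = 0 := by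
  cases k <;> first | rfl | exact absurd rfl hk

@[simp] theorem twist_relabel (δ : ℤ) (k : Kind) (f : C → Y) (s : Strand C) :
    twist δ k (s.relabel f) = twist δ k s := by
  cases k <;> rfl

/-- The coloured strands at the top of a piece: at a virtual crossing the colours change. -/
def Elem.ctgt (ρ : Equiv.Perm C) (δ : ℤ) : Elem C → List (Strand C)
  | .cross k a b => [b.turn ρ (-twist δ k a), a.turn ρ (twist δ k b)]
  | e => e.tgt

/-- Coloured diagrams.  The strands of a diagram carry colours; they change at virtual crossings by
the permutation `ρ` or its inverse, and the colours at minima satisfy `Q`. -/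
inductive CRuns (ρ : Equiv.Perm C) (δ : ℤ) (Q : C → Prop) :
    List (Strand C) → Word C → List (Strand C) → Prop
  | nil (s : List (Strand C)) : CRuns ρ δ Q s [] s
  | cons (u v : List (Strand C)) (e : Elem C) (w : Word C) (t : List (Strand C)) :
      (∀ s, e = .cup s → Q s.comp) → CRuns ρ δ Q (u ++ e.ctgt ρ δ ++ v) w t →
        CRuns ρ δ Q (u ++ e.src ++ v) (⟨u.length, e⟩ :: w) t

section

variable {ρ : Equiv.Perm C} {δ : ℤ} {Q : C → Prop} {s m t : List (Strand C)} {w w' : Word C}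

theorem cruns_nil_iff : CRuns ρ δ Q s [] t ↔ s = t :=
  ⟨fun h => by cases h; rfl, fun h => h ▸ .nil _⟩

theorem cruns_cons_iff {i : ℕ} {e : Elem C} :
    CRuns ρ δ Q s (⟨i, e⟩ :: w) t ↔ ∃ u v, s = u ++ e.src ++ v ∧ i = u.length ∧
      (∀ s, e = .cup s → Q s.comp) ∧ CRuns ρ δ Q (u ++ e.ctgt ρ δ ++ v) w t := by
  constructor
  · rintro ⟨⟩
    exact ⟨_, _, rfl, rfl, by assumption, by assumption⟩
  · rintro ⟨u, v, rfl, rfl, h, h'⟩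
    exact .cons _ _ _ _ _ h h'

theorem CRuns.append (h : CRuns ρ δ Q s w m) (h' : CRuns ρ δ Q m w' t) :
    CRuns ρ δ Q s (w ++ w') t := by
  induction h with
  | nil => exact h'
  | cons u v e w t hq _ ih => exact .cons _ _ _ _ _ hq (ih h')

theorem CRuns.of_append (h : CRuns ρ δ Q s (w ++ w') t) :
    ∃ m, CRuns ρ δ Q s w m ∧ CRuns ρ δ Q m w' t := by
  induction w generalizing s with
  | nil => exact ⟨s, .nil _, h⟩
  | cons l w ih =>
    rw [List.cons_append] at h
    cases h with
    | cons u v e w t hs h =>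
      obtain ⟨m, h1, h2⟩ := ih h
      exact ⟨m, .cons _ _ _ _ _ hs h1, h2⟩

theorem CRuns.frame (h : CRuns ρ δ Q s w t) (u v : List (Strand C)) :
    CRuns ρ δ Q (u ++ s ++ v) (shift u.length w) (u ++ t ++ v) := by
  induction h with
  | nil => exact .nil _
  | cons u' v' e w t hq _ ih =>
    rw [shift_cons, cruns_cons_iff]
    exact ⟨u ++ u', v' ++ v, by simp, by simp, hq, by simpa using ih⟩

theorem CRuns.mono {Q' : C → Prop} (h : CRuns ρ δ Q s w t) (hQ : ∀ c, Q c → Q' c) :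
    CRuns ρ δ Q' s w t := by
  induction h with
  | nil => exact .nil _
  | cons u' v' e w t hq _ ih => exact .cons _ _ _ _ _ (fun s hs => hQ _ (hq s hs)) ih

theorem Elem.ctgt_relabel (e : Elem C) :
    (e.ctgt ρ δ).map (Strand.relabel fun _ => (0 : Fin 1)) =
      (e.relabel fun _ => (0 : Fin 1)).tgt := by
  cases e <;> rfl

/-- The diagram without its colours. -/
theorem CRuns.forget (h : CRuns ρ δ Q s w t) :
    Runs (s.map (Strand.relabel fun _ => (0 : Fin 1)))
      (Word.relabel (fun _ => (0 : Fin 1)) w) (t.map (Strand.relabel fun _ => (0 : Fin 1))) := by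
  induction h with
  | nil => exact .nil _
  | cons u v e w t _ _ ih =>
    rw [relabel_cons, runs_cons_iff]
    exact ⟨u.map (Strand.relabel fun _ => 0), v.map (Strand.relabel fun _ => 0), by simp, by simp,
      by simpa [← Elem.ctgt_relabel (ρ := ρ) (δ := δ)] using ih⟩

theorem map_zpow_apply {D : Type} {ρ : Equiv.Perm C} {ρ' : Equiv.Perm D} {f : C → D}
    (hf : ∀ c, f (ρ c) = ρ' (f c)) (n : ℤ) (c : C) : f ((ρ ^ n) c) = (ρ' ^ n) (f c) := by
  have hf' : ∀ c, f (ρ⁻¹ c) = ρ'⁻¹ (f c) := fun c => by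
    rw [Equiv.Perm.eq_inv_iff_eq, ← hf]; simp
  induction n generalizing c with
  | zero => simp
  | succ n ih => rw [zpow_add_one, zpow_add_one, Equiv.Perm.mul_apply, Equiv.Perm.mul_apply, ih, hf]
  | pred n ih => rw [zpow_sub_one, zpow_sub_one, Equiv.Perm.mul_apply, Equiv.Perm.mul_apply, ih,
      hf']

theorem zpow_apply_comm (ρ : Equiv.Perm C) (n : ℤ) (c : C) : (ρ ^ n) (ρ c) = ρ ((ρ ^ n) c) := by
  rw [← Equiv.Perm.mul_apply, ← Equiv.Perm.mul_apply, ← zpow_one_add, ← zpow_add_one, add_comm]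

theorem Strand.turn_relabel {D : Type} {ρ : Equiv.Perm C} {ρ' : Equiv.Perm D} {f : C → D}
    (hf : ∀ c, f (ρ c) = ρ' (f c)) (n : ℤ) (s : Strand C) :
    (s.turn ρ n).relabel f = (s.relabel f).turn ρ' n := by
  simp [Strand.turn, Strand.relabel, map_zpow_apply hf]

theorem Elem.ctgt_relabel_of_comm {D : Type} {ρ : Equiv.Perm C} {ρ' : Equiv.Perm D} {f : C → D}
    (hf : ∀ c, f (ρ c) = ρ' (f c)) (δ : ℤ) (e : Elem C) :
    (e.relabel f).ctgt ρ' δ = (e.ctgt ρ δ).map (Strand.relabel f) := by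
  cases e <;> simp [Elem.relabel, Elem.ctgt, Elem.tgt, Strand.turn_relabel hf]

/-- Change of colours by a map that commutes with the permutations of the colours. -/
theorem CRuns.relabel {D : Type} {ρ' : Equiv.Perm D} {Q' : D → Prop} (h : CRuns ρ δ Q s w t)
    (f : C → D) (hf : ∀ c, f (ρ c) = ρ' (f c)) (hQ : ∀ c, Q c → Q' (f c)) :
    CRuns ρ' δ Q' (s.map (Strand.relabel f)) (Word.relabel f w) (t.map (Strand.relabel f)) := by
  induction h with
  | nil => exact .nil _
  | cons u v e w t hq _ ih =>
    rw [relabel_cons, cruns_cons_iff]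
    refine ⟨u.map (Strand.relabel f), v.map (Strand.relabel f), by simp, by simp, ?_, ?_⟩
    · cases e with
      | cup s => rintro _ ⟨⟩; exact hQ _ (hq s rfl)
      | cap s => rintro _ ⟨⟩
      | cross => rintro _ ⟨⟩
    · simpa [Elem.ctgt_relabel_of_comm hf] using ih

theorem CRuns.colors (h : CRuns ρ δ Q s w t) (hQ : ∀ c n, Q c → Q ((ρ ^ (n : ℤ)) c))
    (hs : ∀ x ∈ s, Q x.comp) : ∀ x ∈ t, Q x.comp := by
  induction h with
  | nil => exact hs
  | cons u v e w t hq _ ih =>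
    refine ih fun x hx => ?_
    simp only [List.mem_append] at hx hs
    rcases hx with (hx | hx) | hx
    · exact hs x (by simp [hx])
    · cases e with
      | cup y =>
        simp only [Elem.ctgt, Elem.tgt, List.mem_cons, List.not_mem_nil, or_false] at hx
        rcases hx with h | h <;> rw [h] <;> exact hq y rfl
      | cap s => simp [Elem.ctgt, Elem.tgt] at hx
      | cross k a b =>
        simp only [Elem.ctgt, List.mem_cons, List.not_mem_nil, or_false] at hx
        rcases hx with rfl | rfl
        · exact hQ _ _ (hs b (by simp [Elem.src]))
        · exact hQ _ _ (hs a (by simp [Elem.src]))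
    · exact hs x (by simp [hx])

end

/-! ### Bundles of parallel strands -/

/-- The last entry of a list moves to the front. -/
def rotR (l : List ι) : List ι :=
  match l.getLast? with
  | none => []
  | some x => x :: l.dropLast

/-- The first entry of a list moves to the end. -/
def rotL : List ι → List ι
  | [] => []
  | x :: l => l ++ [x]

@[simp] theorem rotR_nil : rotR ([] : List ι) = [] := rfl

@[simp] theorem rotR_concat (l : List ι) (x : ι) : rotR (l ++ [x]) = x :: l := by simp [rotR]

@[simp] theorem rotL_cons (l : List ι) (x : ι) : rotL (x :: l) = l ++ [x] := rfl

/-- The cyclic permutation of lists by one place to the right. -/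
def rot : Equiv.Perm (List ι) where
  toFun := rotR
  invFun := rotL
  left_inv l := by
    rcases List.eq_nil_or_concat' l with rfl | ⟨l, x, rfl⟩ <;> simp [rotL]
  right_inv l := by cases l <;> simp [rotL]

theorem rot_zpow_induction {P : List ι → List ι → Prop} (l : List ι) (h0 : P l l)
    (hR : ∀ m, P l m → P l (rotR m)) (hL : ∀ m, P l m → P l (rotL m)) (n : ℤ) :
    P l ((rot ^ n) l) := by
  induction n with
  | zero => simpa using h0
  | succ n ih =>
    rw [add_comm, zpow_add]
    exact hR _ ih
  | pred n ih =>
    rw [sub_eq_add_neg, add_comm, zpow_add]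
    exact hL _ ih

theorem rotR_isRotated (l : List ι) : rotR l ~r l := by
  rcases List.eq_nil_or_concat' l with rfl | ⟨l, x, rfl⟩
  · simp
  · rw [rotR_concat]
    exact ⟨1, by simp⟩

theorem rotL_isRotated (l : List ι) : rotL l ~r l := by
  cases l with
  | nil => simp [rotL]
  | cons x l => exact List.IsRotated.symm ⟨1, by simp⟩

theorem rot_zpow_isRotated (n : ℤ) (l : List ι) : (rot ^ n) l ~r l :=
  rot_zpow_induction (P := fun l m => m ~r l) l (.refl _)
    (fun m h => (rotR_isRotated m).trans h) (fun m h => (rotL_isRotated m).trans h) n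

@[simp] theorem length_rot_zpow (n : ℤ) (l : List ι) : ((rot ^ n) l).length = l.length :=
  (rot_zpow_isRotated n l).perm.length_eq

theorem rotR_map (f : ι → Y) (l : List ι) : rotR (l.map f) = (rotR l).map f := by
  rcases List.eq_nil_or_concat' l with rfl | ⟨l, x, rfl⟩ <;> simp

theorem rotL_map (f : ι → Y) (l : List ι) : rotL (l.map f) = (rotL l).map f := by
  cases l <;> simp [rotL]

theorem rotR_reverse (l : List ι) : rotR l.reverse = (rotL l).reverse := by
  cases l <;> simp [rotL]

theorem rotL_reverse (l : List ι) : rotL l.reverse = (rotR l).reverse := by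
  rcases List.eq_nil_or_concat' l with rfl | ⟨l, x, rfl⟩ <;> simp [rotL]

/-- The parallel strands that replace a strand whose colour lists their components from left to
right with respect to the orientation; the result is in the order of the page. -/
def bundle (s : Strand (List X)) : List (Strand X) :=
  (if s.up then s.comp else s.comp.reverse).map (Strand.mk s.up)

/-- The parallel strands, from left to right with respect to the orientation. -/
def strands (s : Strand (List X)) : List (Strand X) := s.comp.map (Strand.mk s.up)

theorem bundle_eq (s : Strand (List X)) :
    bundle s = if s.up then strands s else (strands s).reverse := by
  unfold bundle strands; split <;> simp

theorem bundle_perm (s : Strand (List X)) : (bundle s).Perm (strands s) := by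
  rw [bundle_eq]; split
  · rfl
  · exact List.reverse_perm _

@[simp] theorem length_bundle (s : Strand (List X)) : (bundle s).length = s.comp.length := by
  unfold bundle; split <;> simp

theorem bundle_flip (s : Strand (List X)) :
    bundle s.flip = ((bundle s).map Strand.flip).reverse := by
  obtain ⟨_ | _, c⟩ := s <;> simp [bundle, Strand.flip, Function.comp_def]

theorem bundle_relabel (f : X → Y) (s : Strand (List X)) :
    bundle (s.relabel (List.map f)) = (bundle s).map (Strand.relabel f) := by
  obtain ⟨_ | _, c⟩ := s <;>
    simp [bundle, Strand.relabel, Function.comp_def]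

/-- All strands of a list replaced by bundles. -/
def bundles (s : List (Strand (List X))) : List (Strand X) := s.flatMap bundle

@[simp] theorem bundles_nil : bundles ([] : List (Strand (List X))) = [] := rfl

@[simp] theorem bundles_cons (a : Strand (List X)) (s : List (Strand (List X))) :
    bundles (a :: s) = bundle a ++ bundles s := rfl

@[simp] theorem bundles_append (s t : List (Strand (List X))) :
    bundles (s ++ t) = bundles s ++ bundles t := by simp [bundles]

theorem length_bundles {r : ℕ} {s : List (Strand (List X))} (h : ∀ x ∈ s, x.comp.length = r) :
    (bundles s).length = r * s.length := by
  induction s with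
  | nil => simp
  | cons x s ih =>
    simp [h x (by simp), ih fun y hy => h y (by simp [hy]), mul_add, add_comm]

/-- The first strand moves to the right of the others by virtual crossings. -/
def back (x : Strand X) : List (Strand X) → Word X
  | [] => []
  | y :: t => ⟨0, .cross .virt x y⟩ :: shift 1 (back x t)

theorem runs_back (x : Strand X) (t : List (Strand X)) : Runs (x :: t) (back x t) (t ++ [x]) := by
  induction t with
  | nil => exact .nil _
  | cons y t ih => exact .cons_of_eq [] t rfl rfl (by simpa [Elem.tgt] using ih.frame_left [y])

@[simp] theorem events_back (x : Strand X) (t : List (Strand X)) : events (back x t) = [] := by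
  induction t with
  | nil => rfl
  | cons y t ih => simpa [back] using ih

/-- A cyclic permutation of strands, to the right for `b = true`, by virtual crossings. -/
def rotWord : Bool → List (Strand X) → Word X
  | true, l =>
    match l.getLast? with
    | none => []
    | some x => front l.dropLast x
  | false, [] => []
  | false, x :: l => back x l

/-- The effect of `rotWord`. -/
def pageRot (b : Bool) (l : List ι) : List ι := if b then rotR l else rotL l

@[simp] theorem length_pageRot (b : Bool) (l : List ι) : (pageRot b l).length = l.length := by
  cases b
  · exact (rotL_isRotated l).perm.length_eq
  · exact (rotR_isRotated l).perm.length_eq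

theorem runs_rotWord (b : Bool) (l : List (Strand X)) : Runs l (rotWord b l) (pageRot b l) := by
  cases b
  · cases l with
    | nil => exact .nil _
    | cons x l => exact runs_back x l
  · rcases List.eq_nil_or_concat' l with rfl | ⟨l, x, rfl⟩
    · exact .nil _
    · simpa [rotWord, pageRot] using runs_front l x

@[simp] theorem events_rotWord (b : Bool) (l : List (Strand X)) : events (rotWord b l) = [] := by
  cases b
  · cases l <;> simp [rotWord]
  · rcases List.eq_nil_or_concat' l with rfl | ⟨l, x, rfl⟩ <;> simp [rotWord]

theorem relabel_front (f : X → Y) (u : List (Strand X)) (x : Strand X) :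
    Word.relabel f (front u x) = front (u.map (Strand.relabel f)) (x.relabel f) := by
  induction u with
  | nil => rfl
  | cons y u ih => simp [front, ih, Elem.relabel]

theorem relabel_back (f : X → Y) (x : Strand X) (t : List (Strand X)) :
    Word.relabel f (back x t) = back (x.relabel f) (t.map (Strand.relabel f)) := by
  induction t with
  | nil => rfl
  | cons y u ih => simp [back, ih, Elem.relabel]

theorem relabel_rotWord (f : X → Y) (b : Bool) (l : List (Strand X)) :
    Word.relabel f (rotWord b l) = rotWord b (l.map (Strand.relabel f)) := by
  cases b
  · cases l <;> simp [rotWord, relabel_back]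
  · rcases List.eq_nil_or_concat' l with rfl | ⟨l, x, rfl⟩ <;> simp [rotWord, relabel_front]

/-- Two families of parallel strands cross each other; `κ p q` is the kind of the crossing of the
strands number `p` and `q`, counted from the left. -/
def gridWord (κ : ℕ → ℕ → Kind) (A B : List (Strand X)) : Word X :=
  A.zipIdx.reverse.flatMap fun a => B.zipIdx.map fun b => ⟨a.2 + b.2, .cross (κ a.2 b.2) a.1 b.1⟩

theorem gridWord_concat (κ : ℕ → ℕ → Kind) (A B : List (Strand X)) (a : Strand X) :
    gridWord κ (A ++ [a]) B =
      shift A.length (B.zipIdx.map fun b => ⟨b.2, .cross (κ A.length b.2) a b.1⟩) ++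
        gridWord κ A B := by
  simp [gridWord, List.zipIdx_append, shift, Function.comp_def]

theorem runs_row (κ : ℕ → Kind) (a : Strand X) (B u : List (Strand X)) :
    Runs (u ++ a :: B) ((B.zipIdx u.length).map fun b => ⟨b.2, .cross (κ b.2) a b.1⟩)
      (u ++ B ++ [a]) := by
  induction B generalizing u with
  | nil => simpa using Runs.nil _
  | cons b B ih =>
    refine .cons_of_eq u B (by simp [Elem.src]) rfl ?_
    simpa [Elem.tgt] using ih (u ++ [b])

theorem runs_gridWord (κ : ℕ → ℕ → Kind) (A B : List (Strand X)) :
    Runs (A ++ B) (gridWord κ A B) (B ++ A) := by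
  induction A using List.reverseRecOn with
  | nil => simpa [gridWord] using Runs.nil _
  | append_singleton A a ih =>
    rw [gridWord_concat]
    have h := (runs_row (κ A.length) a B []).frame_left A
    refine Runs.append (by simpa using h) (by simpa using ih.frame_right [a])

theorem relabel_gridWord (f : X → Y) (κ : ℕ → ℕ → Kind) (A B : List (Strand X)) :
    Word.relabel f (gridWord κ A B) =
      gridWord κ (A.map (Strand.relabel f)) (B.map (Strand.relabel f)) := by
  simp [gridWord, Word.relabel, List.map_flatMap, List.zipIdx_map, Function.comp_def,
    List.flatMap_map, Elem.relabel, ← List.map_reverse]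

/-! ### The multiplexing of a coloured diagram -/

/-- Parallel minima. -/
def cupWord (A : List (Strand X)) : Word X := A.zipIdx.map fun a => ⟨a.2, .cup a.1⟩

/-- Parallel maxima. -/
def capWord (A : List (Strand X)) : Word X := A.zipIdx.reverse.map fun a => ⟨a.2, .cap a.1⟩

theorem cupWord_cons (a : Strand X) (A : List (Strand X)) :
    cupWord (a :: A) = ⟨0, .cup a⟩ :: shift 1 (cupWord A) := by
  simp [cupWord, List.zipIdx_succ, shift, Function.comp_def, add_comm]

theorem capWord_cons (a : Strand X) (A : List (Strand X)) :
    capWord (a :: A) = shift 1 (capWord A) ++ [⟨0, .cap a⟩] := by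
  simp [capWord, List.zipIdx_succ, shift, Function.comp_def, add_comm, ← List.map_reverse]

theorem runs_cupWord (A : List (Strand X)) :
    Runs [] (cupWord A) (A ++ (A.map Strand.flip).reverse) := by
  induction A with
  | nil => exact .nil _
  | cons a A ih =>
    rw [cupWord_cons]
    refine .cons_of_eq [] [] rfl rfl ?_
    simpa [Elem.tgt] using ih.frame [a] [a.flip]

theorem runs_capWord (A : List (Strand X)) :
    Runs (A ++ (A.map Strand.flip).reverse) (capWord A) [] := by
  induction A with
  | nil => exact .nil _
  | cons a A ih =>
    rw [capWord_cons]
    refine Runs.append (m := [a, a.flip]) ?_ (.cons_of_eq [] [] rfl rfl (.nil _))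
    simpa using ih.frame [a] [a.flip]

theorem events_cupWord (A : List (Strand X)) : events (cupWord A) = A.map .cup := by
  induction A with
  | nil => rfl
  | cons a A ih => simp [cupWord_cons, ih]

theorem events_capWord (A : List (Strand X)) : events (capWord A) = (A.map .cap).reverse := by
  induction A with
  | nil => rfl
  | cons a A ih => simp [capWord_cons, ih]

theorem relabel_cupWord (f : X → Y) (A : List (Strand X)) :
    Word.relabel f (cupWord A) = cupWord (A.map (Strand.relabel f)) := by
  simp [cupWord, Word.relabel, List.zipIdx_map, Function.comp_def, Elem.relabel]

theorem relabel_capWord (f : X → Y) (A : List (Strand X)) :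
    Word.relabel f (capWord A) = capWord (A.map (Strand.relabel f)) := by
  simp [capWord, Word.relabel, List.zipIdx_map, Function.comp_def, Elem.relabel,
    ← List.map_reverse]

/-- The kinds of the crossings of two bundles of `r` strands with orientations `x` and `y`. -/
def gridKind (r : ℕ) (k : Kind) (x y : Bool) (p q : ℕ) : Kind :=
  if (if x = y then p = q else p + q + 1 = r) then k else .virt

/-- What replaces a coloured piece in the multiplexing, with the components of all strands. -/
def cmulElem (dir : Bool) : Elem (List X) → Word X
  | .cup s => cupWord (bundle s)
  | .cap s => capWord (bundle s)
  | .cross .virt a b =>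
      let c := xor dir (a.up == b.up)
      let A := bundle a
      let B := bundle b
      (if a.up then [] else rotWord c A) ++
      (if b.up then [] else shift A.length (rotWord (!c) B)) ++
      gridWord (gridKind A.length .virt a.up b.up) (if a.up then A else pageRot c A)
        (if b.up then B else pageRot (!c) B) ++
      (if a.up then shift B.length (rotWord c A) else []) ++
      (if b.up then rotWord (!c) B else [])
  | .cross k a b => gridWord (gridKind (bundle a).length k a.up b.up) (bundle a) (bundle b)

/-- The sign that stands for the convention `dir`. -/
def dirSign (dir : Bool) : ℤ := if dir then -1 else 1

theorem rot_zpow_map (f : ι → Y) (n : ℤ) (l : List ι) :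
    (rot ^ n) (l.map f) = ((rot ^ n) l).map f :=
  (map_zpow_apply (ρ := rot) (ρ' := rot) (f := List.map f) (fun c => (rotR_map f c).symm) n l).symm

theorem strands_turn (s : Strand (List X)) (n : ℤ) :
    strands (s.turn rot n) = (rot ^ n) (strands s) := by
  simp [strands, rot_zpow_map]

theorem bundle_turn_sign (s : Strand (List X)) :
    bundle (s.turn rot s.sign) = rotR (bundle s) := by
  obtain ⟨_ | _, c⟩ := s
  · change ((rotL c).reverse).map _ = rotR (c.reverse.map _)
    rw [rotR_map, rotR_reverse]
    rfl
  · exact (rotR_map _ _).symm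

theorem bundle_turn_neg_sign (s : Strand (List X)) :
    bundle (s.turn rot (-s.sign)) = rotL (bundle s) := by
  obtain ⟨_ | _, c⟩ := s
  · change ((rotR c).reverse).map _ = rotL (c.reverse.map _)
    rw [rotL_map, rotL_reverse]
    rfl
  · exact (rotL_map _ _).symm

theorem bundle_turn_virt (dir : Bool) (a b : Strand (List X)) :
    bundle (a.turn rot (twist (dirSign dir) .virt b)) =
      pageRot (xor dir (a.up == b.up)) (bundle a) ∧
    bundle (b.turn rot (-twist (dirSign dir) .virt a)) =
      pageRot (!xor dir (a.up == b.up)) (bundle b) := by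
  have ha := bundle_turn_sign a
  have ha' := bundle_turn_neg_sign a
  have hb := bundle_turn_sign b
  have hb' := bundle_turn_neg_sign b
  obtain ⟨_ | _, c⟩ := a <;> obtain ⟨_ | _, d⟩ := b <;> cases dir <;>
    exact ⟨by assumption, by assumption⟩

theorem runs_cmulElem (dir : Bool) (e : Elem (List X)) :
    Runs (bundles e.src) (cmulElem dir e) (bundles (e.ctgt rot (dirSign dir))) := by
  cases e with
  | cup s => simpa [cmulElem, Elem.src, Elem.ctgt, Elem.tgt, bundle_flip] using
      runs_cupWord (bundle s)
  | cap s => simpa [cmulElem, Elem.src, Elem.ctgt, Elem.tgt, bundle_flip] using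
      runs_capWord (bundle s)
  | cross k a b =>
    by_cases hk : k = .virt
    · subst hk
      obtain ⟨h1, h2⟩ := bundle_turn_virt dir a b
      simp only [Elem.src, Elem.ctgt, bundles_cons, bundles_nil, List.append_nil, h1, h2, cmulElem]
      generalize bundle a = A
      generalize bundle b = B
      generalize (a.up == b.up) = c₀
      generalize xor dir c₀ = c
      have hA := runs_rotWord c A
      have hB := runs_rotWord (!c) B
      generalize gridKind A.length .virt a.up b.up = κ
      have hg := fun A B : List (Strand X) => runs_gridWord κ A B
      cases a.up <;> cases b.up <;> simp only [Bool.false_eq_true, if_true, if_false,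
        List.append_nil, List.nil_append]
      · exact ((hA.frame_right B).append
          (by simpa using hB.frame_left (pageRot c A))).append (hg _ _)
      · exact ((hA.frame_right B).append (hg _ _)).append (hB.frame_right _)
      · have := hA.frame_left (pageRot (!c) B)
        rw [length_pageRot] at this
        exact ((hB.frame_left A).append (hg _ _)).append this
      · exact ((hg _ _).append (hA.frame_left B)).append (hB.frame_right _)
    · have h := runs_gridWord (gridKind (bundle a).length k a.up b.up) (bundle a) (bundle b)
      cases k <;> first | exact absurd rfl hk | simpa [Elem.src, Elem.ctgt, twist, cmulElem] using h

theorem cmulElem_relabel (dir : Bool) (f : X → Y) (e : Elem (List X)) :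
    cmulElem dir (e.relabel (List.map f)) = Word.relabel f (cmulElem dir e) := by
  have hp : ∀ (c : Bool) (l : List (Strand X)),
      pageRot c (l.map (Strand.relabel f)) = (pageRot c l).map (Strand.relabel f) := fun c l => by
    cases c
    · exact rotL_map _ _
    · exact rotR_map _ _
  rcases e with s | s | ⟨_ | _ | _, a, b⟩
  · simp [cmulElem, Elem.relabel, bundle_relabel, relabel_cupWord]
  · simp [cmulElem, Elem.relabel, bundle_relabel, relabel_capWord]
  · simp [cmulElem, Elem.relabel, bundle_relabel, relabel_gridWord]
  · simp [cmulElem, Elem.relabel, bundle_relabel, relabel_gridWord]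
  · simp only [cmulElem, Elem.relabel, bundle_relabel, Strand.relabel_up]
    cases a.up <;> cases b.up <;>
      simp [relabel_gridWord, relabel_rotWord, hp]

theorem zipIdx_replicate_zero (r : ℕ) (s : ι) :
    (List.replicate r s).zipIdx = (List.range r).map fun p => (s, p) := by
  apply List.ext_getElem <;> simp

theorem front_replicate (n : ℕ) (s : Strand X) :
    front (List.replicate n s) s =
      (List.range n).reverse.map fun p => ⟨p, .cross .virt s s⟩ := by
  induction n with
  | zero => rfl
  | succ n ih =>
    rw [List.replicate_succ, List.range_succ_eq_map]
    simp [front, ih, shift, Function.comp_def, add_comm, ← List.map_reverse]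

theorem back_replicate (n : ℕ) (s : Strand X) :
    back s (List.replicate n s) = (List.range n).map fun p => ⟨p, .cross .virt s s⟩ := by
  induction n with
  | zero => rfl
  | succ n ih =>
    rw [List.replicate_succ, List.range_succ_eq_map]
    simp [back, ih, shift, Function.comp_def, add_comm]

theorem rotWord_replicate (b : Bool) (r j : ℕ) (s : Strand X) :
    shift j (rotWord b (List.replicate r s)) = rotation b r j s := by
  cases r with
  | zero => cases b <;> simp [rotWord, rotation]
  | succ n =>
    cases b
    · simp [List.replicate_succ, rotWord, rotation, back_replicate, shift, Function.comp_def]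
    · rw [List.replicate_succ']
      simp [rotWord, rotation, front_replicate, shift, Function.comp_def]

theorem gridWord_replicate (r j : ℕ) (k : Kind) (a b : Strand X) :
    shift j (gridWord (gridKind r k a.up b.up) (List.replicate r a) (List.replicate r b)) =
      grid r j k a b := by
  simp [gridWord, grid, zipIdx_replicate_zero, shift, List.map_flatMap, Function.comp_def,
    List.flatMap_map, ← List.map_reverse, gridKind, add_assoc]

theorem bundle_forget {r : ℕ} {s : Strand (List X)} (h : s.comp.length = r) :
    (bundle s).map (Strand.relabel fun _ => (0 : Fin 1)) =
      List.replicate r (s.relabel fun _ => (0 : Fin 1)) := by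
  subst h
  obtain ⟨_ | _, c⟩ := s
  all_goals
    simp only [bundle, if_true, Bool.false_eq_true, if_false, List.map_map]
    rw [List.eq_replicate_iff]
    simp [Strand.relabel]

/-- What replaces a coloured letter in the multiplexing. -/
def cmul (dir : Bool) (r : ℕ) (l : Letter (List X)) : Word X :=
  shift (r * l.pos) (cmulElem dir l.elem)

theorem pageRot_replicate (b : Bool) (r : ℕ) (s : ι) :
    pageRot b (List.replicate r s) = List.replicate r s := by
  rw [List.eq_replicate_iff]
  refine ⟨by simp, fun x hx => ?_⟩
  have : (pageRot b (List.replicate r s)).Perm (List.replicate r s) := by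
    cases b
    · exact (rotL_isRotated _).perm
    · exact (rotR_isRotated _).perm
  exact List.eq_of_mem_replicate (this.subset hx)

theorem relabel_cmul (dir : Bool) (r : ℕ) (l : Letter (List X))
    (h : ∀ s ∈ l.elem.ends, s.comp.length = r) :
    Word.relabel (fun _ => (0 : Fin 1)) (cmul dir r l) =
      multiplexLetter dir r ⟨l.pos, l.elem.relabel fun _ => (0 : Fin 1)⟩ := by
  obtain ⟨i, e⟩ := l
  simp only [Elem.ends] at h
  rcases e with s | s | ⟨k, a, b⟩
  · have hs := bundle_forget (h s (by simp [Elem.tgt]))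
    simp only [cmul, cmulElem, relabel_shift, relabel_cupWord, hs, Elem.relabel, multiplexLetter]
    simp [cupWord, zipIdx_replicate_zero, shift, Function.comp_def]
  · have hs := bundle_forget (h s (by simp [Elem.src]))
    simp only [cmul, cmulElem, relabel_shift, relabel_capWord, hs, Elem.relabel, multiplexLetter]
    simp [capWord, zipIdx_replicate_zero, shift, Function.comp_def, ← List.map_reverse]
  · have la := h a (by simp [Elem.src])
    have lb := h b (by simp [Elem.src])
    have ha := bundle_forget la
    have hb := bundle_forget lb
    have hg := fun k => gridWord_replicate r (r * i) k (a.relabel fun _ => (0 : Fin 1))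
      (b.relabel fun _ => (0 : Fin 1))
    have hp : ∀ (c : Bool) (l : List (Strand X)),
        (pageRot c l).map (Strand.relabel fun _ => (0 : Fin 1)) =
          pageRot c (l.map (Strand.relabel fun _ => (0 : Fin 1))) := fun c l => by
      cases c
      · exact (rotL_map _ _).symm
      · exact (rotR_map _ _).symm
    simp only [Strand.relabel_up] at hg
    cases k
    · simp only [cmul, cmulElem, relabel_shift, relabel_gridWord, ha, hb, Elem.relabel,
        multiplexLetter, length_bundle, la, hg]
    · simp only [cmul, cmulElem, relabel_shift, relabel_gridWord, ha, hb, Elem.relabel,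
        multiplexLetter, length_bundle, la, hg]
    · simp only [cmul, cmulElem, Elem.relabel, multiplexLetter, length_bundle, la, lb,
        Strand.relabel_up]
      obtain ⟨_ | _, c⟩ := a <;> obtain ⟨_ | _, d⟩ := b <;>
        simp only at hg <;>
        simp [relabel_gridWord, relabel_rotWord, hp, ha, hb, pageRot_replicate,
          rotWord_replicate, hg]

/-- The multiplexing of a coloured diagram. -/
def mul (dir : Bool) (r : ℕ) (w : Word (List X)) : Word X := w.flatMap (cmul dir r)

@[simp] theorem mul_nil (dir : Bool) (r : ℕ) : mul dir r ([] : Word (List X)) = [] := rfl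

@[simp] theorem mul_cons (dir : Bool) (r : ℕ) (l : Letter (List X)) (w : Word (List X)) :
    mul dir r (l :: w) = cmul dir r l ++ mul dir r w := rfl

@[simp] theorem mul_append (dir : Bool) (r : ℕ) (w w' : Word (List X)) :
    mul dir r (w ++ w') = mul dir r w ++ mul dir r w' := by simp [mul]

theorem mul_shift (dir : Bool) (r n : ℕ) (w : Word (List X)) :
    mul dir r (shift n w) = shift (r * n) (mul dir r w) := by
  induction w with
  | nil => rfl
  | cons l w ih => simp [ih, cmul, mul_add]

theorem mul_relabel (dir : Bool) (r : ℕ) (f : X → Y) (w : Word (List X)) :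
    mul dir r (Word.relabel (List.map f) w) = Word.relabel f (mul dir r w) := by
  induction w with
  | nil => rfl
  | cons l w ih => simp [ih, cmul, cmulElem_relabel]

theorem bundles_relabel (f : X → Y) (s : List (Strand (List X))) :
    bundles (s.map (Strand.relabel (List.map f))) = (bundles s).map (Strand.relabel f) := by
  induction s with
  | nil => rfl
  | cons a s ih => simp [ih, bundle_relabel]

/-- Coloured diagrams with colours of length `r`. -/
abbrev LRuns (dir : Bool) (r : ℕ) : List (Strand (List X)) → Word (List X) →
    List (Strand (List X)) → Prop :=
  CRuns rot (dirSign dir) fun c => c.length = r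

theorem CRuns.length_colors {dir : Bool} {r : ℕ} {s t : List (Strand (List X))}
    {w : Word (List X)} (h : LRuns dir r s w t) (hs : ∀ x ∈ s, x.comp.length = r) :
    ∀ x ∈ t, x.comp.length = r :=
  CRuns.colors h (fun c n hc => by simpa using hc) hs

theorem LRuns.induction_step {dir : Bool} {r : ℕ} {u v : List (Strand (List X))}
    {e : Elem (List X)} (hq : ∀ s, e = .cup s → s.comp.length = r)
    (hs : ∀ x ∈ u ++ e.src ++ v, x.comp.length = r) :
    ∀ x ∈ u ++ e.ctgt rot (dirSign dir) ++ v, x.comp.length = r :=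
  CRuns.length_colors (dir := dir) (.cons u v e [] _ hq (.nil _)) hs

theorem Elem.forall_ends {P : C → Prop} {e : Elem C} (hq : ∀ s, e = .cup s → P s.comp)
    (hs : ∀ x ∈ e.src, P x.comp) : ∀ x ∈ e.ends, P x.comp := by
  intro x hx
  cases e with
  | cup y =>
    simp only [Elem.ends, Elem.src, Elem.tgt, List.nil_append, List.mem_cons,
      List.not_mem_nil, or_false] at hx
    rcases hx with h | h <;> rw [h] <;> exact hq y rfl
  | cap y => exact hs x (by simpa [Elem.ends, Elem.tgt] using hx)
  | cross k a b =>
    simp only [Elem.ends, Elem.src, Elem.tgt, List.mem_append, List.mem_cons,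
      List.not_mem_nil, or_false] at hx
    rcases hx with (rfl | rfl) | rfl | rfl <;> exact hs _ (by simp [Elem.src])

theorem runs_cmul (dir : Bool) {r : ℕ} {u v : List (Strand (List X))} {e : Elem (List X)}
    (hu : ∀ x ∈ u, x.comp.length = r) :
    Runs (bundles (u ++ e.src ++ v)) (cmul dir r ⟨u.length, e⟩)
      (bundles (u ++ e.ctgt rot (dirSign dir) ++ v)) := by
  have := (runs_cmulElem dir e).frame (bundles u) (bundles v)
  rw [length_bundles hu] at this
  simpa [cmul] using this

theorem runs_mul {dir : Bool} {r : ℕ} {s t : List (Strand (List X))} {w : Word (List X)}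
    (h : LRuns dir r s w t) (hs : ∀ x ∈ s, x.comp.length = r) :
    Runs (bundles s) (mul dir r w) (bundles t) := by
  induction h with
  | nil => exact .nil _
  | cons u v e w t hq _ ih =>
    exact (runs_cmul dir fun x hx => hs x (by simp [hx])).append
      (ih (LRuns.induction_step hq hs))

/-- The crossings between a strand `a` and the strands `B` when only the crossing with the strand
number `n` is not virtual. -/
theorem events_row {k : Kind} (hk : k ≠ .virt) (n m : ℕ) (κ : ℕ → Kind)
    (hκ : ∀ q, κ q = if q = n + m then k else .virt) (a : Strand X) (B : List (Strand X)) :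
    events ((B.zipIdx m).map fun b => ⟨b.2, .cross (κ b.2) a b.1⟩) =
      (B[n]?).toList.map (.cross k a) := by
  induction B generalizing n m with
  | nil => simp
  | cons b B ih =>
    simp only [List.zipIdx_cons, List.map_cons]
    cases n with
    | zero =>
      have h1 : κ m = k := by simp [hκ]
      have h2 : events ((B.zipIdx (m + 1)).map fun b => ⟨b.2, .cross (κ b.2) a b.1⟩) = [] := by
        rw [events, List.filter_eq_nil_iff]
        intro e he
        simp only [List.map_map, List.mem_map] at he
        obtain ⟨⟨c, q⟩, hc, rfl⟩ := he
        have hq := List.le_snd_of_mem_zipIdx hc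
        have : κ q = .virt := by rw [hκ, if_neg]; simp at hq; omega
        simp [this, Elem.isVirtual]
      rw [h1, events_cross hk, h2]
      rfl
    | succ n =>
      have h1 : κ m = .virt := by rw [hκ, if_neg]; omega
      rw [h1, events_virt, ih n (m + 1) (by simpa [add_assoc, add_comm 1] using hκ)]
      simp

/-- The Gauss code of two crossing bundles when the strand number `p` of `A` has a real crossing
with the strand number `p` of `B'` only. -/
theorem events_gridWord {k : Kind} (hk : k ≠ .virt) (κ : ℕ → ℕ → Kind) (n : ℕ → ℕ)
    (A B B' : List (Strand X)) (hκ : ∀ p < A.length, ∀ q, κ p q = if q = n p then k else .virt)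
    (hB : ∀ p < A.length, B[n p]? = B'[p]?) (hAB : A.length ≤ B'.length) :
    events (gridWord κ A B) = (List.zipWith (.cross k) A B').reverse := by
  induction A using List.reverseRecOn with
  | nil => simp [gridWord]
  | append_singleton A a ih =>
    simp only [List.length_append, List.length_singleton] at hκ hB hAB
    have hlt : A.length < B'.length := by omega
    have h1 : List.zipWith (Elem.cross k) (A ++ [a]) B' =
        List.zipWith (.cross k) A B' ++ [.cross k a B'[A.length]] := by
      apply List.ext_getElem
      · simp; omega
      · intro i h1 h2
        simp only [List.getElem_zipWith, List.getElem_append]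
        simp only [List.length_zipWith, List.length_append, List.length_singleton] at h1 ⊢
        by_cases hi : i < A.length
        · simp [hi, hi.trans hlt]
        · have : i = A.length := by omega
          subst this
          simp [hlt.le]
    rw [gridWord_concat, events_append, events_shift,
      events_row hk (n A.length) 0 (κ A.length) (by simpa using hκ A.length (by omega)),
      hB _ (by omega), ih (fun p hp => hκ p (by omega)) (fun p hp => hB p (by omega)) (by omega),
          h1]
    simp [hlt]

theorem events_cmulElem_cross (dir : Bool) {k : Kind} (hk : k ≠ .virt)
    (a b : Strand (List X)) (h : a.comp.length = b.comp.length) :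
    (events (cmulElem dir (.cross k a b))).Perm
      (List.zipWith (.cross k) (strands a) (strands b)) := by
  have h1 : cmulElem dir (.cross k a b) =
      gridWord (gridKind (bundle a).length k a.up b.up) (bundle a) (bundle b) := by
    cases k <;> first | rfl | exact absurd rfl hk
  have hl : (bundle a).length = (bundle b).length := by simpa using h
  have hsl : (strands a).length = (strands b).length := by simpa [strands] using h
  have hs : ∀ A B : List (Strand X), A.length = B.length →
      events (gridWord (gridKind A.length k true true) A B) =
        (List.zipWith (.cross k) A B).reverse := fun A B hAB =>
    events_gridWord hk _ id A B B (fun p hp q => by simp [gridKind, eq_comm])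
      (fun p hp => rfl) hAB.le
  have hd : ∀ A B : List (Strand X), A.length = B.length →
      events (gridWord (gridKind A.length k true false) A B) =
        (List.zipWith (.cross k) A B.reverse).reverse := fun A B hAB =>
    events_gridWord hk _ (fun p => A.length - 1 - p) A B B.reverse
      (fun p hp q => by
        simp only [gridKind, Bool.true_eq_false, if_false]
        congr 1
        simp only [eq_iff_iff]; omega)
      (fun p hp => by rw [List.getElem?_reverse (hAB ▸ hp), hAB]) (by simp [hAB])
  have hgs : ∀ x n, gridKind n k x x = gridKind n k true true := fun x n => by
    funext p q; simp [gridKind]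
  have hgd : ∀ n, gridKind n k false true = gridKind n k true false := fun n => by
    funext p q; simp [gridKind]
  rw [h1]
  rw [bundle_eq, bundle_eq] at hl ⊢
  cases hx : a.up <;> cases hy : b.up <;> simp only [hx, hy, if_true, Bool.false_eq_true, if_false]
    at hl ⊢
  · rw [hgs false, hs _ _ hl, ← List.reverse_zipWith hsl, List.reverse_reverse]
  · rw [hgd, hd _ _ hl, ← List.reverse_zipWith hsl, List.reverse_reverse]
  · rw [hd _ _ hl, List.reverse_reverse]
    exact List.reverse_perm _
  · rw [hgs true, hs _ _ hl]
    exact List.reverse_perm _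

theorem events_cmulElem_virt (dir : Bool) (a b : Strand (List X)) :
    events (cmulElem dir (.cross .virt a b)) = [] := by
  have hg : ∀ (n : ℕ) (x y : Bool) (A B : List (Strand X)),
      events (gridWord (gridKind n .virt x y) A B) = [] := fun n x y A B => by
    rw [events, List.filter_eq_nil_iff]
    intro e he
    simp only [gridWord, List.map_flatMap, List.mem_flatMap, List.map_map, List.mem_map] at he
    obtain ⟨a, -, b, -, rfl⟩ := he
    simp [gridKind, Elem.isVirtual]
  simp only [cmulElem]
  cases a.up <;> cases b.up <;> simp [hg]

/-! ### Multiplexing the local moves -/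

theorem CRuns.cons_of_eq {ρ : Equiv.Perm C} {δ : ℤ} {Q : C → Prop} {s t : List (Strand C)}
    {e : Elem C} {i : ℕ} {w : Word C} (u v : List (Strand C)) (hs : s = u ++ e.src ++ v)
    (h : i = u.length) (hq : ∀ s, e = .cup s → Q s.comp)
    (hw : CRuns ρ δ Q (u ++ e.ctgt ρ δ ++ v) w t) : CRuns ρ δ Q s (⟨i, e⟩ :: w) t :=
  hs ▸ h ▸ .cons _ _ _ _ _ hq hw

theorem cruns_cross_cons {ρ : Equiv.Perm C} {δ : ℤ} {Q : C → Prop} {t : List (Strand C)}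
    {i : ℕ} {k : Kind} {a b : Strand C} {w : Word C} (u v : List (Strand C)) (h : i = u.length)
    (hw : CRuns ρ δ Q (u ++ b.turn ρ (-twist δ k a) :: a.turn ρ (twist δ k b) :: v) w t) :
    CRuns ρ δ Q (u ++ a :: b :: v) (⟨i, .cross k a b⟩ :: w) t :=
  .cons_of_eq u v (by simp [Elem.src]) h (by simp) (by simpa [Elem.ctgt] using hw)

theorem cruns_cap_cons {ρ : Equiv.Perm C} {δ : ℤ} {Q : C → Prop} {t : List (Strand C)}
    {i : ℕ} {a b : Strand C} {w : Word C} (u v : List (Strand C)) (h : i = u.length)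
    (hb : b = a.flip) (hw : CRuns ρ δ Q (u ++ v) w t) :
    CRuns ρ δ Q (u ++ a :: b :: v) (⟨i, .cap a⟩ :: w) t :=
  .cons_of_eq u v (by simp [Elem.src, hb]) h (by simp) (by simpa [Elem.ctgt, Elem.tgt] using hw)

theorem cruns_cup_cons {ρ : Equiv.Perm C} {δ : ℤ} {Q : C → Prop} {t : List (Strand C)}
    {i : ℕ} {a : Strand C} {w : Word C} (u v : List (Strand C)) (h : i = u.length)
    (hq : Q a.comp) (hw : CRuns ρ δ Q (u ++ a :: a.flip :: v) w t) :
    CRuns ρ δ Q (u ++ v) (⟨i, .cup a⟩ :: w) t :=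
  .cons_of_eq u v (by simp [Elem.src]) h (by rintro _ ⟨⟩; exact hq)
    (by simpa [Elem.ctgt, Elem.tgt] using hw)

section Coloured

variable (ρ : Equiv.Perm C) (δ : ℤ) (Q : C → Prop) (k k₁ k₂ k₃ : Kind) (a b c x : Strand C)

/-- One side of the second moves, coloured and drawn at the left end.  The colours above the first
piece are those that result from it. -/
def cBigon : Word C :=
  [⟨0, .cross k a b⟩, ⟨0, .cross k.swap (b.turn ρ (-twist δ k a)) (a.turn ρ (twist δ k b))⟩]

/-- One side of the third moves, coloured. -/
def cTriangle₁ : Word C :=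
  [⟨0, .cross k₁ a b⟩, ⟨1, .cross k₂ (a.turn ρ (twist δ k₁ b)) c⟩,
    ⟨0, .cross k₃ (b.turn ρ (-twist δ k₁ a)) (c.turn ρ (-twist δ k₂ a))⟩]

/-- The other side of the third moves, coloured. -/
def cTriangle₂ : Word C :=
  [⟨1, .cross k₃ b c⟩, ⟨0, .cross k₂ a (c.turn ρ (-twist δ k₃ b))⟩,
    ⟨1, .cross k₁ (a.turn ρ (twist δ k₂ c)) (b.turn ρ (twist δ k₃ c))⟩]

/-- One side of `capSlide`, coloured. -/
def cCapSlide₁ : Word C :=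
  [⟨0, .cross k x a⟩, ⟨1, .cap (x.turn ρ (twist δ k a))⟩]

/-- The other side of `capSlide`, coloured. -/
def cCapSlide₂ : Word C :=
  [⟨1, .cross k.swap a (x.turn ρ (twist δ k a)).flip⟩, ⟨0, .cap x⟩]

/-- One side of `cupSlide`, coloured. -/
def cCupSlide₁ : Word C :=
  [⟨1, .cup x⟩, ⟨0, .cross k a x⟩]

/-- The other side of `cupSlide`, coloured. -/
def cCupSlide₂ : Word C :=
  [⟨0, .cup (x.turn ρ (-twist δ k a))⟩, ⟨1, .cross k.swap (x.turn ρ (-twist δ k a)).flip a⟩]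

/-- The curl at a maximum, coloured. -/
def cCurlCap : Word C :=
  [⟨0, .cross k x x.flip⟩, ⟨0, .cap (x.flip.turn ρ (-twist δ k x))⟩]

/-- The curl at a minimum, coloured. -/
def cCurlCup : Word C :=
  [⟨0, .cup x⟩, ⟨0, .cross k x x.flip⟩]

variable {ρ δ Q}

theorem cruns_cBigon : CRuns ρ δ Q [a, b] (cBigon ρ δ k a b) [a, b] :=
  cruns_cross_cons [] [] rfl (cruns_cross_cons [] [] rfl (cruns_nil_iff.2 (by simp)))

theorem cruns_cTriangle₁ : CRuns ρ δ Q [a, b, c] (cTriangle₁ ρ δ k₁ k₂ k₃ a b c)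
    [c.turn ρ (-twist δ k₂ a - twist δ k₃ b), b.turn ρ (twist δ k₃ c - twist δ k₁ a),
      a.turn ρ (twist δ k₁ b + twist δ k₂ c)] :=
  cruns_cross_cons [] [c] rfl (cruns_cross_cons [_] [] rfl (cruns_cross_cons [] [_] rfl
    (cruns_nil_iff.2 (by simp [sub_eq_add_neg, add_comm]))))

theorem cruns_cTriangle₂ : CRuns ρ δ Q [a, b, c] (cTriangle₂ ρ δ k₁ k₂ k₃ a b c)
    [c.turn ρ (-twist δ k₂ a - twist δ k₃ b), b.turn ρ (twist δ k₃ c - twist δ k₁ a),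
      a.turn ρ (twist δ k₁ b + twist δ k₂ c)] :=
  cruns_cross_cons [a] [] rfl (cruns_cross_cons [] [_] rfl (cruns_cross_cons [_] [] rfl
    (cruns_nil_iff.2 (by simp [sub_eq_add_neg, add_comm]))))

theorem cruns_cCapSlide₁ : CRuns ρ δ Q [x, a, (x.turn ρ (twist δ k a)).flip]
    (cCapSlide₁ ρ δ k a x) [a.turn ρ (-twist δ k x)] :=
  cruns_cross_cons [] [_] rfl (cruns_cap_cons [_] [] rfl rfl (.nil _))

theorem cruns_cCapSlide₂ : CRuns ρ δ Q [x, a, (x.turn ρ (twist δ k a)).flip]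
    (cCapSlide₂ ρ δ k a x) [a.turn ρ (-twist δ k x)] :=
  cruns_cross_cons [x] [] rfl (cruns_cap_cons [] [_] rfl (by simp [Strand.turn_flip])
    (cruns_nil_iff.2 (by simp)))

theorem cruns_cCupSlide₁ (hx : Q x.comp) : CRuns ρ δ Q [a] (cCupSlide₁ k a x)
    [x.turn ρ (-twist δ k a), a.turn ρ (twist δ k x), x.flip] :=
  cruns_cup_cons [a] [] rfl hx (cruns_cross_cons [] [_] rfl (.nil _))

theorem cruns_cCupSlide₂ (hx : Q ((ρ ^ (-twist δ k a)) x.comp)) :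
    CRuns ρ δ Q [a] (cCupSlide₂ ρ δ k a x)
      [x.turn ρ (-twist δ k a), a.turn ρ (twist δ k x), x.flip] :=
  cruns_cup_cons [] [a] rfl hx (cruns_cross_cons [_] [] rfl
    (cruns_nil_iff.2 (by simp [Strand.turn_flip])))

theorem cruns_cCurlCap : CRuns ρ δ Q [x, x.flip] (cCurlCap ρ δ k x) [] :=
  cruns_cross_cons [] [] rfl (cruns_cap_cons [] [] rfl (by simp [Strand.turn_flip]) (.nil _))

theorem cruns_cCurlCup (hx : Q x.comp) : CRuns ρ δ Q [] (cCurlCup k x)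
    [(x.turn ρ (-twist δ k x)).flip, x.turn ρ (-twist δ k x)] :=
  cruns_cup_cons [] [] rfl hx (cruns_cross_cons [] [] rfl
    (cruns_nil_iff.2 (by simp [Strand.turn_flip])))

end Coloured

/-- A coloured strand whose bundle consists of strands with different names: the strand number `p`
of the bundle is called `(i, p)`. -/
def univStrand (r i : ℕ) (up : Bool) : Strand (List (ℕ × ℕ)) := ⟨up, (List.range r).map (Prod.mk i)⟩

theorem univStrand_flip (r i : ℕ) (up : Bool) :
    (univStrand r i up).flip = univStrand r i (!up) := rfl

theorem length_univStrand (r i : ℕ) (up : Bool) : (univStrand r i up).comp.length = r := by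
  simp [univStrand]

/-- Every triple of coloured strands is obtained by renaming from a triple of strands with different
names. -/
theorem exists_relabel_univStrand [Nonempty X] {r : ℕ} (a b c : Strand (List X))
    (ha : a.comp.length = r) (hb : b.comp.length = r) (hc : c.comp.length = r) :
    ∃ f : ℕ × ℕ → X, a = (univStrand r 0 a.up).relabel (List.map f) ∧
      b = (univStrand r 1 b.up).relabel (List.map f) ∧
      c = (univStrand r 2 c.up).relabel (List.map f) := by
  obtain ⟨x⟩ := ‹Nonempty X›
  have key : ∀ (s : Strand (List X)) (i : ℕ) (f : ℕ × ℕ → X), s.comp.length = r →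
      (∀ p, f (i, p) = s.comp.getD p x) → s = (univStrand r i s.up).relabel (List.map f) := by
    rintro ⟨up, l⟩ i f hl hf
    simp only at hl hf
    simp only [univStrand, Strand.relabel, List.map_map, Strand.mk.injEq, true_and]
    apply List.ext_getElem
    · simp [hl]
    · intro p h1 h2
      simp [hf, h1]
  exact ⟨fun q => (if q.1 = 0 then a else if q.1 = 1 then b else c).comp.getD q.2 x,
    key a 0 _ ha (by simp), key b 1 _ hb (by simp), key c 2 _ hc (by simp)⟩

@[simp] theorem relabel_turn_rot (f : X → Y) (s : Strand (List X)) (n : ℤ) :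
    (s.turn rot n).relabel (List.map f) = (s.relabel (List.map f)).turn rot n := by
  simp [Strand.turn, Strand.relabel, rot_zpow_map]

theorem strands_univStrand (r i : ℕ) (up : Bool) (n : ℤ) :
    strands ((univStrand r i up).turn rot n) =
      ((rot ^ n) (List.range r)).map fun p => ⟨up, (i, p)⟩ := by
  rw [strands_turn, strands, univStrand, List.map_map, rot_zpow_map]
  rfl

theorem events_cross_univStrand (dir : Bool) {k : Kind} (hk : k ≠ .virt) (r i j : ℕ)
    (x y : Bool) (n : ℤ) :
    (events (cmulElem dir (.cross k ((univStrand r i x).turn rot n)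
      ((univStrand r j y).turn rot n)))).Perm
      ((List.range r).map fun p => .cross k ⟨x, (i, p)⟩ ⟨y, (j, p)⟩) := by
  refine (events_cmulElem_cross dir hk _ _ (by simp [univStrand])).trans ?_
  rw [strands_univStrand, strands_univStrand, List.zipWith_map, List.zipWith_self]
  exact (rot_zpow_isRotated n (List.range r)).perm.map _

theorem events_cap_univStrand (dir : Bool) (r i : ℕ) (x : Bool) (n : ℤ) :
    (events (cmulElem dir (.cap ((univStrand r i x).turn rot n)))).Perm
      ((List.range r).map fun p => .cap ⟨x, (i, p)⟩) := by
  rw [cmulElem, events_capWord]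
  refine (List.reverse_perm _).trans (((bundle_perm _).map _).trans ?_)
  rw [strands_univStrand, List.map_map]
  exact (rot_zpow_isRotated n (List.range r)).perm.map _

theorem events_cup_univStrand (dir : Bool) (r i : ℕ) (x : Bool) (n : ℤ) :
    (events (cmulElem dir (.cup ((univStrand r i x).turn rot n)))).Perm
      ((List.range r).map fun p => .cup ⟨x, (i, p)⟩) := by
  rw [cmulElem, events_cupWord]
  refine ((bundle_perm _).map _).trans ?_
  rw [strands_univStrand, List.map_map]
  exact (rot_zpow_isRotated n (List.range r)).perm.map _

theorem mem_bundle_univStrand {r i : ℕ} {x : Bool} {n : ℤ} {s : Strand (ℕ × ℕ)} :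
    s ∈ bundle ((univStrand r i x).turn rot n) ↔ ∃ p < r, s = ⟨x, (i, p)⟩ := by
  rw [(bundle_perm _).mem_iff, strands_univStrand, List.mem_map]
  simp only [(rot_zpow_isRotated n (List.range r)).perm.mem_iff, List.mem_range, eq_comm]

theorem nodup_bundle_univStrand (r i : ℕ) (x : Bool) (n : ℤ) :
    (bundle ((univStrand r i x).turn rot n)).Nodup := by
  rw [(bundle_perm _).nodup_iff, strands_univStrand]
  exact ((rot_zpow_isRotated n (List.range r)).perm.nodup_iff.2 List.nodup_range).map
    (fun p q h => by simpa using h)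

theorem disjoint_bundle_univStrand {r i j : ℕ} {x y : Bool} (m n : ℤ) (h : (x, i) ≠ (y, j)) :
    List.Disjoint (bundle ((univStrand r i x).turn rot m))
      (bundle ((univStrand r j y).turn rot n)) := fun s hs hs' => by
  obtain ⟨p, -, rfl⟩ := mem_bundle_univStrand.1 hs
  obtain ⟨q, -, h'⟩ := mem_bundle_univStrand.1 hs'
  simp only [Strand.mk.injEq, Prod.mk.injEq] at h'
  exact h (by simp [h'])

theorem mem_events {l : Letter X} {w : Word X} (h : l ∈ w) (hl : l.elem.isVirtual = false) :
    l.elem ∈ events w :=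
  List.mem_filter.2 ⟨List.mem_map_of_mem h, by simp [hl]⟩

/-- Comparison of Gauss codes for the multiplexings of coloured diagrams without minima. -/
theorem tequiv_mul_of_reduces {dir : Bool} {r : ℕ} {s t : List (Strand (List X))}
    {w w' : Word (List X)} (h : LRuns dir r s w t) (h' : LRuns dir r s w' t)
    (hs : ∀ x ∈ s, x.comp.length = r) (hn : (bundles s).Nodup)
    (hr : Reduces (events (mul dir r w)) (events (mul dir r w')))
    (hc : ∀ x, .cup x ∉ events (mul dir r w)) (hc' : ∀ x, .cup x ∉ events (mul dir r w')) :
    TEquiv (bundles s) (bundles t) (mul dir r w) (mul dir r w') :=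
  hr.tequiv
    (.of_runs (runs_mul h hs) hn fun l hl x hx => hc x (hx ▸ mem_events hl
        (by simp [hx, Elem.isVirtual])))
    (.of_runs (runs_mul h' hs) hn fun l hl x hx =>
      hc' x (hx ▸ mem_events hl (by simp [hx, Elem.isVirtual]))) rfl rfl

/-- Comparison of Gauss codes for the multiplexings of coloured diagrams without maxima. -/
theorem tequiv_mul_of_reduces' {dir : Bool} {r : ℕ} {s t : List (Strand (List X))}
    {w w' : Word (List X)} (h : LRuns dir r s w t) (h' : LRuns dir r s w' t)
    (hs : ∀ x ∈ s, x.comp.length = r) (hn : (bundles t).Nodup)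
    (hr : Reduces (events (mul dir r w)) (events (mul dir r w')))
    (hc : ∀ x, .cap x ∉ events (mul dir r w)) (hc' : ∀ x, .cap x ∉ events (mul dir r w')) :
    TEquiv (bundles s) (bundles t) (mul dir r w) (mul dir r w') :=
  hr.tequiv
    (.of_runs' (runs_mul h hs) hn fun l hl x hx => hc x
        (hx ▸ mem_events hl (by simp [hx, Elem.isVirtual])))
    (.of_runs' (runs_mul h' hs) hn fun l hl x hx =>
      hc' x (hx ▸ mem_events hl (by simp [hx, Elem.isVirtual]))) rfl rfl

theorem events_cmul (dir : Bool) (r : ℕ) (l : Letter (List X)) :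
    events (cmul dir r l) = events (cmulElem dir l.elem) := by simp [cmul]

/-! ### Moves of bundles with distinct names -/

theorem nodup_bundles_univStrand (r : ℕ) (l : List (ℕ × Bool × ℤ))
    (h : (l.map fun t => (t.2.1, t.1)).Nodup) :
    (bundles (l.map fun t => (univStrand r t.1 t.2.1).turn rot t.2.2)).Nodup := by
  induction l with
  | nil => simp
  | cons t l ih =>
    simp only [List.map_cons, List.nodup_cons] at h
    rw [List.map_cons, bundles_cons, List.nodup_append']
    refine ⟨nodup_bundle_univStrand _ _ _ _, ih h.2, ?_⟩
    intro s hs hs'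
    obtain ⟨b, hb, hsb⟩ := List.mem_flatMap.1 hs'
    obtain ⟨t', ht', rfl⟩ := List.mem_map.1 hb
    refine disjoint_bundle_univStrand _ _ (fun he => h.1 ?_) hs hsb
    exact List.mem_map.2 ⟨t', ht', he.symm⟩

theorem cup_cap_notMem_events_cross (dir : Bool) (k : Kind) (a b : Strand (List X))
    (x : Strand X) : .cup x ∉ events (cmulElem dir (.cross k a b)) ∧
      .cap x ∉ events (cmulElem dir (.cross k a b)) := by
  by_cases hk : k = .virt
  · subst hk; simp [events_cmulElem_virt]
  · have h1 : cmulElem dir (.cross k a b) =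
        gridWord (gridKind (bundle a).length k a.up b.up) (bundle a) (bundle b) := by
      cases k <;> first | rfl | exact absurd rfl hk
    rw [h1]
    constructor <;> intro h <;>
      simp [events, gridWord, List.map_flatMap] at h

@[simp] theorem events_cmulElem_cup (dir : Bool) (s : Strand (List X)) :
    events (cmulElem dir (.cup s)) = (bundle s).map .cup := events_cupWord _

@[simp] theorem events_cmulElem_cap (dir : Bool) (s : Strand (List X)) :
    events (cmulElem dir (.cap s)) = ((bundle s).map .cap).reverse := events_capWord _

theorem atPlace_cross (k : Kind) (x y : Bool) (i j p : ℕ) :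
    Reduces.AtPlace (fun s : Strand (ℕ × ℕ) => s.comp.2) p [.cross k ⟨x, (i, p)⟩ ⟨y, (j, p)⟩] := by
  simp only [Reduces.AtPlace, Elem.ends, Elem.src, Elem.tgt, forall_eq,
    List.cons_append, List.nil_append, List.mem_cons, List.not_mem_nil, or_false]
  rintro s (rfl | rfl | rfl | rfl) <;> rfl

theorem atPlace_cap (x : Bool) (i p : ℕ) :
    Reduces.AtPlace (fun s : Strand (ℕ × ℕ) => s.comp.2) p [.cap ⟨x, (i, p)⟩] := by
  simp [Reduces.AtPlace, Elem.ends, Elem.src, Elem.tgt, Strand.flip]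

theorem atPlace_cup (x : Bool) (i p : ℕ) :
    Reduces.AtPlace (fun s : Strand (ℕ × ℕ) => s.comp.2) p [.cup ⟨x, (i, p)⟩] := by
  simp [Reduces.AtPlace, Elem.ends, Elem.src, Elem.tgt, Strand.flip]

section Univ

variable (dir : Bool) (r : ℕ)

/-- A second move of strands whose bundles have different names for all strands becomes one second
move at each place.  The other local moves are treated in the same way; for virtual crossings there
is nothing left to do after the comparison of Gauss codes. -/
theorem tequiv_univ_bigon (k : Kind) (x y : Bool) :
    TEquiv (bundles [univStrand r 0 x, univStrand r 1 y])
      (bundles [univStrand r 0 x, univStrand r 1 y])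
      (mul dir r (cBigon rot (dirSign dir) k (univStrand r 0 x) (univStrand r 1 y)))
      (mul dir r []) := by
  refine tequiv_mul_of_reduces (cruns_cBigon _ _ _) (.nil _) (by simp [length_univStrand])
    (by simpa using nodup_bundles_univStrand r [(0, x, 0), (1, y, 0)] (by simp)) ?_ ?_ (by simp)
  · by_cases hk : k = .virt
    · subst hk
      simpa [cBigon, events_cmul, events_cmulElem_virt] using Reduces.refl _
    · have hk' : k.swap ≠ .virt := by cases k <;> simp [Kind.swap] at hk ⊢
      have e1 := events_cross_univStrand dir hk r 0 1 x y 0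
      have e2 := events_cross_univStrand dir hk' r 1 0 y x 0
      have h1 := (Reduces.two List.nodup_range (atPlace_cross k x y 0 1)
        (atPlace_cross k.swap y x 1 0) e1 e2).1
      have h2 := Reduces.flatMap (P := List.range r) fun p _ =>
        Reduces.bigon hk (⟨x, (0, p)⟩ : Strand (ℕ × ℕ)) ⟨y, (1, p)⟩
      have h3 : ((List.range r).flatMap fun _ => ([] : List (Elem (ℕ × ℕ)))) = [] := by
        simp [List.flatMap_eq_nil_iff]
      rw [h3] at h2
      simpa [cBigon, events_cmul, twist_of_ne hk] using h1.trans h2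
  · simp [cBigon, events_cmul, cup_cap_notMem_events_cross]

theorem tequiv_univ_capSlide (k : Kind) (x y : Bool) :
    TEquiv (bundles [univStrand r 0 x, univStrand r 1 y,
        ((univStrand r 0 x).turn rot (twist (dirSign dir) k (univStrand r 1 y))).flip])
      (bundles [(univStrand r 1 y).turn rot (-twist (dirSign dir) k (univStrand r 0 x))])
      (mul dir r (cCapSlide₁ rot (dirSign dir) k (univStrand r 1 y) (univStrand r 0 x)))
      (mul dir r (cCapSlide₂ rot (dirSign dir) k (univStrand r 1 y) (univStrand r 0 x))) := by
  refine tequiv_mul_of_reduces (cruns_cCapSlide₁ _ _ _) (cruns_cCapSlide₂ _ _ _)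
    (by simp [length_univStrand, Strand.flip])
    (by simpa [Strand.turn_flip, univStrand_flip] using nodup_bundles_univStrand r
          [(0, x, 0), (1, y, 0), (0, !x, (twist (dirSign dir) k (univStrand r 1 y)))] (by simp)) ?_
              ?_ ?_
  · have c1 := events_cap_univStrand dir r 0 x (twist (dirSign dir) k (univStrand r 1 y))
    have c2 := events_cap_univStrand dir r 0 x 0
    by_cases hk : k = .virt
    · subst hk
      have h1 := (Reduces.of_perm_map List.nodup_range (atPlace_cap x 0) c1).1
      have h2 := (Reduces.of_perm_map List.nodup_range (atPlace_cap x 0) c2).2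
      simpa [cCapSlide₁, cCapSlide₂, events_cmul, events_cmulElem_virt] using h1.trans h2
    · have hk' : k.swap ≠ .virt := by cases k <;> simp [Kind.swap] at hk ⊢
      have e1 := events_cross_univStrand dir hk r 0 1 x y 0
      have e2 := events_cross_univStrand dir hk' r 1 0 y (!x) 0
      have h1 := (Reduces.two List.nodup_range (atPlace_cross k x y 0 1)
        (atPlace_cap x 0) e1 c1).1
      have h2 := (Reduces.two List.nodup_range (atPlace_cross k.swap y (!x) 1 0)
        (atPlace_cap x 0) e2 c2).2
      have h3 := Reduces.flatMap (P := List.range r) fun p _ =>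
        Reduces.cap_slide hk (⟨x, (0, p)⟩ : Strand (ℕ × ℕ)) ⟨y, (1, p)⟩ (by simp [Strand.flip])
      simpa [cCapSlide₁, cCapSlide₂, events_cmul, twist_of_ne hk, univStrand_flip] using
        h1.trans (h3.trans h2)
  · simp [cCapSlide₁, events_cmul, cup_cap_notMem_events_cross]
  · simp [cCapSlide₂, events_cmul, cup_cap_notMem_events_cross]

theorem tequiv_univ_cupSlide (k : Kind) (x y : Bool) :
    TEquiv (bundles [univStrand r 1 y])
      (bundles [(univStrand r 0 x).turn rot (-twist (dirSign dir) k (univStrand r 1 y)),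
        (univStrand r 1 y).turn rot (twist (dirSign dir) k (univStrand r 0 x)),
        (univStrand r 0 x).flip])
      (mul dir r (cCupSlide₁ k (univStrand r 1 y) (univStrand r 0 x)))
      (mul dir r (cCupSlide₂ rot (dirSign dir) k (univStrand r 1 y) (univStrand r 0 x))) := by
  refine tequiv_mul_of_reduces' (cruns_cCupSlide₁ _ _ _ (by simp [length_univStrand]))
    (cruns_cCupSlide₂ _ _ _ ((length_rot_zpow _ _).trans (length_univStrand _ _ _)))
    (by simp [length_univStrand])
    (by simpa [Strand.turn_flip, univStrand_flip] using nodup_bundles_univStrand r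
          [(0, x, -twist (dirSign dir) k (univStrand r 1 y)),
            (1, y, twist (dirSign dir) k (univStrand r 0 x)), (0, !x, 0)] (by simp)) ?_ ?_ ?_
  · have c1 := events_cup_univStrand dir r 0 x 0
    have c2 := events_cup_univStrand dir r 0 x (-twist (dirSign dir) k (univStrand r 1 y))
    by_cases hk : k = .virt
    · subst hk
      have h1 := (Reduces.of_perm_map List.nodup_range (atPlace_cup x 0) c1).1
      have h2 := (Reduces.of_perm_map List.nodup_range (atPlace_cup x 0) c2).2
      simpa [cCupSlide₁, cCupSlide₂, events_cmul, events_cmulElem_virt] using h1.trans h2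
    · have hk' : k.swap ≠ .virt := by cases k <;> simp [Kind.swap] at hk ⊢
      have e1 := events_cross_univStrand dir hk r 1 0 y x 0
      have e2 := events_cross_univStrand dir hk' r 0 1 (!x) y 0
      have h1 := (Reduces.two List.nodup_range (atPlace_cup x 0) (atPlace_cross k y x 1 0) c1 e1).1
      have h2 := (Reduces.two List.nodup_range (atPlace_cup x 0)
        (atPlace_cross k.swap (!x) y 0 1) c2 e2).2
      have h3 := Reduces.flatMap (P := List.range r) fun p _ =>
        Reduces.cup_slide hk (⟨x, (0, p)⟩ : Strand (ℕ × ℕ)) ⟨y, (1, p)⟩ (by simp [Strand.flip])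
      simpa [cCupSlide₁, cCupSlide₂, events_cmul, twist_of_ne hk, univStrand_flip] using
        h1.trans (h3.trans h2)
  · simp [cCupSlide₁, events_cmul, cup_cap_notMem_events_cross]
  · simp [cCupSlide₂, events_cmul, cup_cap_notMem_events_cross]

theorem tequiv_univ_curlCap (k : Kind) (x : Bool) :
    TEquiv (bundles [univStrand r 0 x, (univStrand r 0 x).flip]) (bundles [])
      (mul dir r (cCurlCap rot (dirSign dir) k (univStrand r 0 x)))
      (mul dir r [⟨0, .cap (univStrand r 0 x)⟩]) := by
  refine tequiv_mul_of_reduces (cruns_cCurlCap _ _) (cruns_cap_cons [] [] rfl rfl (.nil _))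
    (by simp [length_univStrand, Strand.flip])
    (by simpa [univStrand_flip] using nodup_bundles_univStrand r
          [(0, x, 0), (0, !x, 0)] (by simp)) ?_ ?_ ?_
  · have c1 := events_cap_univStrand dir r 0 (!x) (-twist (dirSign dir) k (univStrand r 0 x))
    have c2 := events_cap_univStrand dir r 0 x 0
    have h2 := (Reduces.of_perm_map List.nodup_range (atPlace_cap x 0) c2).2
    by_cases hk : k = .virt
    · subst hk
      have h1 := (Reduces.of_perm_map List.nodup_range (atPlace_cap (!x) 0) c1).1
      have h3 := Reduces.flatMap (P := List.range r) fun p _ =>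
        Reduces.cap_flip (⟨!x, (0, p)⟩ : Strand (ℕ × ℕ))
      simp only [← List.map_eq_flatMap, Strand.flip, Bool.not_not] at h3
      simpa [cCurlCap, events_cmul, events_cmulElem_virt, univStrand_flip] using
        h1.trans (h3.trans h2)
    · have e1 := events_cross_univStrand dir hk r 0 0 x (!x) 0
      have h1 := (Reduces.two List.nodup_range (atPlace_cross k x (!x) 0 0)
        (atPlace_cap (!x) 0) e1 c1).1
      have h3 := Reduces.flatMap (P := List.range r) fun p _ =>
        Reduces.curl_cap hk (⟨x, (0, p)⟩ : Strand (ℕ × ℕ))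
      simp only [← List.map_eq_flatMap, Strand.flip] at h3
      simpa [cCurlCap, events_cmul, twist_of_ne hk, univStrand_flip] using
        h1.trans (h3.trans h2)
  · simp [cCurlCap, events_cmul, cup_cap_notMem_events_cross]
  · simp [events_cmul]

theorem tequiv_univ_curlCup (k : Kind) (x : Bool) :
    TEquiv (bundles []) (bundles
      [((univStrand r 0 x).turn rot (-twist (dirSign dir) k (univStrand r 0 x))).flip,
        (univStrand r 0 x).turn rot (-twist (dirSign dir) k (univStrand r 0 x))])
      (mul dir r (cCurlCup k (univStrand r 0 x)))
      (mul dir r [⟨0, .cup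
        ((univStrand r 0 x).turn rot (-twist (dirSign dir) k (univStrand r 0 x))).flip⟩]) := by
  refine tequiv_mul_of_reduces' (cruns_cCurlCup _ _ (by simp [length_univStrand]))
    (cruns_cup_cons [] [] rfl ((length_rot_zpow _ _).trans (length_univStrand _ _ _))
      (by simpa using CRuns.nil _))
    (by simp)
    (by simpa [univStrand_flip, Strand.turn_flip] using nodup_bundles_univStrand r
          [(0, !x, -twist (dirSign dir) k (univStrand r 0 x)),
            (0, x, -twist (dirSign dir) k (univStrand r 0 x))] (by simp)) ?_ ?_ ?_
  · have c1 := events_cup_univStrand dir r 0 x 0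
    have c2 := events_cup_univStrand dir r 0 (!x) (-twist (dirSign dir) k (univStrand r 0 x))
    have h2 := (Reduces.of_perm_map List.nodup_range (atPlace_cup (!x) 0) c2).2
    by_cases hk : k = .virt
    · subst hk
      have h1 := (Reduces.of_perm_map List.nodup_range (atPlace_cup x 0) c1).1
      have h3 := Reduces.flatMap (P := List.range r) fun p _ =>
        Reduces.cup_flip (⟨x, (0, p)⟩ : Strand (ℕ × ℕ))
      simp only [← List.map_eq_flatMap, Strand.flip] at h3
      simpa [cCurlCup, events_cmul, events_cmulElem_virt, univStrand_flip, Strand.turn_flip] using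
        h1.trans (h3.trans h2)
    · have e1 := events_cross_univStrand dir hk r 0 0 x (!x) 0
      have h1 := (Reduces.two List.nodup_range (atPlace_cup x 0)
        (atPlace_cross k x (!x) 0 0) c1 e1).1
      have h3 := Reduces.flatMap (P := List.range r) fun p _ =>
        Reduces.curl_cup hk (⟨x, (0, p)⟩ : Strand (ℕ × ℕ))
      simp only [← List.map_eq_flatMap, Strand.flip] at h3
      simpa [cCurlCup, events_cmul, twist_of_ne hk, univStrand_flip] using
        h1.trans (h3.trans h2)
  · simp [cCurlCup, events_cmul, cup_cap_notMem_events_cross]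
  · simp [events_cmul]

/-- In the third moves the bundle of the third strand is named with a shift `n`, chosen so that
strands that meet in a real crossing have names with the same second entry.  If the crossings of
the second strand with the first and the third one are virtual, then the first strand has been
shifted before it meets the third one. -/
theorem tequiv_univ_triangle {k₁ k₂ k₃ : Kind} (h : AdmissibleTriple k₁ k₂ k₃) (x y z : Bool)
    (n : ℤ) (hn : k₁ = .virt → k₃ = .virt → n = twist (dirSign dir) .virt (univStrand r 1 y))
    (hn' : ¬ (k₁ = .virt ∧ k₃ = .virt) → n = 0) :
    TEquiv (bundles [univStrand r 0 x, univStrand r 1 y, (univStrand r 2 z).turn rot n])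
      (bundles [((univStrand r 2 z).turn rot n).turn rot
          (-twist (dirSign dir) k₂ (univStrand r 0 x) -
          twist (dirSign dir) k₃ (univStrand r 1 y)),
        (univStrand r 1 y).turn rot (twist (dirSign dir) k₃ (univStrand r 2 z) -
          twist (dirSign dir) k₁ (univStrand r 0 x)),
        (univStrand r 0 x).turn rot (twist (dirSign dir) k₁ (univStrand r 1 y) +
          twist (dirSign dir) k₂ (univStrand r 2 z))])
      (mul dir r (cTriangle₁ rot (dirSign dir) k₁ k₂ k₃ (univStrand r 0 x) (univStrand r 1 y)
        ((univStrand r 2 z).turn rot n)))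
      (mul dir r (cTriangle₂ rot (dirSign dir) k₁ k₂ k₃ (univStrand r 0 x) (univStrand r 1 y)
        ((univStrand r 2 z).turn rot n))) := by
  have h1 := cruns_cTriangle₁ (ρ := rot) (δ := dirSign dir) (Q := fun c => c.length = r) k₁ k₂ k₃
    (univStrand r 0 x) (univStrand r 1 y) ((univStrand r 2 z).turn rot n)
  have h2 := cruns_cTriangle₂ (ρ := rot) (δ := dirSign dir) (Q := fun c => c.length = r) k₁ k₂ k₃
    (univStrand r 0 x) (univStrand r 1 y) ((univStrand r 2 z).turn rot n)
  rw [twist_turn, twist_turn] at h1 h2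
  refine tequiv_mul_of_reduces h1 h2 (by simp [length_univStrand])
    (by simpa using nodup_bundles_univStrand r [(0, x, 0), (1, y, 0), (2, z, n)] (by simp)) ?_ ?_ ?_
  · by_cases hk₁ : k₁ = .virt
    · by_cases hk₃ : k₃ = .virt
      · have hm := hn hk₁ hk₃
        clear hn hn'
        subst hk₁ hk₃ hm
        by_cases hk₂ : k₂ = .virt
        · subst hk₂
          simpa [cTriangle₁, cTriangle₂, events_cmul, events_cmulElem_virt] using Reduces.refl _
        · have e1 := events_cross_univStrand dir hk₂ r 0 2 x z
            (twist (dirSign dir) .virt (univStrand r 1 y))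
          have e2 := events_cross_univStrand dir hk₂ r 0 2 x z 0
          have h1 := (Reduces.of_perm_map List.nodup_range (atPlace_cross k₂ x z 0 2) e1).1
          have h2 := (Reduces.of_perm_map List.nodup_range (atPlace_cross k₂ x z 0 2) e2).2
          simpa [cTriangle₁, cTriangle₂, events_cmul, events_cmulElem_virt, twist_of_ne hk₂]
            using h1.trans h2
      · have hk₂ : k₂ = .virt := by cases k₂ <;> cases k₃ <;> simp_all [AdmissibleTriple]
        have hm := hn' (by simp [hk₃])
        clear hn hn'
        subst hk₁ hk₂ hm
        have e1 := events_cross_univStrand dir hk₃ r 1 2 y z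
            (-twist (dirSign dir) .virt (univStrand r 0 x))
        have e2 := events_cross_univStrand dir hk₃ r 1 2 y z 0
        have h1 := (Reduces.of_perm_map List.nodup_range (atPlace_cross k₃ y z 1 2) e1).1
        have h2 := (Reduces.of_perm_map List.nodup_range (atPlace_cross k₃ y z 1 2) e2).2
        simpa [cTriangle₁, cTriangle₂, events_cmul, events_cmulElem_virt, twist_of_ne hk₃]
            using h1.trans h2
    · have hm := hn' (by simp [hk₁])
      clear hn hn'
      subst hm
      by_cases hk₂ : k₂ = .virt
      · have hk₃ : k₃ = .virt := by cases k₁ <;> cases k₃ <;> simp_all [AdmissibleTriple]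
        subst hk₂ hk₃
        have e1 := events_cross_univStrand dir hk₁ r 0 1 x y 0
        have e2 := events_cross_univStrand dir hk₁ r 0 1 x y
          (twist (dirSign dir) .virt (univStrand r 2 z))
        have h1 := (Reduces.of_perm_map List.nodup_range (atPlace_cross k₁ x y 0 1) e1).1
        have h2 := (Reduces.of_perm_map List.nodup_range (atPlace_cross k₁ x y 0 1) e2).2
        simpa [cTriangle₁, cTriangle₂, events_cmul, events_cmulElem_virt, twist_of_ne hk₁]
            using h1.trans h2
      · have hk₃ : k₃ ≠ .virt := by
          cases k₁ <;> cases k₂ <;> cases k₃ <;> simp_all [AdmissibleTriple]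
        have e1 := events_cross_univStrand dir hk₁ r 0 1 x y 0
        have e2 := events_cross_univStrand dir hk₂ r 0 2 x z 0
        have e3 := events_cross_univStrand dir hk₃ r 1 2 y z 0
        have a1 := atPlace_cross k₁ x y 0 1
        have a2 := atPlace_cross k₂ x z 0 2
        have a3 := atPlace_cross k₃ y z 1 2
        have h1 := (Reduces.three List.nodup_range a1 a2 a3 e1 e2 e3).1
        have h2 := (Reduces.three List.nodup_range a3 a2 a1 e3 e2 e1).2
        have h3 := Reduces.flatMap (P := List.range r) fun p _ =>
          Reduces.triangle h hk₁ hk₂ hk₃ (⟨x, (0, p)⟩ : Strand (ℕ × ℕ)) ⟨y, (1, p)⟩ ⟨z, (2, p)⟩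
        simpa [cTriangle₁, cTriangle₂, events_cmul, twist_of_ne hk₁, twist_of_ne hk₂,
          twist_of_ne hk₃] using h1.trans (h3.trans h2)
  · simp [cTriangle₁, events_cmul, cup_cap_notMem_events_cross]
  · simp [cTriangle₂, events_cmul, cup_cap_notMem_events_cross]

end Univ

/-! ### Moves of arbitrary bundles -/

section Core

variable [Nonempty X] (dir : Bool) {r : ℕ} (k : Kind) {a b c x : Strand (List X)}

/-- Every instance of a local move is obtained by renaming from one where all strands have different
names. -/
theorem tequiv_mul_bigon (ha : a.comp.length = r) (hb : b.comp.length = r) :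
    TEquiv (bundles [a, b]) (bundles [a, b]) (mul dir r (cBigon rot (dirSign dir) k a b))
      (mul dir r []) := by
  obtain ⟨f, h₁, h₂, -⟩ := exists_relabel_univStrand a b b ha hb hb
  generalize a.up = x at h₁
  generalize b.up = y at h₂
  have h := (tequiv_univ_bigon dir r k x y).relabel f
  rw [← mul_relabel, ← mul_relabel, ← bundles_relabel] at h
  simpa [cBigon, Elem.relabel, ← h₁, ← h₂, ← twist_relabel _ _ (List.map f)] using h

theorem tequiv_mul_capSlide (ha : a.comp.length = r) (hx : x.comp.length = r) :
    TEquiv (bundles [x, a, (x.turn rot (twist (dirSign dir) k a)).flip])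
      (bundles [a.turn rot (-twist (dirSign dir) k x)])
      (mul dir r (cCapSlide₁ rot (dirSign dir) k a x))
      (mul dir r (cCapSlide₂ rot (dirSign dir) k a x)) := by
  obtain ⟨f, h₁, h₂, -⟩ := exists_relabel_univStrand x a a hx ha ha
  generalize x.up = x' at h₁
  generalize a.up = y at h₂
  have h := (tequiv_univ_capSlide dir r k x' y).relabel f
  rw [← mul_relabel, ← mul_relabel, ← bundles_relabel, ← bundles_relabel] at h
  simpa [cCapSlide₁, cCapSlide₂, Elem.relabel, ← h₁, ← h₂, ← twist_relabel _ _ (List.map f)]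
    using h

theorem tequiv_mul_cupSlide (ha : a.comp.length = r) (hx : x.comp.length = r) :
    TEquiv (bundles [a]) (bundles [x.turn rot (-twist (dirSign dir) k a),
        a.turn rot (twist (dirSign dir) k x), x.flip])
      (mul dir r (cCupSlide₁ k a x)) (mul dir r (cCupSlide₂ rot (dirSign dir) k a x)) := by
  obtain ⟨f, h₁, h₂, -⟩ := exists_relabel_univStrand x a a hx ha ha
  generalize x.up = x' at h₁
  generalize a.up = y at h₂
  have h := (tequiv_univ_cupSlide dir r k x' y).relabel f
  rw [← mul_relabel, ← mul_relabel, ← bundles_relabel, ← bundles_relabel] at h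
  simpa [cCupSlide₁, cCupSlide₂, Elem.relabel, ← h₁, ← h₂, ← twist_relabel _ _ (List.map f)]
    using h

theorem tequiv_mul_curlCap (hx : x.comp.length = r) :
    TEquiv (bundles [x, x.flip]) (bundles []) (mul dir r (cCurlCap rot (dirSign dir) k x))
      (mul dir r [⟨0, .cap x⟩]) := by
  obtain ⟨f, h₁, -, -⟩ := exists_relabel_univStrand x x x hx hx hx
  generalize x.up = x' at h₁
  have h := (tequiv_univ_curlCap dir r k x').relabel f
  rw [← mul_relabel, ← mul_relabel, ← bundles_relabel, ← bundles_relabel] at h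
  simpa [cCurlCap, Elem.relabel, ← h₁, ← twist_relabel _ _ (List.map f)] using h

theorem tequiv_mul_curlCup (hx : x.comp.length = r) :
    TEquiv (bundles []) (bundles [(x.turn rot (-twist (dirSign dir) k x)).flip,
        x.turn rot (-twist (dirSign dir) k x)])
      (mul dir r (cCurlCup k x))
      (mul dir r [⟨0, .cup (x.turn rot (-twist (dirSign dir) k x)).flip⟩]) := by
  obtain ⟨f, h₁, -, -⟩ := exists_relabel_univStrand x x x hx hx hx
  generalize x.up = x' at h₁
  have h := (tequiv_univ_curlCup dir r k x').relabel f
  rw [← mul_relabel, ← mul_relabel, ← bundles_relabel, ← bundles_relabel] at h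
  simpa [cCurlCup, Elem.relabel, ← h₁, ← twist_relabel _ _ (List.map f)] using h

theorem tequiv_mul_triangle {k₁ k₂ k₃ : Kind} (h : AdmissibleTriple k₁ k₂ k₃)
    (ha : a.comp.length = r) (hb : b.comp.length = r) (hc : c.comp.length = r) :
    TEquiv (bundles [a, b, c])
      (bundles [c.turn rot (-twist (dirSign dir) k₂ a - twist (dirSign dir) k₃ b),
        b.turn rot (twist (dirSign dir) k₃ c - twist (dirSign dir) k₁ a),
        a.turn rot (twist (dirSign dir) k₁ b + twist (dirSign dir) k₂ c)])
      (mul dir r (cTriangle₁ rot (dirSign dir) k₁ k₂ k₃ a b c))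
      (mul dir r (cTriangle₂ rot (dirSign dir) k₁ k₂ k₃ a b c)) := by
  obtain ⟨n, hn, hn'⟩ : ∃ n : ℤ,
      (k₁ = .virt → k₃ = .virt → n = twist (dirSign dir) .virt (univStrand r 1 b.up)) ∧
      (¬ (k₁ = .virt ∧ k₃ = .virt) → n = 0) := by
    by_cases hk : k₁ = .virt ∧ k₃ = .virt
    · exact ⟨_, fun _ _ => rfl, fun h => absurd hk h⟩
    · exact ⟨0, fun h h' => absurd ⟨h, h'⟩ hk, fun _ => rfl⟩
  obtain ⟨f, h₁, h₂, h₃⟩ := exists_relabel_univStrand a b (c.turn rot (-n)) ha hb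
    ((length_rot_zpow _ _).trans hc)
  have h₃ : c = ((univStrand r 2 c.up).relabel (List.map f)).turn rot n := by
    rw [← c.turn_up rot (-n), ← h₃]; simp
  generalize a.up = x at h₁
  generalize b.up = y at *
  generalize c.up = z at h₃
  have h := (tequiv_univ_triangle dir r h x y z n hn hn').relabel f
  rw [← mul_relabel, ← mul_relabel, ← bundles_relabel, ← bundles_relabel] at h
  have hz : ∀ k, twist (dirSign dir) k (univStrand r 2 z) = twist (dirSign dir) k c := fun k => by
    rw [h₃]; simp
  simp only [hz] at h
  have hz' : ((univStrand r 2 z).turn rot n).relabel (List.map f) = c := by simp [← h₃]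
  simpa [cTriangle₁, cTriangle₂, Elem.relabel, ← h₁, ← h₂, ← h₃, hz,
    ← twist_relabel _ _ (List.map f), -Strand.turn_turn] using h

end Core

theorem TEquiv.mul_frame {dir : Bool} {r : ℕ} {s t : List (Strand (List X))}
    {w w' : Word (List X)} (h : TEquiv (bundles s) (bundles t) (mul dir r w) (mul dir r w'))
    (u v : List (Strand (List X))) (hu : ∀ x ∈ u, x.comp.length = r) :
    TEquiv (bundles (u ++ s ++ v)) (bundles (u ++ t ++ v)) (mul dir r (shift u.length w))
      (mul dir r (shift u.length w')) := by
  have := h.frame (bundles u) (bundles v)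
  rw [length_bundles hu] at this
  simpa [mul_shift] using this

/-! ### Colours and local moves -/

theorem relabel_eq_nil {f : X → Y} {w : Word X} : Word.relabel f w = [] ↔ w = [] := by
  simp [Word.relabel]

theorem relabel_eq_cons {f : X → Y} {w : Word X} {i : ℕ} {e : Elem Y} {w' : Word Y} :
    Word.relabel f w = ⟨i, e⟩ :: w' ↔
      ∃ e' w'', w = ⟨i, e'⟩ :: w'' ∧ e'.relabel f = e ∧ Word.relabel f w'' = w' := by
  cases w with
  | nil => simp
  | cons l w =>
    obtain ⟨j, e'⟩ := l
    simp only [relabel_cons, List.cons.injEq, Letter.mk.injEq]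
    constructor
    · rintro ⟨⟨rfl, rfl⟩, rfl⟩; exact ⟨_, _, ⟨⟨rfl, rfl⟩, rfl⟩, rfl, rfl⟩
    · rintro ⟨_, _, ⟨⟨rfl, rfl⟩, rfl⟩, rfl, rfl⟩; exact ⟨⟨rfl, rfl⟩, rfl⟩

theorem Elem.relabel_eq_cross {f : X → Y} {e : Elem X} {k : Kind} {a b : Strand Y} :
    e.relabel f = .cross k a b ↔
      ∃ a' b', e = .cross k a' b' ∧ a'.relabel f = a ∧ b'.relabel f = b := by
  cases e <;> simp [Elem.relabel, and_assoc]

theorem Elem.relabel_eq_cup {f : X → Y} {e : Elem X} {a : Strand Y} :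
    e.relabel f = .cup a ↔ ∃ a', e = .cup a' ∧ a'.relabel f = a := by
  cases e <;> simp [Elem.relabel]

theorem Elem.relabel_eq_cap {f : X → Y} {e : Elem X} {a : Strand Y} :
    e.relabel f = .cap a ↔ ∃ a', e = .cap a' ∧ a'.relabel f = a := by
  cases e <;> simp [Elem.relabel]

section

variable {ρ : Equiv.Perm C} {δ : ℤ} {Q : C → Prop} {s t l u : List (Strand C)} {w : Word C}
  {i : ℕ}

theorem CRuns.inv {e : Elem C} (h : CRuns ρ δ Q s (⟨i, e⟩ :: w) t) (hs : s = u ++ l)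
    (hi : i = u.length) : ∃ v, l = e.src ++ v ∧ (∀ s, e = .cup s → Q s.comp) ∧
      CRuns ρ δ Q (u ++ e.ctgt ρ δ ++ v) w t := by
  obtain ⟨u', v, h1, h2, h3, h4⟩ := cruns_cons_iff.1 h
  rw [hs, List.append_assoc] at h1
  obtain ⟨rfl, rfl⟩ := List.append_inj h1 (hi.symm.trans h2)
  exact ⟨v, rfl, h3, h4⟩

theorem CRuns.inv_cross {k : Kind} {a b : Strand C} (h : CRuns ρ δ Q s (⟨i, .cross k a b⟩ :: w) t)
    (hs : s = u ++ l) (hi : i = u.length) : ∃ v, l = a :: b :: v ∧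
      CRuns ρ δ Q (u ++ b.turn ρ (-twist δ k a) :: a.turn ρ (twist δ k b) :: v) w t := by
  obtain ⟨v, h1, -, h2⟩ := h.inv hs hi
  exact ⟨v, h1, by simpa [Elem.ctgt] using h2⟩

theorem CRuns.inv_cap {a : Strand C} (h : CRuns ρ δ Q s (⟨i, .cap a⟩ :: w) t)
    (hs : s = u ++ l) (hi : i = u.length) : ∃ v, l = a :: a.flip :: v ∧
      CRuns ρ δ Q (u ++ v) w t := by
  obtain ⟨v, h1, -, h2⟩ := h.inv hs hi
  exact ⟨v, h1, by simpa [Elem.ctgt, Elem.tgt] using h2⟩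

theorem CRuns.inv_cup {a : Strand C} (h : CRuns ρ δ Q s (⟨i, .cup a⟩ :: w) t)
    (hs : s = u ++ l) (hi : i = u.length) : Q a.comp ∧
      CRuns ρ δ Q (u ++ a :: a.flip :: l) w t := by
  obtain ⟨v, rfl, h1, h2⟩ := h.inv hs hi
  exact ⟨h1 a rfl, by simpa [Elem.ctgt, Elem.tgt, Elem.src] using h2⟩

theorem CRuns.split {e : Elem C} (h : CRuns ρ δ Q s (⟨i, e⟩ :: w) t) :
    ∃ u l, s = u ++ l ∧ i = u.length := by
  obtain ⟨u', v, h1, h2, h3, h4⟩ := cruns_cons_iff.1 h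
  exact ⟨u', e.src ++ v, by simp [h1], h2⟩

end

theorem exists_eq_concat {l : List ι} {n : ℕ} (h : n + 1 = l.length) :
    ∃ u z, l = u ++ [z] ∧ n = u.length := by
  rcases List.eq_nil_or_concat' l with rfl | ⟨u, z, rfl⟩
  · simp at h
  · exact ⟨u, z, rfl, by simpa using h⟩

/-- A property of lists of length `r` that does not change under cyclic permutations. -/
def RotClosed (r : ℕ) (Q : List X → Prop) : Prop :=
  (∀ c, Q c → c.length = r) ∧ ∀ c (n : ℤ), Q ((rot ^ n) c) ↔ Q c

/-- The coloured diagram `w` has a counterpart over the diagram `a` without colours, with the same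
coloured ends and an equivalent multiplexing. -/
def Lifted (dir : Bool) (r : ℕ) (Q : List X → Prop) (s t : List (Strand (List X)))
    (w : Word (List X)) (a : Word (Fin 1)) : Prop :=
  ∃ w', Word.relabel (fun _ => (0 : Fin 1)) w' = a ∧ CRuns rot (dirSign dir) Q s w' t ∧
    TEquiv (bundles s) (bundles t) (mul dir r w) (mul dir r w')

theorem Lifted.of_core {dir : Bool} {r : ℕ} {Q : List X → Prop} (hQ : RotClosed r Q)
    {s t s' t' u v : List (Strand (List X))}
    {c c' w : Word (List X)} {a : Word (Fin 1)} (hl : ∀ x ∈ u, Q x.comp)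
    (hc : CRuns rot (dirSign dir) Q s c' t)
    (h : TEquiv (bundles s) (bundles t) (mul dir r c) (mul dir r c'))
    (hs : s' = u ++ s ++ v) (ht : t' = u ++ t ++ v) (hw : w = shift u.length c)
    (ha : a = Word.relabel (fun _ => (0 : Fin 1)) (shift u.length c')) :
    Lifted dir r Q s' t' w a := by
  subst hs ht hw ha
  exact ⟨_, rfl, CRuns.frame hc u v, h.mul_frame u v fun x hx => hQ.1 _ (hl x hx)⟩

/-- Every colouring of `a` with colours in `Q` has a counterpart over `a'`,
provided that the strands on the bottom and on the top fit. -/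
def Lifts (dir : Bool) (r : ℕ) (Q : List X → Prop) (a a' : Word (Fin 1)) : Prop :=
  ∀ (s t : List (Strand (List X))) (w : Word (List X)), (∀ x ∈ s, Q x.comp) →
    CRuns rot (dirSign dir) Q s w t → Word.relabel (fun _ => (0 : Fin 1)) w = a →
    Runs (s.map (Strand.relabel fun _ => (0 : Fin 1))) a'
      (t.map (Strand.relabel fun _ => (0 : Fin 1))) → Lifted dir r Q s t w a'

section Moves

variable [Nonempty X] (dir : Bool) {r : ℕ} {Q : List X → Prop} (i : ℕ)
  (k k₁ k₂ k₃ : Kind) (a b c x : Strand (Fin 1))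

theorem lifts_bigon (hQ : RotClosed r Q) :
    Lifts dir r Q [⟨i, .cross k a b⟩, ⟨i, .cross k.swap b a⟩] [] := by
  rintro s t w hs h hw -
  simp only [relabel_eq_cons, Elem.relabel_eq_cross, relabel_eq_nil] at hw
  obtain ⟨_, _, rfl, ⟨a, b, rfl, rfl, rfl⟩, _, _, rfl, ⟨b', a', rfl, -, -⟩, rfl⟩ := hw
  obtain ⟨u, l, rfl, hi⟩ := h.split
  obtain ⟨v, rfl, g1⟩ := h.inv_cross rfl hi
  obtain ⟨v', h1, g2⟩ := g1.inv_cross rfl hi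
  simp only [List.cons.injEq] at h1
  obtain ⟨rfl, rfl, rfl⟩ := h1
  obtain rfl := cruns_nil_iff.1 g2
  exact .of_core hQ (u := u) (v := v) (fun x hx => hs x (by simp [hx])) (.nil _)
    (tequiv_mul_bigon dir k (a := a) (b := b) (hQ.1 _ (hs a (by simp))) (hQ.1 _ (hs b (by simp))))
        (by simp)
    (by simp) (by simp [cBigon, hi]) (by simp)

theorem lifts_bigon' (hQ : RotClosed r Q) :
    Lifts dir r Q [] [⟨i, .cross k a b⟩, ⟨i, .cross k.swap b a⟩] := by
  rintro s t w hs h hw hr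
  obtain rfl := relabel_eq_nil.1 hw
  obtain rfl := cruns_nil_iff.1 h
  obtain ⟨u, v, h1, hi, -⟩ := runs_cons_iff.1 hr
  simp only [Elem.src] at h1 hi
  obtain ⟨s', v, rfl, h2, rfl⟩ := List.map_eq_append_iff.1 h1
  obtain ⟨u, m, rfl, rfl, h3⟩ := List.map_eq_append_iff.1 h2
  simp only [List.map_eq_cons_iff, List.map_eq_nil_iff] at h3
  obtain ⟨a, _, rfl, rfl, b, _, rfl, rfl, rfl⟩ := h3
  exact .of_core hQ (u := u) (v := v) (fun x hx => hs x (by simp [hx])) (cruns_cBigon k a b)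
    (tequiv_mul_bigon dir k (a := a) (b := b) (hQ.1 _ (hs a (by simp)))
        (hQ.1 _ (hs b (by simp)))).symm (by simp)
    (by simp) (by simp) (by simp [cBigon, Elem.relabel, hi, Strand.turn, Strand.relabel])

theorem lifts_triangle (hQ : RotClosed r Q) (h₀ : AdmissibleTriple k₁ k₂ k₃) :
    Lifts dir r Q [⟨i, .cross k₁ a b⟩, ⟨i + 1, .cross k₂ a c⟩, ⟨i, .cross k₃ b c⟩]
        [⟨i + 1, .cross k₃ b c⟩, ⟨i, .cross k₂ a c⟩, ⟨i + 1, .cross k₁ a b⟩] := by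
  rintro s t w hs h hw -
  simp only [relabel_eq_cons, Elem.relabel_eq_cross, relabel_eq_nil] at hw
  obtain ⟨_, _, rfl, ⟨a, b, rfl, rfl, rfl⟩, _, _, rfl, ⟨a', c, rfl, -, rfl⟩,
    _, _, rfl, ⟨b', c', rfl, -, -⟩, rfl⟩ := hw
  obtain ⟨u, l, rfl, hi⟩ := h.split
  obtain ⟨v, rfl, g1⟩ := h.inv_cross rfl hi
  obtain ⟨v', h1, g2⟩ := g1.inv_cross (u := u ++ [_]) (List.append_cons ..) (by simp [hi])
  simp only [List.cons.injEq] at h1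
  obtain ⟨rfl, rfl⟩ := h1
  obtain ⟨v, h1, g3⟩ := g2.inv_cross (u := u) (List.append_assoc ..) hi
  simp only [List.cons.injEq, List.cons_append, List.nil_append] at h1
  obtain ⟨rfl, rfl, rfl⟩ := h1
  obtain rfl := cruns_nil_iff.1 g3
  exact .of_core hQ (u := u) (v := v') (fun x hx => hs x (by simp [hx]))
      (cruns_cTriangle₂ k₁ k₂ k₃ a b c)
    (tequiv_mul_triangle dir h₀ (hQ.1 _ (hs a (by simp))) (hQ.1 _ (hs b (by simp)))
        (hQ.1 _ (hs c (by simp)))) (by simp)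
    (by simp [sub_eq_add_neg, add_comm]) (by simp [cTriangle₁, hi])
    (by simp [cTriangle₂, Elem.relabel, hi, Strand.turn, Strand.relabel])

theorem lifts_triangle' (hQ : RotClosed r Q) (h₀ : AdmissibleTriple k₁ k₂ k₃) :
    Lifts dir r Q [⟨i + 1, .cross k₃ b c⟩, ⟨i, .cross k₂ a c⟩, ⟨i + 1, .cross k₁ a b⟩]
      [⟨i, .cross k₁ a b⟩, ⟨i + 1, .cross k₂ a c⟩, ⟨i, .cross k₃ b c⟩] := by
  rintro s t w hs h hw -
  simp only [relabel_eq_cons, Elem.relabel_eq_cross, relabel_eq_nil] at hw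
  obtain ⟨_, _, rfl, ⟨b, c, rfl, rfl, rfl⟩, _, _, rfl, ⟨a, c', rfl, rfl, -⟩,
    _, _, rfl, ⟨a', b', rfl, -, -⟩, rfl⟩ := hw
  obtain ⟨u, l, rfl, hi⟩ := h.split
  obtain ⟨u, z, rfl, hj⟩ := exists_eq_concat hi
  obtain ⟨v, rfl, g1⟩ := h.inv_cross rfl (by simp [hj])
  obtain ⟨v', h1, g2⟩ := g1.inv_cross (u := u) (List.append_assoc ..) hj
  simp only [List.cons.injEq, List.cons_append, List.nil_append] at h1
  obtain ⟨rfl, rfl, rfl⟩ := h1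
  obtain ⟨v', h1, g3⟩ := g2.inv_cross (u := u ++ [_]) (List.append_cons ..) (by simp [hj])
  simp only [List.cons.injEq] at h1
  obtain ⟨rfl, rfl, rfl⟩ := h1
  obtain rfl := cruns_nil_iff.1 g3
  exact .of_core hQ (u := u) (v := v) (fun x hx => hs x (by simp [hx]))
      (cruns_cTriangle₁ k₁ k₂ k₃ z b c)
    (tequiv_mul_triangle dir h₀ (hQ.1 _ (hs z (by simp))) (hQ.1 _ (hs b (by simp)))
        (hQ.1 _ (hs c (by simp)))).symm (by simp)
    (by simp [sub_eq_add_neg, add_comm]) (by simp [cTriangle₂, hj])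
    (by simp [cTriangle₁, Elem.relabel, hj, Strand.turn, Strand.relabel])

theorem lifts_capSlide (hQ : RotClosed r Q) : Lifts dir r Q [⟨i, .cross k x a⟩, ⟨i + 1, .cap x⟩]
    [⟨i + 1, .cross k.swap a x.flip⟩, ⟨i, .cap x⟩] := by
  rintro s t w hs h hw -
  simp only [relabel_eq_cons, Elem.relabel_eq_cross, Elem.relabel_eq_cap, relabel_eq_nil] at hw
  obtain ⟨_, _, rfl, ⟨x, a, rfl, rfl, rfl⟩, _, _, rfl, ⟨x', rfl, -⟩, rfl⟩ := hw
  obtain ⟨u, l, rfl, hi⟩ := h.split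
  obtain ⟨v, rfl, g1⟩ := h.inv_cross rfl hi
  obtain ⟨v', h1, g2⟩ := g1.inv_cap (u := u ++ [_]) (List.append_cons ..) (by simp [hi])
  simp only [List.cons.injEq] at h1
  obtain ⟨rfl, rfl⟩ := h1
  obtain rfl := cruns_nil_iff.1 g2
  exact .of_core hQ (u := u) (v := v') (fun x hx => hs x (by simp [hx])) (cruns_cCapSlide₂ k a x)
    (tequiv_mul_capSlide dir k (hQ.1 _ (hs a (by simp))) (hQ.1 _ (hs x (by simp)))) (by simp)
    (by simp) (by simp [cCapSlide₁, hi])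
    (by simp [cCapSlide₂, Elem.relabel, hi, Strand.turn, Strand.relabel, Strand.flip])

theorem lifts_capSlide' (hQ : RotClosed r Q) :
    Lifts dir r Q [⟨i + 1, .cross k.swap a x.flip⟩, ⟨i, .cap x⟩]
    [⟨i, .cross k x a⟩, ⟨i + 1, .cap x⟩] := by
  rintro s t w hs h hw -
  simp only [relabel_eq_cons, Elem.relabel_eq_cross, Elem.relabel_eq_cap, relabel_eq_nil] at hw
  obtain ⟨_, _, rfl, ⟨a, x', rfl, rfl, hx⟩, _, _, rfl, ⟨x, rfl, rfl⟩, rfl⟩ := hw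
  obtain ⟨u, l, rfl, hi⟩ := h.split
  obtain ⟨u, z, rfl, hj⟩ := exists_eq_concat hi
  obtain ⟨v, rfl, g1⟩ := h.inv_cross rfl (by simp [hj])
  obtain ⟨v', h1, g2⟩ := g1.inv_cap (u := u) (List.append_assoc ..) hj
  simp only [List.cons.injEq, List.cons_append, List.nil_append] at h1
  obtain ⟨rfl, h1, rfl⟩ := h1
  obtain rfl := cruns_nil_iff.1 g2
  obtain rfl : x' = (z.turn rot (twist (dirSign dir) k a)).flip := by
    rw [Strand.turn_flip, ← h1]; simp
  exact .of_core hQ (u := u) (v := v) (fun x hx => hs x (by simp [hx])) (cruns_cCapSlide₁ k a z)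
    (tequiv_mul_capSlide dir k (hQ.1 _ (hs a (by simp))) (hQ.1 _ (hs z (by simp)))).symm (by simp)
    (by simp) (by simp [cCapSlide₂, hj])
    (by simp [cCapSlide₁, Elem.relabel, hj, Strand.turn, Strand.relabel])

theorem lifts_cupSlide (hQ : RotClosed r Q) : Lifts dir r Q [⟨i + 1, .cup x⟩, ⟨i, .cross k a x⟩]
    [⟨i, .cup x⟩, ⟨i + 1, .cross k.swap x.flip a⟩] := by
  rintro s t w hs h hw -
  simp only [relabel_eq_cons, Elem.relabel_eq_cross, Elem.relabel_eq_cup, relabel_eq_nil] at hw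
  obtain ⟨_, _, rfl, ⟨x, rfl, rfl⟩, _, _, rfl, ⟨a, x', rfl, rfl, -⟩, rfl⟩ := hw
  obtain ⟨u, l, rfl, hi⟩ := h.split
  obtain ⟨u, z, rfl, hj⟩ := exists_eq_concat hi
  obtain ⟨hq, g1⟩ := h.inv_cup rfl (by simp [hj])
  obtain ⟨v', h1, g2⟩ := g1.inv_cross (u := u) (List.append_assoc ..) hj
  simp only [List.cons.injEq, List.cons_append, List.nil_append] at h1
  obtain ⟨rfl, rfl, rfl⟩ := h1
  obtain rfl := cruns_nil_iff.1 g2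
  exact .of_core hQ (u := u) (v := l) (fun x hx => hs x (by simp [hx]))
    (cruns_cCupSlide₂ k z x ((hQ.2 _ _).2 hq))
    (tequiv_mul_cupSlide dir k (hQ.1 _ (hs z (by simp))) (hQ.1 _ hq)) (by simp)
    (by simp) (by simp [cCupSlide₁, hj])
    (by simp [cCupSlide₂, Elem.relabel, hj, Strand.turn, Strand.relabel, Strand.flip])

theorem lifts_cupSlide' (hQ : RotClosed r Q) :
    Lifts dir r Q [⟨i, .cup x⟩, ⟨i + 1, .cross k.swap x.flip a⟩]
    [⟨i + 1, .cup x⟩, ⟨i, .cross k a x⟩] := by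
  rintro s t w hs h hw -
  simp only [relabel_eq_cons, Elem.relabel_eq_cross, Elem.relabel_eq_cup, relabel_eq_nil] at hw
  obtain ⟨_, _, rfl, ⟨z, rfl, rfl⟩, _, _, rfl, ⟨x', a, rfl, -, rfl⟩, rfl⟩ := hw
  obtain ⟨u, l, rfl, hi⟩ := h.split
  obtain ⟨hq, g1⟩ := h.inv_cup rfl hi
  obtain ⟨v', h1, g2⟩ := g1.inv_cross (u := u ++ [_]) (List.append_cons ..) (by simp [hi])
  simp only [List.cons.injEq] at h1
  obtain ⟨rfl, rfl⟩ := h1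
  obtain rfl := cruns_nil_iff.1 g2
  obtain ⟨x, rfl⟩ : ∃ x : Strand (List X), z = x.turn rot (-twist (dirSign dir) k a) :=
    ⟨z.turn rot (twist (dirSign dir) k a), by simp⟩
  have hx : Q x.comp := (hQ.2 _ _).1 hq
  exact .of_core hQ (u := u) (v := v') (fun x hx => hs x (by simp [hx]))
    (cruns_cCupSlide₁ k a x hx)
    (tequiv_mul_cupSlide dir k (hQ.1 _ (hs a (by simp))) (hQ.1 _ hx)).symm (by simp)
    (by simp [Strand.turn_flip]) (by simp [cCupSlide₂, hi])
    (by simp [cCupSlide₁, Elem.relabel, hi, Strand.turn, Strand.relabel])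

theorem lifts_curl₁ (hQ : RotClosed r Q) :
    Lifts dir r Q [⟨i, .cross k x x.flip⟩, ⟨i, .cap x.flip⟩] [⟨i, .cap x⟩] := by
  rintro s t w hs h hw -
  simp only [relabel_eq_cons, Elem.relabel_eq_cross, Elem.relabel_eq_cap, relabel_eq_nil] at hw
  obtain ⟨_, _, rfl, ⟨x, y, rfl, rfl, hy⟩, _, _, rfl, ⟨x', rfl, -⟩, rfl⟩ := hw
  obtain ⟨u, l, rfl, hi⟩ := h.split
  obtain ⟨v, rfl, g1⟩ := h.inv_cross rfl hi
  obtain ⟨v', h1, g2⟩ := g1.inv_cap rfl hi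
  simp only [List.cons.injEq] at h1
  obtain ⟨rfl, h1, rfl⟩ := h1
  obtain rfl := cruns_nil_iff.1 g2
  have hy' : twist (dirSign dir) k y = -twist (dirSign dir) k x := by
    rw [← twist_relabel _ _ (fun _ => (0 : Fin 1)), hy]; simp
  obtain rfl : y = x.flip := by
    rw [hy', Strand.turn_flip] at h1
    have := congrArg (Strand.turn rot (twist (dirSign dir) k x)) h1
    simpa using (congrArg Strand.flip this).symm
  exact .of_core hQ (u := u) (v := v) (fun x hx => hs x (by simp [hx]))
    (cruns_cap_cons [] [] rfl rfl (.nil _))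
    (tequiv_mul_curlCap dir k (hQ.1 _ (hs x (by simp)))) (by simp)
    (by simp) (by simp [cCurlCap, hi]) (by simp [Elem.relabel, hi])

theorem lifts_curl₁' (hQ : RotClosed r Q) :
    Lifts dir r Q [⟨i, .cap x⟩] [⟨i, .cross k x x.flip⟩, ⟨i, .cap x.flip⟩] := by
  rintro s t w hs h hw -
  simp only [relabel_eq_cons, Elem.relabel_eq_cap, relabel_eq_nil] at hw
  obtain ⟨_, _, rfl, ⟨x, rfl, rfl⟩, rfl⟩ := hw
  obtain ⟨u, l, rfl, hi⟩ := h.split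
  obtain ⟨v, rfl, g1⟩ := h.inv_cap rfl hi
  obtain rfl := cruns_nil_iff.1 g1
  exact .of_core hQ (u := u) (v := v) (fun x hx => hs x (by simp [hx]))
    (cruns_cCurlCap k x)
    (tequiv_mul_curlCap dir k (hQ.1 _ (hs x (by simp)))).symm (by simp)
    (by simp) (by simp [hi])
    (by simp [cCurlCap, Elem.relabel, hi, Strand.turn, Strand.relabel, Strand.flip])

theorem lifts_curl₂ (hQ : RotClosed r Q) :
    Lifts dir r Q [⟨i, .cup x⟩, ⟨i, .cross k x x.flip⟩] [⟨i, .cup x.flip⟩] := by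
  rintro s t w hs h hw -
  simp only [relabel_eq_cons, Elem.relabel_eq_cross, Elem.relabel_eq_cup, relabel_eq_nil] at hw
  obtain ⟨_, _, rfl, ⟨x, rfl, rfl⟩, _, _, rfl, ⟨y, z, rfl, -⟩, rfl⟩ := hw
  obtain ⟨u, l, rfl, hi⟩ := h.split
  obtain ⟨hq, g1⟩ := h.inv_cup rfl hi
  obtain ⟨v', h1, g2⟩ := g1.inv_cross rfl hi
  simp only [List.cons.injEq] at h1
  obtain ⟨rfl, rfl, rfl⟩ := h1
  obtain rfl := cruns_nil_iff.1 g2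
  exact .of_core hQ (u := u) (v := l) (fun x hx => hs x (by simp [hx]))
    (cruns_cup_cons [] [] rfl ((hQ.2 _ _).2 hq) (by simpa using CRuns.nil _))
    (tequiv_mul_curlCup dir k (hQ.1 _ hq)) (by simp)
    (by simp [Strand.turn_flip]) (by simp [cCurlCup, hi])
    (by simp [Elem.relabel, hi, Strand.turn, Strand.relabel, Strand.flip])

theorem lifts_curl₂' (hQ : RotClosed r Q) :
    Lifts dir r Q [⟨i, .cup x.flip⟩] [⟨i, .cup x⟩, ⟨i, .cross k x x.flip⟩] := by
  rintro s t w hs h hw -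
  simp only [relabel_eq_cons, Elem.relabel_eq_cup, relabel_eq_nil] at hw
  obtain ⟨_, _, rfl, ⟨z, rfl, hz⟩, rfl⟩ := hw
  obtain ⟨u, l, rfl, hi⟩ := h.split
  obtain ⟨hq, g1⟩ := h.inv_cup rfl hi
  obtain rfl := cruns_nil_iff.1 g1
  obtain ⟨y, rfl⟩ : ∃ y : Strand (List X), z = (y.turn rot (-twist (dirSign dir) k y)).flip :=
    ⟨z.flip.turn rot (twist (dirSign dir) k z.flip), by simp⟩
  obtain rfl : Strand.relabel (fun _ => (0 : Fin 1)) y = x := by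
    rw [Strand.relabel_flip] at hz
    exact (Strand.flip_injective hz)
  have hx : Q y.comp := (hQ.2 _ _).1 hq
  exact .of_core hQ (u := u) (v := l) (fun x hx => hs x (by simp [hx]))
    (cruns_cCurlCup k y hx)
    (tequiv_mul_curlCup dir k (hQ.1 _ hx)).symm (by simp)
    (by simp) (by simp [hi])
    (by simp [cCurlCup, Elem.relabel, hi])

end Moves

/-! ### Parallel zigzags and exchanges -/

theorem cupWord_concat (A : List (Strand X)) (a : Strand X) :
    cupWord (A ++ [a]) = cupWord A ++ [⟨A.length, .cup a⟩] := by
  simp [cupWord, List.zipIdx_append]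

theorem capWord_concat (A : List (Strand X)) (a : Strand X) :
    capWord (A ++ [a]) = ⟨A.length, .cap a⟩ :: capWord A := by
  simp [capWord, List.zipIdx_append]

/-- Parallel zigzags are straightened one after the other. -/
theorem tequiv_zigzag₁ (A : List (Strand X)) :
    TEquiv A A (shift A.length (cupWord (A.map Strand.flip).reverse) ++ capWord A) [] := by
  induction A with
  | nil => exact .refl _
  | cons a A ih =>
    set B := (A.map Strand.flip).reverse with hB
    have hBl : B.length = A.length := by simp [hB]
    have rcup : Runs A (shift A.length (cupWord B)) (A ++ B ++ A) := by
      have h : B ++ (B.map Strand.flip).reverse = B ++ A := by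
        simp [hB, Function.comp_def]
      have := (runs_cupWord B).frame_left A
      rw [h] at this
      simpa using this
    have rcap : Runs (A ++ B) (capWord A) [] := runs_capWord A
    have rnew : Runs A [⟨0, .cup a.flip⟩] (a.flip :: a :: A) :=
      Runs.single_of_eq (u := []) (v := A) (by simp [Elem.src]) rfl (by simp [Elem.tgt])
    have h1 : TEquiv (a :: (A ++ B ++ A)) (a :: a.flip :: a :: A)
        (⟨A.length + A.length + 1, .cup a.flip⟩ :: shift 1 (capWord A))
        (shift 1 (capWord A) ++ [⟨1, .cup a.flip⟩]) := by
      have := (TEquiv.exchange rcap rnew).symm.frame_left [a]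
      simpa [hBl, add_comm, add_left_comm] using this
    have h2 : TEquiv (a :: A) (a :: A) [⟨1, .cup a.flip⟩, ⟨0, .cap a⟩] [] := by
      refine .of_localMove (.zigzag₁ 0 a) ?_ (.nil _)
      exact .cons_of_eq [a] A (by simp [Elem.src]) rfl (.cons_of_eq [] (a :: A)
        (by simp [Elem.src, Elem.tgt]) rfl (by simpa [Elem.tgt] using Runs.nil _))
    have h3 := ih.frame_left [a]
    have r1 : Runs (a :: A) (shift (A.length + 1) (cupWord B)) (a :: (A ++ B ++ A)) := by
      simpa [add_comm] using rcup.frame_left [a]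
    have r2 : Runs (a :: a.flip :: a :: A) [⟨0, .cap a⟩] (a :: A) :=
      Runs.single_of_eq (u := []) (v := a :: A) (by simp [Elem.src]) rfl (by simp [Elem.tgt])
    have h4 := h1.congr r1 r2
    have h5 : TEquiv (a :: A) (a :: A) (shift (A.length + 1) (cupWord B) ++
        (shift 1 (capWord A) ++ [⟨1, .cup a.flip⟩] ++ [⟨0, .cap a⟩]))
        ([⟨1, .cup a.flip⟩, ⟨0, .cap a⟩]) := by
      have := h3.append_right (q := [⟨1, .cup a.flip⟩, ⟨0, .cap a⟩]) (t' := a :: A)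
        (.cons_of_eq [a] A (by simp [Elem.src]) rfl (.cons_of_eq [] (a :: A)
          (by simp [Elem.src, Elem.tgt]) rfl (by simpa [Elem.tgt] using Runs.nil _)))
      simpa [add_comm] using this
    have h6 := h4.trans (h5.trans h2)
    simpa [List.map_cons, List.reverse_cons, ← hB, cupWord_concat, capWord_cons, hBl, add_assoc,
      add_comm, add_left_comm] using h6

theorem tequiv_zigzag₂ (A : List (Strand X)) :
    TEquiv A A (cupWord A ++ shift A.length (capWord (A.map Strand.flip).reverse)) [] := by
  induction A with
  | nil => exact .refl _
  | cons a A ih =>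
    set B := (A.map Strand.flip).reverse with hB
    have hBl : B.length = A.length := by simp [hB]
    have rcup : Runs [] (cupWord A) (A ++ B) := runs_cupWord A
    have rcap : Runs (A ++ B ++ A) (shift A.length (capWord B)) A := by
      have h : B ++ (B.map Strand.flip).reverse = B ++ A := by
        simp [hB, Function.comp_def]
      have := (runs_capWord B).frame_left A
      rw [h] at this
      simpa using this
    have rnew : Runs (a.flip :: a :: A) [⟨0, .cap a.flip⟩] A :=
      Runs.single_of_eq (u := []) (v := A) (by simp [Elem.src]) rfl (by simp [Elem.tgt])
    have h1 : TEquiv (a :: a.flip :: a :: A) (a :: (A ++ B ++ A))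
        (shift 1 (cupWord A) ++ [⟨A.length + A.length + 1, .cap a.flip⟩])
        (⟨1, .cap a.flip⟩ :: shift 1 (cupWord A)) := by
      have := (TEquiv.exchange rcup rnew).frame_left [a]
      simpa [hBl, add_comm, add_left_comm] using this
    have r0 : Runs (a :: A) [⟨0, .cup a⟩] (a :: a.flip :: a :: A) :=
      Runs.single_of_eq (u := []) (v := a :: A) (by simp [Elem.src]) rfl (by simp [Elem.tgt])
    have r1 : Runs (a :: a.flip :: a :: A) [⟨1, .cap a.flip⟩] (a :: A) :=
      Runs.single_of_eq (u := [a]) (v := A) (by simp [Elem.src]) rfl (by simp [Elem.tgt])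
    have h2 : TEquiv (a :: A) (a :: A) [⟨0, .cup a⟩, ⟨1, .cap a.flip⟩] [] :=
      .of_localMove (.zigzag₂ 0 a) (r0.append r1) (.nil _)
    have r2 : Runs (a :: (A ++ B ++ A)) (shift (A.length + 1) (capWord B)) (a :: A) := by
      simpa [add_comm] using rcap.frame_left [a]
    have h3 := ih.frame_left [a]
    have h4 := h1.congr r0 r2
    have h5 := h2.append_right (q := shift 1 (cupWord A) ++ shift (A.length + 1) (capWord B))
      (t' := a :: A) (by simpa using (rcup.frame [a] A).append (by simpa using r2))
    have h6 := h4.trans (by simpa using h5)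
    have h7 := h6.trans (by simpa [add_comm] using h3)
    simpa [List.map_cons, List.reverse_cons, ← hB, cupWord_cons, capWord_concat, hBl, add_assoc,
      add_comm, add_left_comm] using h7

section Moves

variable (dir : Bool) (r : ℕ)

theorem tequiv_mul_zigzag₁ {z : Strand (List X)} (hz : z.comp.length = r) :
    TEquiv (bundles [z]) (bundles [z]) (mul dir r [⟨1, .cup z.flip⟩, ⟨0, .cap z⟩])
      (mul dir r []) := by
  simpa [cmul, cmulElem, bundle_flip, hz] using tequiv_zigzag₁ (bundle z)

theorem tequiv_mul_zigzag₂ {z : Strand (List X)} (hz : z.comp.length = r) :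
    TEquiv (bundles [z]) (bundles [z]) (mul dir r [⟨0, .cup z⟩, ⟨1, .cap z.flip⟩])
      (mul dir r []) := by
  simpa [cmul, cmulElem, bundle_flip, hz] using tequiv_zigzag₂ (bundle z)

variable {r} {Q : List X → Prop} (i : ℕ) (x : Strand (Fin 1))

theorem lifts_zigzag₁ (hQ : RotClosed r Q) :
    Lifts dir r Q [⟨i + 1, .cup x.flip⟩, ⟨i, .cap x⟩] [] := by
  rintro s t w hs h hw -
  simp only [relabel_eq_cons, Elem.relabel_eq_cap, Elem.relabel_eq_cup, relabel_eq_nil] at hw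
  obtain ⟨_, _, rfl, ⟨y, rfl, hy⟩, _, _, rfl, ⟨z, rfl, hz⟩, rfl⟩ := hw
  obtain ⟨u, l, rfl, hi⟩ := h.split
  obtain ⟨u, c, rfl, hj⟩ := exists_eq_concat hi
  obtain ⟨hq, g1⟩ := h.inv_cup rfl hi
  obtain ⟨v', h1, g2⟩ := g1.inv_cap (u := u) (List.append_assoc ..) hj
  simp only [List.cons.injEq, List.cons_append, List.nil_append] at h1
  obtain ⟨rfl, rfl, rfl⟩ := h1
  obtain rfl := cruns_nil_iff.1 g2
  exact .of_core hQ (u := u) (v := l) (fun x hx => hs x (by simp [hx])) (.nil _)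
    (tequiv_mul_zigzag₁ dir r (z := c) (hQ.1 _ (hs c (by simp)))) (by simp) (by simp) (by simp [hj])
    (by simp)

theorem lifts_zigzag₁' (hQ : RotClosed r Q) :
    Lifts dir r Q [] [⟨i + 1, .cup x.flip⟩, ⟨i, .cap x⟩] := by
  rintro s t w hs h hw hr
  obtain rfl := relabel_eq_nil.1 hw
  obtain rfl := cruns_nil_iff.1 h
  obtain ⟨u, v, h1, hi, hr⟩ := runs_cons_iff.1 hr
  simp only [Elem.src, Elem.tgt, List.append_nil] at h1 hi hr
  obtain ⟨u, c, rfl, hj⟩ := exists_eq_concat hi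
  obtain ⟨u', v', h2, hi', -⟩ := runs_cons_iff.1 hr
  simp only [Elem.src, List.append_assoc] at h2 hi'
  obtain ⟨rfl, h3⟩ := List.append_inj h2 (hj.symm.trans hi')
  simp only [List.cons.injEq, List.cons_append, List.nil_append] at h3
  obtain ⟨rfl, -⟩ := h3
  clear h2
  obtain ⟨s', v, rfl, h2, rfl⟩ := List.map_eq_append_iff.1 h1
  obtain ⟨u, m, rfl, rfl, h3⟩ := List.map_eq_append_iff.1 h2
  simp only [List.map_eq_cons_iff, List.map_eq_nil_iff] at h3
  obtain ⟨a, _, rfl, rfl, rfl⟩ := h3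
  have ha : Q a.comp := hs a (by simp)
  exact .of_core hQ (u := u) (v := v) (fun x hx => hs x (by simp [hx]))
    (c' := [⟨1, .cup a.flip⟩, ⟨0, .cap a⟩])
    (cruns_cup_cons (a := a.flip) [a] [] rfl ha (cruns_cap_cons (a := a) [] [a.flip.flip] rfl rfl
      (by simpa using CRuns.nil _)))
    (tequiv_mul_zigzag₁ dir r (hQ.1 _ ha)).symm (by simp) (by simp) (by simp)
    (by simp [Elem.relabel, hj])

theorem lifts_zigzag₂ (hQ : RotClosed r Q) :
    Lifts dir r Q [⟨i, .cup x⟩, ⟨i + 1, .cap x.flip⟩] [] := by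
  rintro s t w hs h hw -
  simp only [relabel_eq_cons, Elem.relabel_eq_cap, Elem.relabel_eq_cup, relabel_eq_nil] at hw
  obtain ⟨_, _, rfl, ⟨y, rfl, hy⟩, _, _, rfl, ⟨z, rfl, hz⟩, rfl⟩ := hw
  obtain ⟨u, l, rfl, hi⟩ := h.split
  obtain ⟨hq, g1⟩ := h.inv_cup rfl hi
  obtain ⟨v', h1, g2⟩ := g1.inv_cap (u := u ++ [_]) (List.append_cons ..) (by simp [hi])
  simp only [List.cons.injEq] at h1
  obtain ⟨rfl, rfl⟩ := h1
  obtain rfl := cruns_nil_iff.1 g2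
  exact .of_core hQ (u := u) (v := v') (fun x hx => hs x (by simp [hx])) (.nil _)
    (tequiv_mul_zigzag₂ dir r (z := y) (hQ.1 _ hq)) (by simp) (by simp) (by simp [hi])
    (by simp)

theorem lifts_zigzag₂' (hQ : RotClosed r Q) :
    Lifts dir r Q [] [⟨i, .cup x⟩, ⟨i + 1, .cap x.flip⟩] := by
  rintro s t w hs h hw hr
  obtain rfl := relabel_eq_nil.1 hw
  obtain rfl := cruns_nil_iff.1 h
  obtain ⟨u, v, h1, hi, hr⟩ := runs_cons_iff.1 hr
  simp only [Elem.src, Elem.tgt, List.append_nil] at h1 hi hr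
  obtain ⟨u', v', h2, hi', -⟩ := runs_cons_iff.1 hr
  simp only [Elem.src, List.append_assoc, Strand.flip_flip] at h2 hi'
  have h2 : (u ++ [x]) ++ ([x.flip] ++ v) = u' ++ ([x.flip, x] ++ v') := by simpa using h2
  obtain ⟨rfl, h3⟩ := List.append_inj h2 (by simp [← hi', hi])
  simp only [List.cons.injEq, List.cons_append, List.nil_append] at h3
  obtain ⟨-, rfl⟩ := h3
  obtain ⟨u, m, rfl, rfl, h3⟩ := List.map_eq_append_iff.1 h1
  obtain ⟨a, v, rfl, rfl, rfl⟩ := List.map_eq_cons_iff.1 h3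
  have ha : Q a.comp := hs a (by simp)
  exact .of_core hQ (u := u) (v := v) (fun x hx => hs x (by simp [hx]))
    (cruns_cup_cons [] [a] rfl ha (cruns_cap_cons [_] [] rfl (by simp) (.nil _)))
    (tequiv_mul_zigzag₂ dir r (hQ.1 _ ha)).symm (by simp) (by simp) (by simp)
    (by simp [Elem.relabel, hi])

end Moves

theorem Elem.length_ctgt {ρ : Equiv.Perm C} {δ : ℤ} (e : Elem C) :
    (e.ctgt ρ δ).length = e.tgt.length := by cases e <;> rfl

theorem Elem.length_src_relabel (f : X → Y) (e : Elem X) :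
    (e.relabel f).src.length = e.src.length := by simp

theorem Elem.length_tgt_relabel (f : X → Y) (e : Elem X) :
    (e.relabel f).tgt.length = e.tgt.length := by simp

section Exchange

variable {dir : Bool} {r : ℕ} {e f : Elem (List X)} {u m v : List (Strand (List X))}

theorem cruns_exchange₁ {ρ : Equiv.Perm C} {δ : ℤ} {Q : C → Prop} {e f : Elem C}
    {u m v : List (Strand C)} (he : ∀ s, e = .cup s → Q s.comp) (hf : ∀ s, f = .cup s → Q s.comp) :
    CRuns ρ δ Q (u ++ e.src ++ m ++ f.src ++ v)
      [⟨u.length, e⟩, ⟨u.length + e.tgt.length + m.length, f⟩]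
      (u ++ e.ctgt ρ δ ++ m ++ f.ctgt ρ δ ++ v) :=
  .cons_of_eq u (m ++ f.src ++ v) (by simp) rfl he
    (.cons_of_eq (u ++ e.ctgt ρ δ ++ m) v (by simp)
      (by simp [Elem.length_ctgt, add_assoc]) hf (.nil _))

theorem cruns_exchange₂ {ρ : Equiv.Perm C} {δ : ℤ} {Q : C → Prop} {e f : Elem C}
    {u m v : List (Strand C)} (he : ∀ s, e = .cup s → Q s.comp) (hf : ∀ s, f = .cup s → Q s.comp) :
    CRuns ρ δ Q (u ++ e.src ++ m ++ f.src ++ v)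
      [⟨u.length + e.src.length + m.length, f⟩, ⟨u.length, e⟩]
      (u ++ e.ctgt ρ δ ++ m ++ f.ctgt ρ δ ++ v) :=
  .cons_of_eq (u ++ e.src ++ m) v (by simp) (by simp [add_assoc]) hf
    (.cons_of_eq u (m ++ f.ctgt ρ δ ++ v) (by simp) rfl he (cruns_nil_iff.2 (by simp)))

theorem tequiv_mul_exchange (he : ∀ s, e = .cup s → s.comp.length = r)
    (hs : ∀ x ∈ u ++ e.src ++ m ++ f.src ++ v, x.comp.length = r) :
    TEquiv (bundles (u ++ e.src ++ m ++ f.src ++ v))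
      (bundles (u ++ e.ctgt rot (dirSign dir) ++ m ++ f.ctgt rot (dirSign dir) ++ v))
      (mul dir r [⟨u.length, e⟩, ⟨u.length + e.tgt.length + m.length, f⟩])
      (mul dir r [⟨u.length + e.src.length + m.length, f⟩, ⟨u.length, e⟩]) := by
  have h1 : ∀ x ∈ u ++ e.src ++ m, x.comp.length = r := fun x hx =>
    hs x (by rw [List.append_assoc]; exact List.mem_append_left _ hx)
  have h2 : ∀ x ∈ u ++ e.ctgt rot (dirSign dir) ++ m, x.comp.length = r :=
    LRuns.induction_step he h1
  have l1 := length_bundles h1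
  have l2 := length_bundles h2
  have h := (TEquiv.exchange (runs_cmul dir (u := u) (v := m) (e := e) fun x hx =>
      h1 x (by simp [hx]))
    (runs_cmulElem dir f)).frame_right (bundles v)
  rw [l1, l2] at h
  simpa [cmul, Elem.length_ctgt, add_assoc] using h

end Exchange

section Moves

variable (dir : Bool) {r : ℕ} {Q : List X → Prop} (i d : ℕ) (e f : Elem (Fin 1))

theorem lifts_exchange (hQ : RotClosed r Q) :
    Lifts dir r Q [⟨i, e⟩, ⟨i + e.tgt.length + d, f⟩] [⟨i + e.src.length + d, f⟩, ⟨i, e⟩] := by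
  rintro s t w hs h hw -
  simp only [relabel_eq_cons, relabel_eq_nil] at hw
  obtain ⟨e, _, rfl, rfl, f, _, rfl, rfl, rfl⟩ := hw
  simp only [Elem.length_src_relabel, Elem.length_tgt_relabel] at *
  obtain ⟨u, v, rfl, hi, he, g1⟩ := cruns_cons_iff.1 h
  obtain ⟨u', v', h1, hi', hf, g2⟩ := cruns_cons_iff.1 g1
  obtain rfl := cruns_nil_iff.1 g2
  rw [List.append_assoc _ f.src] at h1
  obtain ⟨m, rfl, rfl⟩ : ∃ m, u' = u ++ e.ctgt rot (dirSign dir) ++ m ∧ v = m ++ (f.src ++ v') := by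
    rcases List.append_eq_append_iff.1 h1 with ⟨m, h2, h3⟩ | ⟨m, h2, h3⟩
    · exact ⟨m, h2, h3⟩
    · have : m = [] := by
        have := congrArg List.length h2
        simp only [List.length_append, Elem.length_ctgt] at this
        exact List.length_eq_zero_iff.1 (by omega)
      subst this
      exact ⟨[], by simpa using h2.symm, by simpa using h3.symm⟩
  obtain rfl : d = m.length := by
    simp only [List.length_append, Elem.length_ctgt] at hi'
    omega
  subst hi
  refine ⟨[⟨u.length + e.src.length + m.length, f⟩, ⟨u.length, e⟩], by simp, ?_, ?_⟩
  · simpa using cruns_exchange₂ (u := u) (m := m) (v := v') he hf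
  · simpa using tequiv_mul_exchange (dir := dir) (u := u) (m := m) (v := v') (e := e) (f := f)
      (fun s hs => hQ.1 _ (he s hs)) (fun x hx => hQ.1 _ (hs x (by simpa using hx)))

theorem lifts_exchange' (hQ : RotClosed r Q) :
    Lifts dir r Q [⟨i + e.src.length + d, f⟩, ⟨i, e⟩] [⟨i, e⟩, ⟨i + e.tgt.length + d, f⟩] := by
  rintro s t w hs h hw -
  simp only [relabel_eq_cons, relabel_eq_nil] at hw
  obtain ⟨f, _, rfl, rfl, e, _, rfl, rfl, rfl⟩ := hw
  simp only [Elem.length_src_relabel, Elem.length_tgt_relabel] at *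
  obtain ⟨u', v', rfl, hi', hf, g1⟩ := cruns_cons_iff.1 h
  obtain ⟨u, v, h1, hi, he, g2⟩ := cruns_cons_iff.1 g1
  obtain rfl := cruns_nil_iff.1 g2
  rw [List.append_assoc u'] at h1
  obtain ⟨m, rfl, rfl⟩ : ∃ m, u' = u ++ e.src ++ m ∧ v = m ++ (f.ctgt rot (dirSign dir) ++ v') := by
    rcases List.append_eq_append_iff.1 h1 with ⟨m, h2, h3⟩ | ⟨m, h2, h3⟩
    · have : m = [] := by
        have := congrArg List.length h2
        simp only [List.length_append] at this
        exact List.length_eq_zero_iff.1 (by omega)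
      subst this
      exact ⟨[], by simpa using h2.symm, by simpa using h3.symm⟩
    · exact ⟨m, h2, h3⟩
  obtain rfl : d = m.length := by
    simp only [List.length_append] at hi'
    omega
  subst hi
  refine ⟨[⟨u.length, e⟩, ⟨u.length + e.tgt.length + m.length, f⟩], by simp, ?_, ?_⟩
  · simpa using cruns_exchange₁ (u := u) (m := m) (v := v') he hf
  · simpa using (tequiv_mul_exchange (dir := dir) (u := u) (m := m) (v := v') (e := e) (f := f)
      (fun s hs => hQ.1 _ (he s hs)) (fun x hx => hQ.1 _ (hs x (by simpa using hx)))).symm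

end Moves

/-- Colourings can be carried through the local moves, in both directions. -/
theorem LocalMove.lifts [Nonempty X] (dir : Bool) {r : ℕ} {Q : List X → Prop}
    (hQ : RotClosed r Q) {a a' : Word (Fin 1)}
    (h : LocalMove a a') : Lifts dir r Q a a' ∧ Lifts dir r Q a' a := by
  cases h with
  | exchange i d e f => exact
      ⟨by apply lifts_exchange; exact hQ, by apply lifts_exchange'; exact hQ⟩
  | zigzag₁ i s => exact ⟨by apply lifts_zigzag₁; exact hQ, by apply lifts_zigzag₁'; exact hQ⟩
  | zigzag₂ i s => exact ⟨by apply lifts_zigzag₂; exact hQ, by apply lifts_zigzag₂'; exact hQ⟩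
  | capSlide i k x a => exact
      ⟨by apply lifts_capSlide; exact hQ, by apply lifts_capSlide'; exact hQ⟩
  | cupSlide i k x a => exact
      ⟨by apply lifts_cupSlide; exact hQ, by apply lifts_cupSlide'; exact hQ⟩
  | curl₁ i k x => exact ⟨by apply lifts_curl₁; exact hQ, by apply lifts_curl₁'; exact hQ⟩
  | curl₂ i k x => exact ⟨by apply lifts_curl₂; exact hQ, by apply lifts_curl₂'; exact hQ⟩
  | bigon i k a b => exact ⟨by apply lifts_bigon; exact hQ, by apply lifts_bigon'; exact hQ⟩
  | triangle i k₁ k₂ k₃ a b c h => exact ⟨lifts_triangle _ _ _ _ _ _ _ _ hQ h,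
      lifts_triangle' _ _ _ _ _ _ _ _ hQ h⟩

theorem Runs.codet {s s' t : List (Strand X)} {w : Word X} (h : Runs s w t) (h' : Runs s' w t) :
    s = s' := by
  induction h generalizing s' with
  | nil => exact (runs_nil_iff.1 h').symm
  | cons u v e w t _ ih =>
    obtain ⟨u', v', rfl, h2, h3⟩ := runs_cons_iff.1 h'
    have h1 := ih h3
    simp only [List.append_assoc] at h1 h2
    obtain ⟨rfl, h4⟩ := List.append_inj h1 h2
    obtain rfl : v = v' := List.append_cancel_left h4
    rfl

theorem relabel_eq_append {f : X → Y} {w : Word X} {p q : Word Y}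
    (h : Word.relabel f w = p ++ q) :
    ∃ p' q', w = p' ++ q' ∧ Word.relabel f p' = p ∧ Word.relabel f q' = q :=
  List.map_eq_append_iff.1 h

/-- A colouring of a closed diagram can be carried along an equivalence. -/
theorem exists_lift_of_eqvGen [Nonempty X] {dir : Bool} {r : ℕ} {Q : List X → Prop}
    (hQ : RotClosed r Q) {w w' : Word (Fin 1)}
    (h : Relation.EqvGen Move w w') :
    (∀ c : Word (List X), CRuns rot (dirSign dir) Q [] c [] →
        Word.relabel (fun _ => (0 : Fin 1)) c = w →
      ∃ c', CRuns rot (dirSign dir) Q [] c' [] ∧ Word.relabel (fun _ => (0 : Fin 1)) c' = w' ∧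
        TEquiv [] [] (mul dir r c) (mul dir r c')) ∧
    (∀ c : Word (List X), CRuns rot (dirSign dir) Q [] c [] →
        Word.relabel (fun _ => (0 : Fin 1)) c = w' →
      ∃ c', CRuns rot (dirSign dir) Q [] c' [] ∧ Word.relabel (fun _ => (0 : Fin 1)) c' = w ∧
        TEquiv [] [] (mul dir r c) (mul dir r c')) := by
  have key : ∀ {w w' : Word (Fin 1)} {p q a a' : Word (Fin 1)}, w = p ++ a ++ q →
      w' = p ++ a' ++ q → Runs [] w' [] → Lifts dir r Q a a' →
      ∀ c : Word (List X), CRuns rot (dirSign dir) Q [] c [] →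
          Word.relabel (fun _ => (0 : Fin 1)) c = w →
        ∃ c', CRuns rot (dirSign dir) Q [] c' [] ∧ Word.relabel (fun _ => (0 : Fin 1)) c' = w' ∧
          TEquiv [] [] (mul dir r c) (mul dir r c') := by
    rintro w w' p q a a' rfl rfl hr hl c hc hw
    obtain ⟨c₁, q, rfl, hw₁, rfl⟩ := relabel_eq_append hw
    obtain ⟨p, a, rfl, rfl, rfl⟩ := relabel_eq_append hw₁
    obtain ⟨t, h1, h3⟩ := CRuns.of_append hc
    obtain ⟨s, h1, h2⟩ := CRuns.of_append h1
    have hs := h1.colors (fun c n => (hQ.2 c n).2) (by simp)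
    have ht := h2.colors (fun c n => (hQ.2 c n).2) hs
    have hr' : Runs (s.map (Strand.relabel fun _ => (0 : Fin 1))) a'
        (t.map (Strand.relabel fun _ => (0 : Fin 1))) := by
      rw [List.append_assoc] at hr
      obtain ⟨s', hr1, hr2⟩ := runs_append_iff.1 hr
      obtain rfl := h1.forget.det hr1
      obtain ⟨t', hr2, hr3⟩ := runs_append_iff.1 hr2
      obtain rfl : t.map (Strand.relabel fun _ => (0 : Fin 1)) = t' := h3.forget.codet hr3
      exact hr2
    obtain ⟨a'', rfl, h4, h5⟩ := hl s t a hs h2 rfl hr'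
    refine ⟨p ++ a'' ++ q, (h1.append h4).append h3, by simp, ?_⟩
    simpa using h5.congr (runs_mul (h1.mono hQ.1) (by simp))
      (runs_mul (h3.mono hQ.1) fun x hx => hQ.1 _ (ht x hx))
  induction h with
  | rel _ _ h =>
    obtain ⟨h1, h2, p, q, a, a', hm, e1, e2⟩ := h
    obtain ⟨m1, m2⟩ := LocalMove.lifts dir hQ hm
    exact ⟨key e1 e2 h2 m1, key e2 e1 h1 m2⟩
  | refl => exact ⟨fun c h h' => ⟨c, h, h', .refl _⟩, fun c h h' => ⟨c, h, h', .refl _⟩⟩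
  | symm _ _ _ ih => exact ih.symm
  | trans _ _ _ _ _ ih₁ ih₂ =>
    constructor
    · intro c h h'
      obtain ⟨c₁, h1, h2, h3⟩ := ih₁.1 c h h'
      obtain ⟨c₂, h4, h5, h6⟩ := ih₂.1 c₁ h1 h2
      exact ⟨c₂, h4, h5, h3.trans h6⟩
    · intro c h h'
      obtain ⟨c₁, h1, h2, h3⟩ := ih₂.2 c h h'
      obtain ⟨c₂, h4, h5, h6⟩ := ih₁.2 c₁ h1 h2
      exact ⟨c₂, h4, h5, h3.trans h6⟩

/-! ### Rotating all colours -/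

theorem Strand.relabel_perm (ρ : Equiv.Perm C) (s : Strand C) : s.relabel ρ = s.turn ρ 1 := by
  simp [Strand.relabel, Strand.turn]

theorem bundle_relabel_rot (s : Strand (List X)) :
    bundle (s.relabel rot) = pageRot s.up (bundle s) := by
  rw [Strand.relabel_perm]
  have h1 := bundle_turn_sign s
  have h2 := bundle_turn_neg_sign s
  obtain ⟨_ | _, c⟩ := s
  · simpa [Strand.sign, pageRot] using h2
  · simpa [Strand.sign, pageRot] using h1

/-- All bundles are permuted cyclically by one place to the right, by virtual crossings. -/
def turnWord : List (Strand (List X)) → Word X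
  | [] => []
  | s :: l => rotWord s.up (bundle s) ++ shift (bundle s).length (turnWord l)

theorem length_bundles_relabel_rot (s : List (Strand (List X))) :
    (bundles (s.map (Strand.relabel rot))).length = (bundles s).length := by
  induction s with
  | nil => rfl
  | cons a s ih => simp only [List.map_cons, bundles_cons, List.length_append, ih,
      bundle_relabel_rot, length_pageRot]

theorem turnWord_append (s t : List (Strand (List X))) :
    turnWord (s ++ t) = turnWord s ++ shift (bundles s).length (turnWord t) := by
  induction s with
  | nil => simp [turnWord]
  | cons a s ih => simp [turnWord, ih]

theorem runs_turnWord (s : List (Strand (List X))) :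
    Runs (bundles s) (turnWord s) (bundles (s.map (Strand.relabel rot))) := by
  induction s with
  | nil => exact .nil _
  | cons a s ih =>
    have h1 := (runs_rotWord a.up (bundle a)).frame_right (bundles s)
    have h2 := ih.frame_left (bundle (a.relabel rot))
    rw [bundle_relabel_rot, length_pageRot] at h2
    simpa only [List.map_cons, bundles_cons, bundle_relabel_rot, turnWord] using h1.append h2

@[simp] theorem events_turnWord (s : List (Strand (List X))) : events (turnWord s) = [] := by
  induction s with
  | nil => rfl
  | cons a s ih => simp [turnWord, ih]

theorem turnWord_relabel (f : X → Y) (s : List (Strand (List X))) :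
    turnWord (s.map (Strand.relabel (List.map f))) = Word.relabel f (turnWord s) := by
  induction s with
  | nil => rfl
  | cons a s ih => simp [turnWord, ih, bundle_relabel, relabel_rotWord]

theorem Elem.ctgt_relabel_perm (ρ : Equiv.Perm C) (δ : ℤ) (e : Elem C) :
    (e.relabel ρ).ctgt ρ δ = (e.ctgt ρ δ).map (Strand.relabel ρ) :=
  Elem.ctgt_relabel_of_comm (fun _ => rfl) δ e

theorem elem_ne {w : Word X} {y : Elem X} (hy : y ∉ events w) (hv : y.isVirtual = false) :
    ∀ l ∈ w, l.elem ≠ y :=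
  fun _ hl h => hy (h ▸ mem_events hl (h ▸ hv))

theorem tequiv_turn_univ (dir : Bool) (r : ℕ) (e : Elem (List (ℕ × ℕ)))
    (he : (∃ k x y, e = .cross k (univStrand r 0 x) (univStrand r 1 y)) ∨
      (∃ x, e = .cup (univStrand r 0 x)) ∨ (∃ x, e = .cap (univStrand r 0 x))) :
    TEquiv (bundles e.src) (bundles ((e.ctgt rot (dirSign dir)).map (Strand.relabel rot)))
      (cmulElem dir e ++ turnWord (e.ctgt rot (dirSign dir)))
      (turnWord e.src ++ cmulElem dir (e.relabel rot)) := by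
  have r1 := (runs_cmulElem dir e).append (runs_turnWord (e.ctgt rot (dirSign dir)))
  have r2 := (runs_turnWord e.src).append
    (by simpa only [Elem.src_relabel, Elem.ctgt_relabel_perm] using
      runs_cmulElem dir (e.relabel rot))
  rcases he with ⟨k, x, y, rfl⟩ | ⟨x, rfl⟩ | ⟨x, rfl⟩
  · refine Reduces.tequiv (E := events _) (E' := events _) ?_ (.of_runs r1 ?_ ?_)
      (.of_runs r2 ?_ ?_) rfl rfl
    · rw [events_append, events_append, events_turnWord, events_turnWord, List.append_nil,
        List.nil_append, Elem.relabel]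
      by_cases hk : k = .virt
      · subst hk
        simpa [events_cmulElem_virt] using Reduces.refl _
      · have e1 := events_cross_univStrand dir hk r 0 1 x y 0
        have e2 := events_cross_univStrand dir hk r 0 1 x y 1
        have h1 := (Reduces.of_perm_map List.nodup_range (atPlace_cross k x y 0 1) e1).1
        have h2 := (Reduces.of_perm_map List.nodup_range (atPlace_cross k x y 0 1) e2).2
        rw [Strand.relabel_perm, Strand.relabel_perm]
        simpa using h1.trans h2
    · simpa [Elem.src] using nodup_bundles_univStrand r [(0, x, 0), (1, y, 0)] (by simp)
    · exact fun l hl z => elem_ne (by simp [cup_cap_notMem_events_cross]) rfl l hl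
    · simpa [Elem.src] using nodup_bundles_univStrand r [(0, x, 0), (1, y, 0)] (by simp)
    · exact fun l hl z => elem_ne (by simp [cup_cap_notMem_events_cross, Elem.relabel]) rfl l hl
  · have hn : (bundles (((Elem.cup (univStrand r 0 x)).ctgt rot (dirSign dir)).map
        (Strand.relabel rot))).Nodup := by
      simp only [Elem.ctgt, Elem.tgt, List.map_cons, List.map_nil, Strand.relabel_perm,
        univStrand_flip]
      exact nodup_bundles_univStrand r [(0, x, 1), (0, !x, 1)] (by simp)
    refine Reduces.tequiv (E := events _) (E' := events _) ?_ (.of_runs' r1 hn ?_)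
      (.of_runs' r2 hn ?_) rfl rfl
    · rw [events_append, events_append, events_turnWord, events_turnWord, List.append_nil,
        List.nil_append, Elem.relabel]
      have c1 := events_cup_univStrand dir r 0 x 0
      have c2 := events_cup_univStrand dir r 0 x 1
      have h1 := (Reduces.of_perm_map List.nodup_range (atPlace_cup x 0) c1).1
      have h2 := (Reduces.of_perm_map List.nodup_range (atPlace_cup x 0) c2).2
      rw [Strand.relabel_perm]
      simpa using h1.trans h2
    · exact fun l hl z => elem_ne (by simp) rfl l hl
    · exact fun l hl z => elem_ne (by simp [Elem.relabel]) rfl l hl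
  · have hn : (bundles (Elem.cap (univStrand r 0 x)).src).Nodup := by
      simp only [Elem.src, univStrand_flip]
      exact nodup_bundles_univStrand r [(0, x, 0), (0, !x, 0)] (by simp)
    refine Reduces.tequiv (E := events _) (E' := events _) ?_ (.of_runs r1 hn ?_)
      (.of_runs r2 hn ?_) rfl rfl
    · rw [events_append, events_append, events_turnWord, events_turnWord, List.append_nil,
        List.nil_append, Elem.relabel]
      have c1 := events_cap_univStrand dir r 0 x 0
      have c2 := events_cap_univStrand dir r 0 x 1
      have h1 := (Reduces.of_perm_map List.nodup_range (atPlace_cap x 0) c1).1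
      have h2 := (Reduces.of_perm_map List.nodup_range (atPlace_cap x 0) c2).2
      rw [Strand.relabel_perm]
      simpa using h1.trans h2
    · exact fun l hl z => elem_ne (by simp) rfl l hl
    · exact fun l hl z => elem_ne (by simp [Elem.relabel]) rfl l hl

theorem Strand.relabel_map_rot (f : X → Y) (s : Strand (List X)) :
    (s.relabel (List.map f)).relabel rot = (s.relabel rot).relabel (List.map f) := by
  rw [Strand.relabel_perm, Strand.relabel_perm, relabel_turn_rot]

theorem Elem.relabel_map_rot (f : X → Y) (e : Elem (List X)) :
    (e.relabel (List.map f)).relabel rot = (e.relabel rot).relabel (List.map f) := by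
  cases e <;> simp only [Elem.relabel, Strand.relabel_map_rot]

theorem Elem.ctgt_relabel_map (f : X → Y) (δ : ℤ) (e : Elem (List X)) :
    (e.relabel (List.map f)).ctgt rot δ =
      (e.ctgt rot δ).map (Strand.relabel (List.map f)) :=
  Elem.ctgt_relabel_of_comm (fun c => (rotR_map f c).symm) δ e

/-- The cyclic permutation of all bundles by virtual crossings may be moved through a piece. -/
theorem tequiv_turn_elem [Nonempty X] (dir : Bool) {r : ℕ} (e : Elem (List X))
    (he : ∀ s ∈ e.ends, s.comp.length = r) :
    TEquiv (bundles e.src) (bundles ((e.ctgt rot (dirSign dir)).map (Strand.relabel rot)))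
      (cmulElem dir e ++ turnWord (e.ctgt rot (dirSign dir)))
      (turnWord e.src ++ cmulElem dir (e.relabel rot)) := by
  obtain ⟨f, e', rfl, h⟩ : ∃ (f : ℕ × ℕ → X) (e' : Elem (List (ℕ × ℕ))),
      e = e'.relabel (List.map f) ∧
      ((∃ k x y, e' = .cross k (univStrand r 0 x) (univStrand r 1 y)) ∨
      (∃ x, e' = .cup (univStrand r 0 x)) ∨ (∃ x, e' = .cap (univStrand r 0 x))) := by
    cases e with
    | cross k a b =>
      have ha := he a (by simp [Elem.ends, Elem.src])
      have hb := he b (by simp [Elem.ends, Elem.src])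
      obtain ⟨f, h1, h2, -⟩ := exists_relabel_univStrand a b b ha hb hb
      exact ⟨f, .cross k (univStrand r 0 a.up) (univStrand r 1 b.up),
        by rw [Elem.relabel, ← h1, ← h2], .inl ⟨_, _, _, rfl⟩⟩
    | cup a =>
      have ha := he a (by simp [Elem.ends, Elem.tgt])
      obtain ⟨f, h1, -, -⟩ := exists_relabel_univStrand a a a ha ha ha
      exact ⟨f, .cup (univStrand r 0 a.up), by rw [Elem.relabel, ← h1], .inr (.inl ⟨_, rfl⟩)⟩
    | cap a =>
      have ha := he a (by simp [Elem.ends, Elem.src])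
      obtain ⟨f, h1, -, -⟩ := exists_relabel_univStrand a a a ha ha ha
      exact ⟨f, .cap (univStrand r 0 a.up), by rw [Elem.relabel, ← h1], .inr (.inr ⟨_, rfl⟩)⟩
  have := (tequiv_turn_univ dir r e' h).relabel f
  have hcomm : ∀ l : List (Strand (List (ℕ × ℕ))),
      (l.map (Strand.relabel (List.map f))).map (Strand.relabel rot) =
        (l.map (Strand.relabel rot)).map (Strand.relabel (List.map f)) := fun l => by
    simp only [List.map_map, Function.comp_def, Strand.relabel_map_rot]
  rw [Elem.src_relabel, Elem.ctgt_relabel_map, hcomm, bundles_relabel, bundles_relabel,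
    turnWord_relabel, turnWord_relabel, cmulElem_relabel, Elem.relabel_map_rot, cmulElem_relabel]
  simpa only [relabel_append] using this

theorem tequiv_turn_letter [Nonempty X] (dir : Bool) {r : ℕ} (e : Elem (List X))
    (u v : List (Strand (List X))) (hu : ∀ s ∈ u, s.comp.length = r)
    (he : ∀ s ∈ e.ends, s.comp.length = r) :
    TEquiv (bundles (u ++ e.src ++ v))
      (bundles ((u ++ e.ctgt rot (dirSign dir) ++ v).map (Strand.relabel rot)))
      (cmul dir r ⟨u.length, e⟩ ++ turnWord (u ++ e.ctgt rot (dirSign dir) ++ v))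
      (turnWord (u ++ e.src ++ v) ++ cmul dir r ⟨u.length, e.relabel rot⟩) := by
  have re := runs_cmulElem dir e
  have re' := runs_cmulElem dir (e.relabel rot)
  rw [Elem.src_relabel, Elem.ctgt_relabel_perm] at re'
  have h2 := tequiv_turn_elem dir e he
  have lu := length_bundles_relabel_rot u
  have ls := length_bundles_relabel_rot e.src
  have lc := length_bundles_relabel_rot (e.ctgt rot (dirSign dir))
  have ru := runs_turnWord u
  have rv := runs_turnWord v
  have rs := runs_turnWord e.src
  have rc := runs_turnWord (e.ctgt rot (dirSign dir))
  have hr : r * u.length = (bundles u).length := (length_bundles hu).symm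
  simp only [cmul, hr, turnWord_append, List.map_append, bundles_append, List.length_append]
  generalize bundles u = U at *
  generalize bundles v = V at *
  generalize bundles e.src = S at *
  generalize bundles (e.ctgt rot (dirSign dir)) = T at *
  generalize bundles (u.map (Strand.relabel rot)) = U' at *
  generalize bundles (v.map (Strand.relabel rot)) = V' at *
  generalize bundles (e.src.map (Strand.relabel rot)) = S' at *
  generalize bundles ((e.ctgt rot (dirSign dir)).map (Strand.relabel rot)) = T' at *
  generalize cmulElem dir e = E at *
  generalize cmulElem dir (e.relabel rot) = E' at *
  generalize turnWord u = tu at *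
  generalize turnWord v = tv at *
  generalize turnWord e.src = ts at *
  generalize turnWord (e.ctgt rot (dirSign dir)) = tc at *
  have s1 := (TEquiv.exchange ru re).symm
  rw [lu] at s1
  have s1 := (s1.append_right (rc.frame_left U')).frame_right V
  have s1 := s1.append_right (q := shift (U.length + T.length) tv) (t' := U' ++ T' ++ V')
    (by simpa [lu, lc] using rv.frame_left (U' ++ T'))
  have s2 := ((h2.frame_left U').frame_right V).append_left (p := tu) (s' := U ++ S ++ V)
    (by simpa using (ru.frame_right (S ++ V)))
  have s2 := s2.append_right (q := shift (U.length + T.length) tv) (t' := U' ++ T' ++ V')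
    (by simpa [lu, lc] using rv.frame_left (U' ++ T'))
  have s3 := (TEquiv.exchange re' rv).frame_left U'
  have s3 := s3.append_left (p := tu ++ shift U.length ts) (s' := U ++ S ++ V)
    (by
      have := (rs.frame_left U').frame_right V
      rw [lu] at this
      simpa using (ru.frame_right (S ++ V)).append (by simpa using this))
  rw [lu] at s2 s3
  simp only [shift_append, shift_shift, lc, ls, lu, List.append_assoc] at s1 s2 s3 ⊢
  exact s1.trans (s2.trans s3)

theorem tequiv_turn_mul [Nonempty X] {dir : Bool} {r : ℕ} {s t : List (Strand (List X))}
    {w : Word (List X)} (h : LRuns dir r s w t) (hs : ∀ x ∈ s, x.comp.length = r) :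
    TEquiv (bundles s) (bundles (t.map (Strand.relabel rot))) (mul dir r w ++ turnWord t)
      (turnWord s ++ mul dir r (Word.relabel rot w)) := by
  induction h with
  | nil s => simpa using TEquiv.refl _
  | cons u v e w t hq hw ih =>
    have hm := LRuns.induction_step (dir := dir) hq hs
    have hu : ∀ x ∈ u, x.comp.length = r := fun x hx => hs x (by simp [hx])
    have he : ∀ x ∈ e.ends, x.comp.length = r :=
      Elem.forall_ends (P := fun c => c.length = r) hq fun x hx => hs x (by simp [hx])
    have h1 := (ih hm).append_left (runs_cmul dir (v := v) (e := e) hu)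
    have h2 := (tequiv_turn_letter dir e u v hu he).append_right
      (q := mul dir r (Word.relabel rot w)) (t' := bundles (t.map (Strand.relabel rot))) (by
        refine runs_mul (hw.relabel rot (fun _ => rfl) fun c hc => ?_) ?_
        · simpa using (length_rot_zpow 1 c).trans hc
        · intro x hx
          obtain ⟨y, hy, rfl⟩ := List.mem_map.1 hx
          simpa [Strand.relabel_perm] using (length_rot_zpow 1 _).trans (hm y hy))
    simpa using h1.trans (by simpa using h2)

/-- The multiplexing of a closed coloured diagram does not change up to equivalence if all colours
are permuted cyclically: the parallel strands are permuted everywhere at the same time. -/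
theorem tequiv_mul_relabel_rot [Nonempty X] {dir : Bool} {r : ℕ} {w : Word (List X)}
    (h : LRuns dir r [] w []) (n : ℤ) :
    LRuns dir r [] (Word.relabel ⇑(rot ^ n) w) [] ∧
      TEquiv [] [] (mul dir r w) (mul dir r (Word.relabel ⇑(rot ^ n) w)) := by
  have hrel : ∀ n : ℤ, LRuns dir r [] (Word.relabel ⇑(rot ^ n) w) [] := fun n =>
    CRuns.relabel h (rot ^ n) (zpow_apply_comm rot n)
      (fun c hc => (length_rot_zpow n c).trans hc)
  have hcomp : ∀ n : ℤ, Word.relabel rot (Word.relabel ⇑(rot ^ n) w) =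
      Word.relabel ⇑(rot ^ (n + 1)) w := fun n => by
    rw [relabel_relabel, add_comm, zpow_add]
    rfl
  have hstep : ∀ n : ℤ, TEquiv [] [] (mul dir r (Word.relabel ⇑(rot ^ n) w))
      (mul dir r (Word.relabel ⇑(rot ^ (n + 1)) w)) := fun n => by
    simpa [turnWord, hcomp] using tequiv_turn_mul (hrel n) (by simp)
  refine ⟨hrel n, ?_⟩
  induction n with
  | zero =>
    refine .of_eq ?_
    congr 1
    conv_lhs => rw [← List.map_id w]
    refine List.map_congr_left fun l _ => ?_
    obtain ⟨i, e⟩ := l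
    cases e <;> rfl
  | succ n ih => exact ih.trans (hstep n)
  | pred n ih =>
    have := hstep (-n - 1)
    rw [sub_add_cancel] at this
    exact ih.trans this.symm

/-! ### Every labelling of a multiplexing comes from a colouring -/

/-- Above a word without minima, the components of all strands are determined by those at the
bottom. -/
theorem Runs.unique_of_forget {s t t' : List (Strand X)} {w w' : Word X} (h : Runs s w t)
    (h' : Runs s w' t')
    (hw : Word.relabel (fun _ => (0 : Fin 1)) w' = Word.relabel (fun _ => (0 : Fin 1)) w)
    (hc : ∀ l ∈ w, ∀ x, l.elem ≠ .cup x) : w' = w ∧ t' = t := by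
  induction h generalizing w' with
  | nil =>
    obtain rfl := relabel_eq_nil.1 hw
    exact ⟨rfl, (runs_nil_iff.1 h').symm⟩
  | cons u v e w t _ ih =>
    rw [relabel_cons] at hw
    obtain ⟨e', w', rfl, he, hw₁⟩ := relabel_eq_cons.1 hw
    obtain ⟨u', v', h1, h2, h3⟩ := runs_cons_iff.1 h'
    simp only [List.append_assoc] at h1 h2 h3
    obtain ⟨rfl, h5⟩ := List.append_inj h1 h2
    have hl : e.src.length = e'.src.length := by
      rw [← Elem.length_src_relabel (fun _ => (0 : Fin 1)) e, ← he, Elem.length_src_relabel]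
    obtain ⟨h4, rfl⟩ := List.append_inj h5 hl
    obtain rfl : e' = e := by
      cases e with
      | cup x => exact absurd rfl (hc ⟨u.length, .cup x⟩ (by simp) x)
      | cap x =>
        obtain ⟨y, rfl, -⟩ := Elem.relabel_eq_cap.1 he
        simp only [Elem.src, List.cons.injEq] at h4
        rw [h4.1]
      | cross k a b =>
        obtain ⟨a', b', rfl, -⟩ := Elem.relabel_eq_cross.1 he
        simp only [Elem.src, List.cons.injEq] at h4
        rw [h4.1, h4.2.1]
    obtain ⟨rfl, rfl⟩ := ih (by simpa using h3) hw₁ fun l hl => hc l (by simp [hl])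
    exact ⟨rfl, rfl⟩

theorem eq_capWord_of_forget {u A B v M : List (Strand X)} {W : Word X} {s : Strand (Fin 1)}
    (hAB : B.length = A.length) (h : Runs (u ++ A ++ B ++ v) W M)
    (hW : Word.relabel (fun _ => (0 : Fin 1)) W =
      (List.range A.length).reverse.map fun p => ⟨u.length + p, .cap s⟩) :
    B = (A.map Strand.flip).reverse ∧ W = shift u.length (capWord A) ∧ M = u ++ v := by
  induction A using List.reverseRecOn generalizing B W with
  | nil =>
    obtain rfl := List.length_eq_zero_iff.1 hAB
    obtain rfl := relabel_eq_nil.1 hW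
    exact ⟨rfl, rfl, by simpa using (runs_nil_iff.1 h).symm⟩
  | append_singleton A a ih =>
    obtain ⟨b, B, rfl⟩ := List.exists_cons_of_length_eq_add_one (by simpa using hAB)
    simp only [List.length_append, List.length_singleton, List.range_succ, List.reverse_append,
      List.reverse_singleton, List.singleton_append, List.map_cons] at hW
    obtain ⟨e, W, rfl, he, hW₁⟩ := relabel_eq_cons.1 hW
    obtain ⟨z, rfl, -⟩ := Elem.relabel_eq_cap.1 he
    obtain ⟨u', v', h1, h2, h3⟩ := runs_cons_iff.1 h
    have h1 : (u ++ A) ++ (a :: b :: (B ++ v)) = u' ++ (z :: z.flip :: v') := by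
      simpa [Elem.src] using h1
    obtain ⟨rfl, h4⟩ := List.append_inj h1 (by simpa using h2)
    simp only [List.cons.injEq] at h4
    obtain ⟨rfl, rfl, rfl⟩ := h4
    obtain ⟨rfl, rfl, rfl⟩ := ih (B := B) (by simpa using hAB) (by simpa [Elem.tgt] using h3) hW₁
    exact ⟨by simp, by simp [capWord_concat], rfl⟩

theorem eq_cupWord_of_forget {u v M : List (Strand X)} {W : Word X} {s : Strand (Fin 1)} {n : ℕ}
    (h : Runs (u ++ v) W M) (hW : Word.relabel (fun _ => (0 : Fin 1)) W =
      (List.range n).map fun p => ⟨u.length + p, .cup s⟩) :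
    ∃ A : List (Strand X), A.length = n ∧ (∀ a ∈ A, a.relabel (fun _ => (0 : Fin 1)) = s) ∧
      W = shift u.length (cupWord A) ∧ M = u ++ A ++ (A.map Strand.flip).reverse ++ v := by
  induction n generalizing W M with
  | zero =>
    obtain rfl := relabel_eq_nil.1 hW
    exact ⟨[], rfl, by simp, rfl, by simpa using (runs_nil_iff.1 h).symm⟩
  | succ n ih =>
    rw [List.range_succ, List.map_append] at hW
    obtain ⟨W, W', rfl, hW₁, hW'⟩ := relabel_eq_append hW
    obtain ⟨e, _, rfl, he, hnil⟩ := relabel_eq_cons.1 hW'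
    obtain rfl := relabel_eq_nil.1 hnil
    obtain ⟨z, rfl, rfl⟩ := Elem.relabel_eq_cup.1 he
    obtain ⟨M', hM, hM'⟩ := runs_append_iff.1 h
    obtain ⟨A, rfl, hA, rfl, rfl⟩ := ih hM hW₁
    obtain ⟨u', v', h1, h2, h3⟩ := runs_cons_iff.1 hM'
    have h1 : (u ++ A) ++ ((A.map Strand.flip).reverse ++ v) = u' ++ v' := by
      simpa [Elem.src] using h1
    obtain ⟨rfl, rfl⟩ := List.append_inj h1 (by simpa using h2)
    refine ⟨A ++ [z], by simp, ?_, by simp [cupWord_concat],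
      by simpa [Elem.tgt] using (runs_nil_iff.1 h3).symm⟩
    intro a ha
    simp only [List.mem_append, List.mem_singleton] at ha
    rcases ha with ha | rfl
    · exact hA a ha
    · rfl

theorem exists_bundle_eq {A : List (Strand X)} {s : Strand (Fin 1)}
    (h : ∀ a ∈ A, a.relabel (fun _ => (0 : Fin 1)) = s) :
    ∃ c : Strand (List X), bundle c = A ∧ c.relabel (fun _ => (0 : Fin 1)) = s := by
  obtain ⟨up, x⟩ := s
  obtain rfl : x = 0 := Subsingleton.elim _ _
  have h' : (A.map Strand.comp).map (Strand.mk up) = A := by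
    rw [List.map_map]
    conv_rhs => rw [← List.map_id A]
    refine List.map_congr_left fun a ha => ?_
    have : a.up = up := congrArg Strand.up (h a ha)
    subst this
    rfl
  cases up
  · exact ⟨⟨false, (A.map Strand.comp).reverse⟩, by simpa [bundle] using h', rfl⟩
  · exact ⟨⟨true, A.map Strand.comp⟩, by simpa [bundle] using h', rfl⟩

theorem exists_cmul_of_runs {dir : Bool} {r : ℕ} {S : List (Strand (List X))}
    (hS : ∀ x ∈ S, x.comp.length = r) {l : Letter (Fin 1)} {w' : Word (Fin 1)}
    {t : List (Strand (Fin 1))}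
    (hd : Runs (S.map (Strand.relabel fun _ => (0 : Fin 1))) (l :: w') t) {W : Word X}
    {M : List (Strand X)} (h : Runs (bundles S) W M)
    (hW : Word.relabel (fun _ => (0 : Fin 1)) W = multiplexLetter dir r l) :
    ∃ e T, e.relabel (fun _ => (0 : Fin 1)) = l.elem ∧ LRuns dir r S [⟨l.pos, e⟩] T ∧
      W = cmul dir r ⟨l.pos, e⟩ ∧ M = bundles T := by
  obtain ⟨i, e⟩ := l
  obtain ⟨u, v, h1, h2, -⟩ := runs_cons_iff.1 hd
  obtain ⟨s', V, rfl, h3, rfl⟩ := List.map_eq_append_iff.1 h1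
  obtain ⟨U, m, rfl, rfl, h4⟩ := List.map_eq_append_iff.1 h3
  simp only [List.length_map] at h2 h4 hS ⊢
  subst h2
  have hU : ∀ x ∈ U, x.comp.length = r := fun x hx => hS x (by simp [hx])
  have hlU := length_bundles hU
  cases e with
  | cup s =>
    simp only [Elem.src, List.map_eq_nil_iff] at h4
    subst h4
    rw [List.append_nil, bundles_append] at h
    obtain ⟨A, hA, hA', rfl, rfl⟩ := eq_cupWord_of_forget h
      (by simpa [hlU, multiplexLetter] using hW)
    obtain ⟨c, rfl, rfl⟩ := exists_bundle_eq hA'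
    have hc : c.comp.length = r := by simpa using hA
    exact ⟨.cup c, U ++ [c, c.flip] ++ V, rfl,
      .cons_of_eq U V (by simp [Elem.src]) rfl (by rintro _ ⟨⟩; exact hc) (.nil _),
      by simp [cmul, cmulElem, hlU], by simp [bundle_flip]⟩
  | cap s =>
    simp only [Elem.src, List.map_eq_cons_iff, List.map_eq_nil_iff] at h4
    obtain ⟨a, _, rfl, rfl, b, _, rfl, hb, rfl⟩ := h4
    have ha : a.comp.length = r := hS a (by simp)
    have hb' : b.comp.length = r := hS b (by simp)
    have h : Runs (bundles U ++ bundle a ++ bundle b ++ bundles V) W M := by simpa using h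
    obtain ⟨hab, rfl, rfl⟩ := eq_capWord_of_forget (by simp [ha, hb']) h
      (by simpa [hlU, multiplexLetter, ha] using hW)
    obtain rfl : b = a.flip := by
      have hup : b.up = !a.up := congrArg Strand.up hb
      rw [← bundle_flip] at hab
      obtain ⟨y, c⟩ := a
      obtain ⟨_, c'⟩ := b
      obtain rfl : _ = !y := hup
      have hinj : Function.Injective (Strand.mk (X := X) (!y)) := fun _ _ h => by simpa using h
      cases y
      · have := List.map_injective_iff.2 hinj hab
        simpa [Strand.flip] using this
      · have := List.map_injective_iff.2 hinj hab
        simpa [Strand.flip] using this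
    exact ⟨.cap a, U ++ V, rfl, .cons_of_eq U V (by simp [Elem.src]) rfl (by simp)
      (cruns_nil_iff.2 (by simp [Elem.ctgt, Elem.tgt])), by simp [cmul, cmulElem, hlU], by simp⟩
  | cross k a b =>
    simp only [Elem.src, List.map_eq_cons_iff, List.map_eq_nil_iff] at h4
    obtain ⟨a, _, rfl, rfl, b, _, rfl, rfl, rfl⟩ := h4
    have ha : a.comp.length = r := hS a (by simp)
    have hb : b.comp.length = r := hS b (by simp)
    have h1 := runs_cmul dir (v := V) (e := .cross k a b) hU
    have h2 := relabel_cmul dir r ⟨U.length, .cross k a b⟩ (by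
      simp [Elem.ends, Elem.src, Elem.tgt, ha, hb])
    obtain ⟨rfl, rfl⟩ := h1.unique_of_forget h (by rw [h2, hW]; rfl) fun l hl x =>
      elem_ne (by simp [events_cmul, cup_cap_notMem_events_cross]) rfl l hl
    exact ⟨.cross k a b, _, rfl, .cons_of_eq U V (by simp [Elem.src]) rfl (by simp) (.nil _),
      rfl, rfl⟩

/-- A diagram whose underlying diagram is a multiplexing is the multiplexing of a coloured
diagram. -/
theorem exists_mul_of_runs {dir : Bool} {r : ℕ} {w : Word (Fin 1)} {S : List (Strand (List X))}
    (hS : ∀ x ∈ S, x.comp.length = r) {t : List (Strand (Fin 1))}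
    (hd : Runs (S.map (Strand.relabel fun _ => (0 : Fin 1))) w t) {W : Word X}
    {M : List (Strand X)} (h : Runs (bundles S) W M)
    (hW : Word.relabel (fun _ => (0 : Fin 1)) W = multiplex dir r w) :
    ∃ c T, Word.relabel (fun _ => (0 : Fin 1)) c = w ∧ LRuns dir r S c T ∧
      W = mul dir r c ∧ M = bundles T := by
  induction w generalizing S W with
  | nil =>
    obtain rfl := relabel_eq_nil.1 hW
    exact ⟨[], S, rfl, .nil _, rfl, (runs_nil_iff.1 h).symm⟩
  | cons l w ih =>
    rw [multiplex, List.flatMap_cons] at hW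
    obtain ⟨W, W', rfl, hW, hW'⟩ := relabel_eq_append hW
    obtain ⟨N, hN, hN'⟩ := runs_append_iff.1 h
    obtain ⟨e, T, he, hT, rfl, rfl⟩ := exists_cmul_of_runs hS hd hN hW
    have hd' : Runs (T.map (Strand.relabel fun _ => (0 : Fin 1))) w t := by
      obtain ⟨i, e'⟩ := l
      obtain rfl := he
      obtain ⟨m, h1, h2⟩ := runs_append_iff.1 (show Runs _ ([_] ++ w) t from hd)
      rwa [h1.det hT.forget] at h2
    obtain ⟨c, T', rfl, hc, rfl, rfl⟩ := ih (hT.length_colors hS) hd' hN' hW'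
    exact ⟨⟨l.pos, e⟩ :: c, T', by rw [relabel_cons, he], hT.append hc, rfl, rfl⟩

/-- The multiplexing of a coloured diagram, without the names of the components. -/
theorem relabel_mul {dir : Bool} {r : ℕ} {s t : List (Strand (List X))} {c : Word (List X)}
    (h : LRuns dir r s c t) (hs : ∀ x ∈ s, x.comp.length = r) :
    Word.relabel (fun _ => (0 : Fin 1)) (mul dir r c) =
      multiplex dir r (Word.relabel (fun _ => (0 : Fin 1)) c) := by
  induction h with
  | nil => rfl
  | cons u v e w t hq _ ih =>
    have he : ∀ x ∈ e.ends, x.comp.length = r :=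
      Elem.forall_ends (P := fun c => c.length = r) hq fun x hx => hs x (by simp [hx])
    rw [mul_cons, relabel_append, relabel_cmul dir r _ he, ih (LRuns.induction_step hq hs)]
    rfl

/-! ### Colours along a circle -/

section

variable {ρ : Equiv.Perm C} {δ : ℤ} {Q : C → Prop} {s m t : List (Strand C)} {w : Word C}

theorem CRuns.det {t' : List (Strand C)} (h : CRuns ρ δ Q s w t) (h' : CRuns ρ δ Q s w t') :
    t = t' := by
  induction h with
  | nil => exact cruns_nil_iff.1 h'
  | cons u v e w t _ _ ih =>
    obtain ⟨u', v', h1, h2, -, h3⟩ := cruns_cons_iff.1 h'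
    simp only [List.append_assoc] at h1 h2
    obtain ⟨rfl, h4⟩ := List.append_inj h1 h2
    obtain rfl : v = v' := List.append_cancel_left h4
    exact ih h3

theorem CRuns.at_letter (h : CRuns ρ δ Q s w t) {n i : ℕ} {e : Elem C}
    (hn : w[n]? = some ⟨i, e⟩) : ∃ u v, i = u.length ∧ CRuns ρ δ Q s (w.take n) (u ++ e.src ++ v) ∧
      CRuns ρ δ Q s (w.take (n + 1)) (u ++ e.ctgt ρ δ ++ v) ∧ ∀ s, e = .cup s → Q s.comp := by
  obtain ⟨hlt, he⟩ := List.getElem?_eq_some_iff.1 hn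
  have hw : w.take (n + 1) = w.take n ++ [⟨i, e⟩] := by rw [List.take_add_one, hn]; rfl
  rw [← List.take_append_drop (n + 1) w] at h
  obtain ⟨m, h1, -⟩ := h.of_append
  have h1' := h1
  rw [hw] at h1
  obtain ⟨m', h4, h2⟩ := h1.of_append
  obtain ⟨u, v, rfl, rfl, hq, h3⟩ := cruns_cons_iff.1 h2
  obtain rfl := cruns_nil_iff.1 h3
  exact ⟨u, v, rfl, h4, h1', hq⟩

/-- The colour of the strand number `p` above the first `n` pieces satisfies `P`. -/
def ColourAt (ρ : Equiv.Perm C) (δ : ℤ) (Q P : C → Prop) (w : Word C) (x : ℕ × ℕ) : Prop :=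
  ∃ u s, CRuns ρ δ Q [] (w.take x.1) u ∧ u[x.2]? = some s ∧ P s.comp

theorem colourAt_iff {P : C → Prop} {n p : ℕ} {u : List (Strand C)}
    (h : CRuns ρ δ Q [] (w.take n) u) :
    ColourAt ρ δ Q P w (n, p) ↔ ∃ s, u[p]? = some s ∧ P s.comp :=
  ⟨fun ⟨_, s, h1, h2, h3⟩ => ⟨s, (h1.det h) ▸ h2, h3⟩, fun ⟨s, h1, h2⟩ => ⟨u, s, h, h1, h2⟩⟩

/-- A property of colours that is invariant under `ρ` does not change along a circle, as long as it
stays below a horizontal line where no strand has the property. -/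
theorem Joined.colourAt_iff {P : C → Prop} (h : CRuns ρ δ Q [] w t) (ht : ∀ s ∈ t, ¬ P s.comp)
    (hP : ∀ c (n : ℤ), P ((ρ ^ n) c) ↔ P c) {w' : Word (Fin 1)} {x y : ℕ × ℕ}
    (hxy : Joined (Word.relabel (fun _ => (0 : Fin 1)) w ++ w') x y) :
    ColourAt ρ δ Q P w x ↔ ColourAt ρ δ Q P w y := by
  have htop : ∀ {n p}, w.length ≤ n → ¬ ColourAt ρ δ Q P w (n, p) := by
    rintro n p hn ⟨u, s, h1, h2, h3⟩
    rw [List.take_of_length_le hn] at h1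
    obtain rfl := h.det h1
    exact ht s (List.mem_of_getElem? h2) h3
  have hletter : ∀ {n : ℕ} {l : Letter (Fin 1)},
      (Word.relabel (fun _ => (0 : Fin 1)) w ++ w')[n]? = some l → n < w.length →
      ∃ e, w[n]? = some ⟨l.pos, e⟩ ∧ e.relabel (fun _ => (0 : Fin 1)) = l.elem := by
    intro n l hl hn
    rw [List.getElem?_append_left (by simpa), Word.relabel, List.getElem?_map,
      Option.map_eq_some_iff] at hl
    obtain ⟨l', hl', rfl⟩ := hl
    exact ⟨l'.elem, hl', rfl⟩
  have hsrc : ∀ (e : Elem C) l, e.relabel (fun _ => (0 : Fin 1)) = l →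
      l.src.length = e.src.length :=
    fun e l he => by rw [← he, Elem.length_src_relabel]
  have htgt : ∀ (e : Elem C) l, e.relabel (fun _ => (0 : Fin 1)) = l →
      l.tgt.length = (e.ctgt ρ δ).length :=
    fun e l he => by rw [← he, Elem.length_tgt_relabel, Elem.length_ctgt]
  cases hxy with
  | left n p l hl hp =>
    rcases lt_or_ge n w.length with hn | hn
    · obtain ⟨e, he, -⟩ := hletter hl hn
      obtain ⟨u, v, hi, h1, h2, -⟩ := h.at_letter he
      rw [VirtualLinks.colourAt_iff h1, VirtualLinks.colourAt_iff h2]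
      rw [hi] at hp
      simp [List.getElem?_append_left hp]
    · exact iff_of_false (htop hn) (htop (by omega))
  | right n d l hl =>
    rcases lt_or_ge n w.length with hn | hn
    · obtain ⟨e, he, hel⟩ := hletter hl hn
      obtain ⟨u, v, hi, h1, h2, -⟩ := h.at_letter he
      rw [VirtualLinks.colourAt_iff h1, VirtualLinks.colourAt_iff h2, hi, hsrc e _ hel,
        htgt e _ hel, ← List.length_append, ← List.length_append]
      simp only [List.getElem?_append_right (Nat.le_add_right _ _), Nat.add_sub_cancel_left]
    · exact iff_of_false (htop hn) (htop (by omega))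
  | cup n i s hl =>
    rcases lt_or_ge n w.length with hn | hn
    · obtain ⟨e, he, hel⟩ := hletter hl hn
      obtain ⟨u, v, hi, h1, h2, -⟩ := h.at_letter he
      obtain ⟨s, rfl, -⟩ := Elem.relabel_eq_cup.1 hel
      simp only at hi
      subst hi
      rw [VirtualLinks.colourAt_iff h2, VirtualLinks.colourAt_iff h2]
      simp [Elem.ctgt, Elem.tgt, Strand.flip]
    · exact iff_of_false (htop (by omega)) (htop (by omega))
  | cap n i s hl =>
    rcases lt_or_ge n w.length with hn | hn
    · obtain ⟨e, he, hel⟩ := hletter hl hn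
      obtain ⟨u, v, hi, h1, h2, -⟩ := h.at_letter he
      obtain ⟨s, rfl, -⟩ := Elem.relabel_eq_cap.1 hel
      simp only at hi
      subst hi
      rw [VirtualLinks.colourAt_iff h1, VirtualLinks.colourAt_iff h1]
      simp [Elem.src, Strand.flip]
    · exact iff_of_false (htop (by omega)) (htop (by omega))
  | cross₁ n i k a b hl =>
    rcases lt_or_ge n w.length with hn | hn
    · obtain ⟨e, he, hel⟩ := hletter hl hn
      obtain ⟨u, v, hi, h1, h2, -⟩ := h.at_letter he
      obtain ⟨a, b, rfl, -⟩ := Elem.relabel_eq_cross.1 hel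
      simp only at hi
      subst hi
      rw [VirtualLinks.colourAt_iff h1, VirtualLinks.colourAt_iff h2]
      simp [Elem.src, Elem.ctgt, -zpow_neg, hP]
    · exact iff_of_false (htop (by omega)) (htop (by omega))
  | cross₂ n i k a b hl =>
    rcases lt_or_ge n w.length with hn | hn
    · obtain ⟨e, he, hel⟩ := hletter hl hn
      obtain ⟨u, v, hi, h1, h2, -⟩ := h.at_letter he
      obtain ⟨a, b, rfl, -⟩ := Elem.relabel_eq_cross.1 hel
      simp only at hi
      subst hi
      rw [VirtualLinks.colourAt_iff h1, VirtualLinks.colourAt_iff h2]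
      simp [Elem.src, Elem.ctgt, -zpow_neg, hP]
    · exact iff_of_false (htop (by omega)) (htop (by omega))

/-- In a knot diagram, a property of colours that is invariant under `ρ` holds everywhere if it
holds for one strand. -/
theorem KnotDiagram.forall_colour (D : KnotDiagram) {P : C → Prop} {w' : Word (Fin 1)}
    (hD : D.word = Word.relabel (fun _ => (0 : Fin 1)) w ++ w')
    (h : CRuns ρ δ Q [] w t) (ht : ∀ s ∈ t, ¬ P s.comp) (hP : ∀ c (n : ℤ), P ((ρ ^ n) c) ↔ P c)
    {n : ℕ} (hn : n ≤ w.length) {u : List (Strand C)} (hu : CRuns ρ δ Q [] (w.take n) u)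
    {s : Strand C} (hs : s ∈ u) (hPs : P s.comp) {n' : ℕ} (hn' : n' ≤ w.length)
    {u' : List (Strand C)} (hu' : CRuns ρ δ Q [] (w.take n') u') : ∀ s' ∈ u', P s'.comp := by
  intro s' hs'
  have hat : ∀ {n p : ℕ} {u : List (Strand C)} {s : Strand C}, n ≤ w.length →
      CRuns ρ δ Q [] (w.take n) u → u[p]? = some s →
      StrandAt D.word n p (s.relabel fun _ => (0 : Fin 1)) := by
    intro n p u s hn hu hp
    refine ⟨_, ?_, by rw [List.getElem?_map, hp]; rfl⟩
    rw [hD, List.take_append_of_le_length (by simpa), Word.relabel, ← List.map_take]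
    exact hu.forget
  obtain ⟨p, hp⟩ := List.mem_iff_getElem?.1 hs
  obtain ⟨p', hp'⟩ := List.mem_iff_getElem?.1 hs'
  have hc := D.comp_connected _ _ _ _ _ _ (hat hn hu hp) (hat hn' hu' hp') rfl
  rw [hD] at hc
  have key : ∀ x y, Relation.EqvGen
      (Joined (Word.relabel (fun _ => (0 : Fin 1)) w ++ w')) x y →
      (ColourAt ρ δ Q P w x ↔ ColourAt ρ δ Q P w y) := by
    intro x y hxy
    induction hxy with
    | rel _ _ hj => exact hj.colourAt_iff h ht hP
    | refl => rfl
    | symm _ _ _ ih => exact ih.symm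
    | trans _ _ _ _ _ ih₁ ih₂ => exact ih₁.trans ih₂
  obtain ⟨s₁, h1, h2⟩ := (colourAt_iff hu').1 ((key _ _ hc).1 ⟨u, s, hu, hp, hPs⟩)
  rw [hp', Option.some_inj] at h1
  exact h1 ▸ h2

/-- The colours on a horizontal line, weighted with the directions of the strands, have the same sum
on all lines: the changes of the two colours at a virtual crossing cancel. -/
theorem CRuns.sum_sign_mul (h : CRuns ρ δ Q s w t) (f : C → ℤ) (hf : ∀ c, f (ρ c) = f c + 1) :
    (s.map fun x => x.sign * f x.comp).sum = (t.map fun x => x.sign * f x.comp).sum := by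
  have hz : ∀ (n : ℤ) c, f ((ρ ^ n) c) = f c + n := by
    intro n
    induction n with
    | zero => simp
    | succ n ih => intro c; rw [add_comm, zpow_add, zpow_one, Equiv.Perm.mul_apply, hf, ih]; ring
    | pred n ih =>
      intro c
      have := hf ((ρ ^ (-(n : ℤ) - 1)) c)
      rw [← Equiv.Perm.mul_apply, ← zpow_one_add, add_sub_cancel, ih] at this
      linarith
  induction h with
  | nil => rfl
  | cons u v e w t _ _ ih =>
    rw [← ih]
    cases e with
    | cup x => simp [Elem.src, Elem.ctgt, Elem.tgt, Strand.flip, Strand.sign]; cases x.up <;> simp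
    | cap x => simp [Elem.src, Elem.ctgt, Elem.tgt, Strand.flip, Strand.sign]; cases x.up <;> simp
    | cross k a b =>
      simp only [Elem.src, Elem.ctgt, List.map_append, List.map_cons, List.map_nil, List.sum_append,
        List.sum_cons, List.sum_nil, Strand.turn_sign, Strand.turn_comp, hz]
      cases k <;> simp only [twist] <;> ring

end

/-! ### Existence of a colouring -/

/-- The permutation of `ℕ × ℤ` that adds `1` to the second entry. -/
def addOne : Equiv.Perm (ℕ × ℤ) := (Equiv.refl ℕ).prodCongr (Equiv.addRight 1)

@[simp] theorem addOne_apply (c : ℕ × ℤ) : addOne c = (c.1, c.2 + 1) := rfl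

@[simp] theorem addOne_zpow_fst (n : ℤ) (c : ℕ × ℤ) : ((addOne ^ n) c).1 = c.1 := by
  simpa using map_zpow_apply (ρ := addOne) (ρ' := 1) (f := Prod.fst) (fun _ => rfl) n c

/-- The part of a knot diagram below a horizontal line has a colouring by pairs `(i, n)`, where
`i` is a name for the arcs below the line.  When two arcs are joined by a maximum, the names and
the numbers on one of them are adapted to those on the other one.  When the two ends of the same arc
are joined, there are no other ends left since the diagram is connected, and the
numbers at the two ends agree by `CRuns.sum_sign_mul`. -/
theorem KnotDiagram.exists_colouring_take (D : KnotDiagram) (δ : ℤ) (w : Word (Fin 1)) :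
    ∀ w', D.word = w ++ w' → ∃ (c : Word (ℕ × ℤ)) (t : List (Strand (ℕ × ℤ))),
      Word.relabel (fun _ => (0 : Fin 1)) c = w ∧ CRuns addOne δ (fun _ => True) [] c t ∧
        ∀ i, t.countP (fun s => s.comp.1 = i) ≤ 2 := by
  induction w using List.reverseRecOn with
  | nil => exact fun w' _ => ⟨[], [], rfl, .nil _, by simp⟩
  | append_singleton w l ih =>
    intro w' hD
    obtain ⟨c, t, rfl, hc, ht⟩ := ih (l :: w') (by simpa using hD)
    obtain ⟨l, e⟩ := l
    obtain ⟨u, v, h1, h2⟩ : ∃ u v, t.map (Strand.relabel fun _ => (0 : Fin 1)) = u ++ e.src ++ v ∧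
        l = u.length := by
      have := D.closed
      rw [hD, List.append_assoc] at this
      obtain ⟨m, hm, hm'⟩ := runs_append_iff.1 this
      rw [hm.det hc.forget] at hm'
      obtain ⟨u, v, h, h', -⟩ := runs_cons_iff.1 hm'
      exact ⟨u, v, h, h'⟩
    obtain ⟨s', V, rfl, h3, rfl⟩ := List.map_eq_append_iff.1 h1
    obtain ⟨U, m, rfl, rfl, h4⟩ := List.map_eq_append_iff.1 h3
    rw [List.length_map] at h2
    subst h2
    cases e with
    | cup s =>
      obtain rfl : m = [] := by simpa [Elem.src] using h4
      obtain ⟨N, hN⟩ := Infinite.exists_notMem_finset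
        ((U ++ [] ++ V).map fun s : Strand (ℕ × ℤ) => s.comp.1).toFinset
      refine ⟨c ++ [⟨U.length, .cup ⟨s.up, (N, 0)⟩⟩],
        U ++ [⟨s.up, (N, 0)⟩, ⟨!s.up, (N, 0)⟩] ++ V, ?_, hc.append (.cons_of_eq U V
          (by simp [Elem.src]) rfl (by simp) (.nil _)), ?_⟩
      · obtain ⟨up, y⟩ := s
        obtain rfl : y = 0 := Subsingleton.elim _ _
        simp [Elem.relabel, Strand.relabel]
      · intro i
        have hi := ht i
        simp only [List.countP_append, List.countP_cons, List.countP_nil] at hi ⊢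
        by_cases hNi : N = i
        · subst hNi
          have h0 : ∀ l : List (Strand (ℕ × ℤ)), (∀ s ∈ l, s ∈ U ++ [] ++ V) →
              l.countP (fun s => decide (s.comp.1 = N)) = 0 := by
            intro l hl
            rw [List.countP_eq_zero]
            intro s hs h
            exact hN (List.mem_toFinset.2 (List.mem_map.2 ⟨s, hl s hs, by simpa using h⟩))
          rw [h0 U fun s hs => by simp [hs], h0 V fun s hs => by simp [hs]]
          simp
        · simpa [hNi] using hi
    | cross k a b =>
      simp only [Elem.src, List.map_eq_cons_iff, List.map_eq_nil_iff] at h4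
      obtain ⟨a, _, rfl, rfl, b, _, rfl, rfl, rfl⟩ := h4
      refine ⟨c ++ [⟨U.length, .cross k a b⟩], _, by simp [Elem.relabel],
        hc.append (.cons_of_eq (e := .cross k a b) U V rfl rfl (by simp) (.nil _)), ?_⟩
      intro i
      have hi := ht i
      simp only [Elem.ctgt, List.countP_append, List.countP_cons, List.countP_nil,
        Strand.turn_comp, addOne_zpow_fst] at hi ⊢
      omega
    | cap s =>
      simp only [Elem.src, List.map_eq_cons_iff, List.map_eq_nil_iff] at h4
      obtain ⟨a, _, rfl, rfl, b, _, rfl, hb, rfl⟩ := h4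
      have hup : b.up = !a.up := congrArg Strand.up hb
      obtain ⟨x, i, n⟩ := a
      obtain ⟨y, j, n'⟩ := b
      obtain rfl : y = !x := hup
      by_cases hij : i = j
      · subst hij
        -- the names alone form a colouring of the diagram up to and including the maximum
        have hfst := hc.relabel (ρ' := 1) (Q' := fun _ => True) Prod.fst (fun _ => rfl) (by simp)
        have hcap : CRuns 1 δ (fun _ => True) []
            (Word.relabel Prod.fst c ++ [⟨U.length, .cap ⟨x, i⟩⟩])
            (U.map (Strand.relabel Prod.fst) ++ V.map (Strand.relabel Prod.fst)) := by
          refine hfst.append (.cons_of_eq (U.map (Strand.relabel Prod.fst))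
            (V.map (Strand.relabel Prod.fst)) ?_ (by simp) (by simp)
            (cruns_nil_iff.2 (by simp [Elem.ctgt, Elem.tgt])))
          simp [Elem.src, Strand.relabel, Strand.flip]
        have h0 : ∀ s ∈ U ++ V, s.comp.1 ≠ i := by
          have := ht i
          simp only [List.countP_append, List.countP_cons, List.countP_nil, decide_true,
            if_true] at this
          have h0 : (U ++ V).countP (fun s => decide (s.comp.1 = i)) = 0 := by
            rw [List.countP_append]; omega
          intro s hs h
          exact List.countP_eq_zero.1 h0 s hs (by simpa using h)
        have hrel : Word.relabel (fun _ => (0 : Fin 1)) (Word.relabel Prod.fst c) =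
            Word.relabel (fun _ => (0 : Fin 1)) c := relabel_relabel ..
        have hall := D.forall_colour (P := fun j => j = i) (w' := w') (n := c.length)
          (n' := c.length) (s := ⟨x, i⟩) (by rw [relabel_append, hrel]; exact hD) hcap
          (by
            intro s hs
            rw [← List.map_append] at hs
            obtain ⟨s, hs', rfl⟩ := List.mem_map.1 hs
            exact h0 s hs')
          (by simp) (by simp) (by simpa using hfst) (by simp [Strand.relabel]) rfl (by simp)
          (by simpa using hfst)
        have hUV : U ++ V = [] := by
          refine List.eq_nil_iff_forall_not_mem.2 fun s hs => h0 s hs ?_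
          refine hall (s.relabel Prod.fst) ?_
          simp only [List.mem_append, List.mem_cons] at hs ⊢
          rcases hs with hs | hs
          · exact .inl (List.mem_map_of_mem hs)
          · exact .inr (.inr (.inr (List.mem_map_of_mem hs)))
        obtain ⟨rfl, rfl⟩ := List.append_eq_nil_iff.1 hUV
        obtain rfl : n = n' := by
          have := hc.sum_sign_mul Prod.snd fun _ => rfl
          cases x <;> simp [Strand.sign] at this <;> omega
        exact ⟨c ++ [⟨0, .cap ⟨x, (i, n)⟩⟩], [], by simp [Elem.relabel],
          hc.append (.cons_of_eq [] [] (by simp [Elem.src, Strand.flip]) rfl (by simp) (.nil _)),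
          by simp⟩
      · set φ : ℕ × ℤ → ℕ × ℤ := fun c => if c.1 = j then (i, c.2 + (n - n')) else c with hφ
        have hrel := hc.relabel (ρ' := addOne) (Q' := fun _ => True) φ (fun c => by
          simp only [hφ, addOne_apply]
          split
          · simp only [Prod.mk.injEq, true_and]; ring
          · rfl) (by simp)
        refine ⟨Word.relabel φ c ++ [⟨U.length, .cap ⟨x, (i, n)⟩⟩], (U ++ V).map (Strand.relabel φ),
          ?_, hrel.append (.cons_of_eq (U.map (Strand.relabel φ)) (V.map (Strand.relabel φ)) ?_
            (by simp) (by simp) (cruns_nil_iff.2 (by simp [Elem.ctgt, Elem.tgt]))), ?_⟩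
        · rw [relabel_append]
          exact congrArg (· ++ _) (relabel_relabel ..)
        · simp [Elem.src, Strand.relabel, Strand.flip, hφ, hij]
        · intro k
          have hi := ht i
          have hj := ht j
          have hk := ht k
          simp only [List.countP_append, List.countP_cons, List.countP_nil, decide_true,
            if_true, List.map_append, List.countP_map] at hi hj hk ⊢
          have key : ∀ l : List (Strand (ℕ × ℤ)),
              l.countP ((fun s => decide (s.comp.1 = k)) ∘ Strand.relabel φ) =
                if k = j then 0 else if k = i then l.countP (fun s => decide (s.comp.1 = i)) +
                  l.countP (fun s => decide (s.comp.1 = j))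
                else l.countP (fun s => decide (s.comp.1 = k)) := by
            intro l
            induction l with
            | nil => simp
            | cons s l ih =>
              simp only [List.countP_cons, Function.comp_apply, Strand.relabel, hφ,
                decide_eq_true_eq]
              split_ifs <;> simp_all <;> omega
          rw [key, key]
          split_ifs <;> simp_all <;> omega

theorem KnotDiagram.exists_colouring (D : KnotDiagram) (δ : ℤ) : ∃ c : Word (ℕ × ℤ),
    Word.relabel (fun _ => (0 : Fin 1)) c = D.word ∧ CRuns addOne δ (fun _ => True) [] c [] := by
  obtain ⟨c, t, h1, h2, -⟩ := D.exists_colouring_take δ D.word [] (by simp)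
  refine ⟨c, h1, ?_⟩
  have := h2.forget
  rw [h1] at this
  have := this.det D.closed
  rw [List.map_eq_nil_iff] at this
  exact this ▸ h2

/-! ### Comparing two colourings -/

theorem Strand.ext_relabel {s s' : Strand (C × D)} (h : s.relabel Prod.fst = s'.relabel Prod.fst)
    (h' : s.relabel Prod.snd = s'.relabel Prod.snd) : s = s' := by
  obtain ⟨x, a, b⟩ := s
  obtain ⟨x', a', b'⟩ := s'
  simp only [Strand.relabel, Strand.mk.injEq] at h h'
  simp [h.1, h.2, h'.2]

/-- Two colourings of the same diagram form a colouring by pairs. -/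
theorem CRuns.zip {ρ : Equiv.Perm C} {ρ' : Equiv.Perm D} {δ : ℤ} {Q : C → Prop} {Q' : D → Prop}
    {s t : List (Strand C)} {w : Word C} (h : CRuns ρ δ Q s w t) {s' t' : List (Strand D)}
    {w' : Word D} (h' : CRuns ρ' δ Q' s' w' t')
    (hw : Word.relabel (fun _ => (0 : Fin 1)) w' = Word.relabel (fun _ => (0 : Fin 1)) w)
    {S : List (Strand (C × D))} (hS : S.map (Strand.relabel Prod.fst) = s)
    (hS' : S.map (Strand.relabel Prod.snd) = s') :
    ∃ z T, Word.relabel Prod.fst z = w ∧ Word.relabel Prod.snd z = w' ∧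
      CRuns (ρ.prodCongr ρ') δ (fun _ => True) S z T := by
  induction h generalizing S s' w' with
  | nil =>
    obtain rfl := relabel_eq_nil.1 hw
    exact ⟨[], S, rfl, rfl, .nil _⟩
  | cons u v e w t hq _ ih =>
    rw [relabel_cons] at hw
    obtain ⟨e', w', rfl, he, hw₁⟩ := relabel_eq_cons.1 hw
    obtain ⟨u', v', h1, h2, -, h3⟩ := cruns_cons_iff.1 h'
    obtain ⟨S₁, V, rfl, h4, rfl⟩ := List.map_eq_append_iff.1 hS
    obtain ⟨U, m, rfl, rfl, h5⟩ := List.map_eq_append_iff.1 h4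
    subst h1
    rw [List.map_append, List.map_append, List.append_assoc, List.append_assoc] at hS'
    obtain ⟨rfl, h6⟩ := List.append_inj hS' (by simpa using h2)
    have hl : e.src.length = e'.src.length := by
      rw [← Elem.length_src_relabel (fun _ => (0 : Fin 1)) e, ← he, Elem.length_src_relabel]
    obtain ⟨h7, rfl⟩ := List.append_inj h6 (by
      rw [← hl, ← h5, List.length_map, List.length_map])
    have key : ∃ f : Elem (C × D), f.relabel Prod.fst = e ∧ f.relabel Prod.snd = e' ∧
        f.src = m := by
      cases e with
      | cup x =>
        obtain ⟨y, rfl, hy⟩ := Elem.relabel_eq_cup.1 he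
        obtain rfl : m = [] := by simpa [Elem.src] using h5
        obtain ⟨x, a⟩ := x
        obtain ⟨y, b⟩ := y
        obtain rfl : y = x := congrArg Strand.up hy
        exact ⟨.cup ⟨y, (a, b)⟩, rfl, rfl, rfl⟩
      | cap x =>
        obtain ⟨y, rfl, hy⟩ := Elem.relabel_eq_cap.1 he
        simp only [Elem.src, List.map_eq_cons_iff, List.map_eq_nil_iff] at h5
        obtain ⟨x, _, rfl, rfl, y', _, rfl, hy', rfl⟩ := h5
        simp only [Elem.src, List.map_cons, List.cons.injEq] at h7
        obtain ⟨rfl, h8, -⟩ := h7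
        refine ⟨.cap x, rfl, rfl, ?_⟩
        obtain rfl : y' = x.flip := Strand.ext_relabel hy' h8
        rfl
      | cross k a b =>
        obtain ⟨a', b', rfl, -⟩ := Elem.relabel_eq_cross.1 he
        simp only [Elem.src, List.map_eq_cons_iff, List.map_eq_nil_iff] at h5
        obtain ⟨a, _, rfl, rfl, b, _, rfl, rfl, rfl⟩ := h5
        simp only [Elem.src, List.map_cons, List.cons.injEq] at h7
        obtain ⟨rfl, rfl, -⟩ := h7
        exact ⟨.cross k a b, rfl, rfl, rfl⟩
    obtain ⟨f, rfl, rfl, rfl⟩ := key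
    obtain ⟨z, T, rfl, rfl, hz⟩ := ih h3 hw₁
      (S := U ++ f.ctgt (ρ.prodCongr ρ') δ ++ V)
      (by simp [Elem.ctgt_relabel_of_comm (ρ := ρ.prodCongr ρ') (ρ' := ρ) (f := Prod.fst)
        (fun _ => rfl)])
      (by simp [Elem.ctgt_relabel_of_comm (ρ := ρ.prodCongr ρ') (ρ' := ρ') (f := Prod.snd)
        (fun _ => rfl)])
    refine ⟨⟨U.length, f⟩ :: z, T, by simp, by simp, .cons _ _ _ _ _ (by simp) hz⟩

theorem relabel_congr {f g : C → D} {w : Word C}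
    (h : ∀ l ∈ w, ∀ s ∈ l.elem.ends, f s.comp = g s.comp) :
    Word.relabel f w = Word.relabel g w := by
  refine List.map_congr_left fun l hl => ?_
  have := h l hl
  obtain ⟨i, e⟩ := l
  have hs : ∀ s : Strand C, f s.comp = g s.comp → s.relabel f = s.relabel g := fun s h => by
    simp [Strand.relabel, h]
  cases e with
  | cup s => simp [Elem.relabel, hs s (this s (by simp [Elem.ends, Elem.tgt]))]
  | cap s => simp [Elem.relabel, hs s (this s (by simp [Elem.ends, Elem.src]))]
  | cross k a b => simp [Elem.relabel, hs a (this a (by simp [Elem.ends, Elem.src])),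
      hs b (this b (by simp [Elem.ends, Elem.src]))]

section

variable {ρ : Equiv.Perm C} {δ : ℤ} {Q : C → Prop} {s t : List (Strand C)} {w : Word C}

theorem CRuns.forall_ends {P : C → Prop} (h : CRuns ρ δ Q s w t)
    (hP : ∀ n ≤ w.length, ∀ u, CRuns ρ δ Q s (w.take n) u → ∀ x ∈ u, P x.comp) :
    ∀ l ∈ w, ∀ x ∈ l.elem.ends, P x.comp := by
  intro l hl x hx
  obtain ⟨n, hn⟩ := List.mem_iff_getElem?.1 hl
  obtain ⟨hlt, -⟩ := List.getElem?_eq_some_iff.1 hn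
  obtain ⟨i, e⟩ := l
  obtain ⟨u, v, -, h1, h2, -⟩ := h.at_letter hn
  have h1 := hP n hlt.le _ h1
  have h2 := hP (n + 1) hlt _ h2
  cases e with
  | cup y =>
      simp only [Elem.ends, Elem.src, List.nil_append] at hx
      exact h2 x (by simp [Elem.ctgt, hx])
  | cap y => exact h1 x (by
      simp only [Elem.ends, Elem.tgt, List.append_nil] at hx
      simp [hx])
  | cross k a b => exact h1 x (by
      simp only [Elem.ends, Elem.src, Elem.tgt, List.mem_append, List.mem_cons,
        List.not_mem_nil, or_false] at hx
      rcases hx with (rfl | rfl) | rfl | rfl <;> simp [Elem.src])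

theorem CRuns.of_forall_ends {Q' : C → Prop} (h : CRuns ρ δ Q s w t)
    (hQ : ∀ l ∈ w, ∀ x ∈ l.elem.ends, Q' x.comp) : CRuns ρ δ Q' s w t := by
  induction h with
  | nil => exact .nil _
  | cons u v e w t _ _ ih =>
    refine .cons _ _ _ _ _ ?_ (ih fun l hl => hQ l (by simp [hl]))
    rintro s rfl
    exact hQ ⟨u.length, .cup s⟩ (by simp) s (by simp [Elem.ends, Elem.tgt])

theorem CRuns.exists_take (h : CRuns ρ δ Q s w t) (n : ℕ) :
    ∃ u, CRuns ρ δ Q s (w.take n) u := by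
  rw [← List.take_append_drop n w] at h
  obtain ⟨u, hu, -⟩ := h.of_append
  exact ⟨u, hu⟩

theorem StrandAt.exists_colour {K : Word (Fin 1)} {n p : ℕ} {s : Strand (Fin 1)}
    (h : StrandAt K n p s) (hK : Runs [] K [])
    (hc : CRuns ρ δ Q [] w []) (hw : Word.relabel (fun _ => (0 : Fin 1)) w = K) :
    n ≤ w.length ∧ ∃ u x v, CRuns ρ δ Q [] (w.take n) (u ++ x :: v) ∧ u.length = p ∧
      x.up = s.up := by
  obtain ⟨m, h1, h2⟩ := h
  subst hw
  obtain ⟨u, hu⟩ := hc.exists_take n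
  have hu' := hu.forget
  rw [Word.relabel, List.map_take] at hu'
  obtain rfl := h1.det hu'
  rw [List.getElem?_map, Option.map_eq_some_iff] at h2
  obtain ⟨x, hx, rfl⟩ := h2
  constructor
  · by_contra hn
    rw [List.take_of_length_le (by omega)] at hu
    obtain rfl := hu.det hc
    simp at hx
  · obtain ⟨hlt, hx⟩ := List.getElem?_eq_some_iff.1 hx
    refine ⟨u.take p, x, u.drop (p + 1), ?_, by simp; omega, rfl⟩
    rwa [← hx, List.getElem_cons_drop, List.take_append_drop]

/-- A colouring of a knot diagram is determined by the colour of one strand. -/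
theorem KnotDiagram.relabel_eq (K : KnotDiagram) {ρ' : Equiv.Perm D} {Q' : D → Prop} {w' : Word D}
    (hw : Word.relabel (fun _ => (0 : Fin 1)) w = K.word)
    (hw' : Word.relabel (fun _ => (0 : Fin 1)) w' = K.word)
    (h : CRuns ρ δ Q [] w []) (h' : CRuns ρ' δ Q' [] w' []) (f : C → D)
    (hf : ∀ c, f (ρ c) = ρ' (f c)) {n : ℕ} (hn : n ≤ w.length) {u v : List (Strand C)}
    {u' v' : List (Strand D)} {x : Strand C} {y : Strand D}
    (h₁ : CRuns ρ δ Q [] (w.take n) (u ++ x :: v))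
    (h₂ : CRuns ρ' δ Q' [] (w'.take n) (u' ++ y :: v')) (hu : u.length = u'.length)
    (hxy : y.comp = f x.comp) : w' = Word.relabel f w := by
  obtain ⟨z, T, rfl, rfl, hz⟩ := h.zip h' (hw'.trans hw.symm) (S := []) rfl rfl
  have hbare : ∀ {B : Type} (g : C × D → B),
      Word.relabel (fun _ => (0 : Fin 1)) (Word.relabel g z) =
      Word.relabel (fun _ => (0 : Fin 1)) z := fun g => relabel_relabel ..
  rw [hbare] at hw
  obtain rfl : T = [] := by
    have := hz.forget
    rw [hw] at this
    simpa using this.det K.closed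
  obtain ⟨m, hm⟩ := hz.exists_take n
  have h3 := hm.relabel (ρ' := ρ) (Q' := fun _ => True) Prod.fst (fun _ => rfl) (by simp)
  have h4 := hm.relabel (ρ' := ρ') (Q' := fun _ => True) Prod.snd (fun _ => rfl) (by simp)
  have ht : ∀ {B : Type} (g : C × D → B), Word.relabel g (z.take n) = (Word.relabel g z).take n :=
    fun g => by simp [Word.relabel]
  rw [ht] at h3 h4
  have h5 := h3.det (h₁.mono (by simp))
  have h6 := h4.det (h₂.mono (by simp))
  have hf' : ∀ (k : ℤ) c, f ((ρ ^ k) c) = (ρ' ^ k) (f c) := fun k c => map_zpow_apply hf k c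
  have hfst : ∀ (k : ℤ) (c : C × D), (((ρ.prodCongr ρ') ^ k) c).1 = (ρ ^ k) c.1 := fun k c =>
    map_zpow_apply (ρ := ρ.prodCongr ρ') (ρ' := ρ) (f := Prod.fst) (fun _ => rfl) k c
  have hsnd : ∀ (k : ℤ) (c : C × D), (((ρ.prodCongr ρ') ^ k) c).2 = (ρ' ^ k) c.2 := fun k c =>
    map_zpow_apply (ρ := ρ.prodCongr ρ') (ρ' := ρ') (f := Prod.snd) (fun _ => rfl) k c
  obtain ⟨m₁, m', rfl, rfl, h7⟩ := List.map_eq_append_iff.1 h5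
  obtain ⟨x, m₂, rfl, rfl, rfl⟩ := List.map_eq_cons_iff.1 h7
  rw [List.map_append] at h6
  obtain ⟨rfl, h8⟩ := List.append_inj h6 (by simpa using hu)
  simp only [List.map_cons, List.cons.injEq] at h8
  obtain ⟨rfl, -⟩ := h8
  have hall : ∀ l ∈ z, ∀ s ∈ l.elem.ends, s.comp.2 = f s.comp.1 := by
    refine hz.forall_ends (P := fun c => c.2 = f c.1) fun n' hn' u' hu' => ?_
    refine K.forall_colour (P := fun c => c.2 = f c.1) (w' := []) (by simp [hw]) hz (by simp) ?_
      (by simpa using hn) hm (s := x) (by simp) hxy hn' hu'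
    intro c k
    simp only [hfst, hsnd, hf']
    exact (ρ' ^ k).injective.eq_iff
  rw [relabel_relabel]
  exact relabel_congr hall

end

/-! ### The components of a diagram as classes of joined points -/

/-- The strands on the line above the first `n` pieces of `w`, the first of them at the position
`k`, each named after the class of its points under `Joined w`. -/
def classStrands (w : Word X) (n k : ℕ) (u : List (Strand X)) :
    List (Strand (Quot (Joined w))) :=
  (u.zipIdx k).map fun x => ⟨x.1.up, Quot.mk _ (n, x.2)⟩

/-- The piece number `n` of `w`, at the position `i`, with its strands named after their
classes under `Joined w`. -/
def classElem (w : Word X) (n i : ℕ) : Elem X → Elem (Quot (Joined w))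
  | .cup s => .cup ⟨s.up, Quot.mk _ (n + 1, i)⟩
  | .cap s => .cap ⟨s.up, Quot.mk _ (n, i)⟩
  | .cross k a b => .cross k ⟨a.up, Quot.mk _ (n, i)⟩ ⟨b.up, Quot.mk _ (n, i + 1)⟩

/-- The diagram `w` with its strands named after their classes under `Joined w`. -/
def classWord (w : Word X) : Word (Quot (Joined w)) :=
  w.zipIdx.map fun l => ⟨l.1.pos, classElem w l.2 l.1.pos l.1.elem⟩

theorem classStrands_append (w : Word X) (n k : ℕ) (u v : List (Strand X)) :
    classStrands w n k (u ++ v) = classStrands w n k u ++ classStrands w n (k + u.length) v := by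
  simp [classStrands, List.zipIdx_append]

theorem length_classStrands (w : Word X) (n k : ℕ) (u : List (Strand X)) :
    (classStrands w n k u).length = u.length := by simp [classStrands]

theorem classStrands_congr {w : Word X} {n n' k k' : ℕ} {u : List (Strand X)}
    (h : ∀ i < u.length, Quot.mk (Joined w) (n, k + i) = Quot.mk _ (n', k' + i)) :
    classStrands w n k u = classStrands w n' k' u := by
  refine List.ext_getElem (by simp [classStrands]) fun i h1 h2 => ?_
  simp only [classStrands, List.getElem_map, List.getElem_zipIdx]
  rw [h i (by simpa [classStrands] using h1)]

theorem relabel_classWord (w : Word X) :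
    Word.relabel (fun _ => (0 : Fin 1)) (classWord w) = Word.relabel (fun _ => (0 : Fin 1)) w := by
  refine List.ext_getElem (by simp [classWord, Word.relabel]) fun i h1 h2 => ?_
  simp only [Word.relabel, classWord, List.getElem_map, List.getElem_zipIdx, zero_add]
  cases (w[i]'(by simpa [Word.relabel] using h2)).elem <;> rfl

theorem runs_classWord_take {w : Word X} {n : ℕ} (hn : n ≤ w.length) {u : List (Strand X)}
    (h : Runs [] (w.take n) u) : Runs [] ((classWord w).take n) (classStrands w n 0 u) := by
  induction n generalizing u with
  | zero =>
    obtain rfl := runs_nil_iff.1 (by simpa using h)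
    exact .nil _
  | succ n ih =>
    have hl : w[n]? = some w[n] := List.getElem?_eq_getElem hn
    rw [List.take_succ_eq_append_getElem hn] at h
    obtain ⟨m, h1, h2⟩ := runs_append_iff.1 h
    have h1 := ih (by omega) h1
    have hn' : n < (classWord w).length := by simpa [classWord] using hn
    rw [List.take_succ_eq_append_getElem hn']
    refine h1.append ?_
    have hc : (classWord w)[n] = ⟨w[n].pos, classElem w n w[n].pos w[n].elem⟩ := by
      simp [classWord]
    rw [hc]
    generalize w[n] = l at hl h2
    obtain ⟨i, e⟩ := l
    obtain ⟨a, b, rfl, rfl, h3⟩ := runs_cons_iff.1 h2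
    obtain rfl := runs_nil_iff.1 h3
    simp only [classStrands_append, zero_add]
    have ha : classStrands w n 0 a = classStrands w (n + 1) 0 a :=
      classStrands_congr fun j hj => Quot.sound (by simpa using .left n j _ hl hj)
    have hb : classStrands w n (a.length + e.src.length) b =
        classStrands w (n + 1) (a.length + e.tgt.length) b :=
      classStrands_congr fun j hj => Quot.sound (.right n j _ hl)
    have he : (classElem w n a.length e).src = classStrands w n a.length e.src ∧
        (classElem w n a.length e).tgt = classStrands w (n + 1) a.length e.tgt := by
      cases e with
      | cup s =>
        refine ⟨rfl, ?_⟩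
        simp [classElem, Elem.tgt, classStrands, Strand.flip, Quot.sound (Joined.cup n _ s hl)]
      | cap s =>
        refine ⟨?_, rfl⟩
        simp [classElem, Elem.src, classStrands, Strand.flip, Quot.sound (Joined.cap n _ s hl)]
      | cross k x y =>
        refine ⟨rfl, ?_⟩
        simp [classElem, Elem.tgt, classStrands, Quot.sound (Joined.cross₁ n _ k x y hl),
          Quot.sound (Joined.cross₂ n _ k x y hl)]
    have := Runs.cons (classStrands w n 0 a) (classStrands w n (a.length + e.src.length) b)
      (classElem w n a.length e) [] _ (.nil _)
    rw [length_classStrands, he.1, he.2, hb] at this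
    rw [ha] at this
    simpa [hb, ha] using this

theorem runs_classWord {w : Word X} (h : Runs [] w []) : Runs [] (classWord w) [] := by
  have := runs_classWord_take le_rfl (by simpa using h : Runs [] (w.take w.length) [])
  rwa [List.take_of_length_le (by simp [classWord])] at this

/-- If the components of `w` can be given names such that different classes of joined points get
different names, then the strands of each component form one circle. -/
theorem eqvGen_joined_of_classWord_eq {w : Word X} (hw : Runs [] w []) {g : X → Quot (Joined w)}
    (hg : classWord w = Word.relabel g w) {t p t' p' : ℕ} {s s' : Strand X}
    (h : StrandAt w t p s) (h' : StrandAt w t' p' s') (hs : s.comp = s'.comp) :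
    Relation.EqvGen (Joined w) (t, p) (t', p') := by
  have key : ∀ {t p : ℕ} {s : Strand X}, StrandAt w t p s →
      Quot.mk (Joined w) (t, p) = g s.comp := by
    rintro t p s ⟨u, hu, hp⟩
    have ht : t ≤ w.length := by
      by_contra ht
      rw [List.take_of_length_le (by omega)] at hu
      obtain rfl := hu.det hw
      simp at hp
    have h1 := runs_classWord_take ht hu
    have h2 := hu.relabel g
    rw [hg, Word.relabel, ← List.map_take] at h1
    have h3 : (classStrands w t 0 u)[p]? = (u.map (Strand.relabel g))[p]? :=
      congrArg (·[p]?) (h1.det (by simpa [Word.relabel] using h2))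
    simp only [classStrands, List.getElem?_map, List.getElem?_zipIdx, hp, Option.map_some,
      Option.some_inj, zero_add, Strand.relabel, Strand.mk.injEq] at h3
    exact h3.2
  exact Quot.eqvGen_exact ((key h).trans ((congrArg g hs).trans (key h').symm))

/-! ### The multiplexing of a knot diagram -/

theorem exists_rot_zpow_eq {l l' : List ι} (h : l ~r l') : ∃ k : ℤ, (rot ^ k) l = l' := by
  have h1 : ∀ l : List ι, (rot ^ (-1 : ℤ)) l = l.rotate 1 := by
    intro l
    cases l with
    | nil => simpa using rot_zpow_isRotated (-1) ([] : List ι)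
    | cons x l => rw [zpow_neg_one]; simp [show rot⁻¹ (x :: l) = rotL (x :: l) from rfl]
  obtain ⟨n, rfl⟩ := h
  refine ⟨-(n : ℤ), ?_⟩
  induction n with
  | zero => simp
  | succ n ih =>
    rw [← List.rotate_rotate, ← ih, ← h1, ← Equiv.Perm.mul_apply, ← zpow_add]
    congr 2
    push_cast
    ring

/-- The colours that number the components in increasing order up to a cyclic permutation. -/
def IsNumbering (r : ℕ) (c : List (Fin r)) : Prop := c ~r List.finRange r

theorem rotClosed_isNumbering (r : ℕ) : RotClosed r (IsNumbering r) := by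
  refine ⟨fun c hc => by simpa using hc.perm.length_eq, fun c n => ?_⟩
  exact ⟨fun h => (rot_zpow_isRotated n c).symm.trans h, fun h => (rot_zpow_isRotated n c).trans h⟩

/-- A colouring of a knot diagram that numbers the parallel strands from left to right at some
base point. -/
def IsNumberedColouring (dir : Bool) {r : ℕ} (D : KnotDiagram) (c : Word (List (Fin r))) : Prop :=
  Word.relabel (fun _ => (0 : Fin 1)) c = D.word ∧
    CRuns rot (dirSign dir) (IsNumbering r) [] c [] ∧
    ∃ n ≤ c.length, ∃ u x v, CRuns rot (dirSign dir) (IsNumbering r) [] (c.take n) (u ++ x :: v) ∧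
      x.comp = List.finRange r

theorem relabel_take (f : X → Y) (w : Word X) (n : ℕ) :
    Word.relabel f (w.take n) = (Word.relabel f w).take n := by simp [Word.relabel]

/-- Two colourings of the same diagram have the same strands on each line. -/
theorem CRuns.exists_take_split {ρ : Equiv.Perm C} {ρ' : Equiv.Perm D} {δ : ℤ} {Q : C → Prop}
    {Q' : D → Prop} {w : Word C} {w' : Word D} {n : ℕ} {u v : List (Strand C)} {x : Strand C}
    {t : List (Strand D)} (h : CRuns ρ δ Q [] (w.take n) (u ++ x :: v))
    (h' : CRuns ρ' δ Q' [] w' t)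
    (hw : Word.relabel (fun _ => (0 : Fin 1)) w' = Word.relabel (fun _ => (0 : Fin 1)) w) :
    ∃ u' y v', CRuns ρ' δ Q' [] (w'.take n) (u' ++ y :: v') ∧ u.length = u'.length := by
  obtain ⟨m, hm⟩ := h'.exists_take n
  have h3 := h.forget
  have h4 := hm.forget
  rw [relabel_take] at h3
  rw [relabel_take, hw] at h4
  have hlen : m.length = (u ++ x :: v).length := by
    simpa using congrArg List.length (h4.det h3)
  have hlt : u.length < m.length := by simp [hlen]
  exact ⟨m.take u.length, m[u.length], m.drop (u.length + 1),
    by rwa [List.getElem_cons_drop, List.take_append_drop], by simp [hlt.le]⟩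

theorem KnotDiagram.exists_isNumberedColouring (dir : Bool) (r : ℕ) (D : KnotDiagram) :
    ∃ c : Word (List (Fin r)), IsNumberedColouring dir D c := by
  obtain ⟨c₀, h1, h2⟩ := D.exists_colouring (dirSign dir)
  have h3 := h2.relabel (ρ' := rot) (Q' := IsNumbering r)
    (fun x => (rot ^ x.2) (List.finRange r))
    (fun x => by rw [← Equiv.Perm.mul_apply, ← zpow_one_add, add_comm, addOne_apply])
    (fun x _ => rot_zpow_isRotated _ _)
  obtain ⟨n, p, s, hs, -⟩ := D.comp_nonempty 0
  have h4 : Word.relabel (fun _ => (0 : Fin 1))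
      (Word.relabel (fun x : ℕ × ℤ => (rot ^ x.2) (List.finRange r)) c₀) = D.word := by
    rw [← h1]
    exact relabel_relabel ..
  generalize Word.relabel (fun x : ℕ × ℤ => (rot ^ x.2) (List.finRange r)) c₀ = c at h3 h4
  obtain ⟨hn, u, x, v, h5, -, -⟩ := hs.exists_colour D.closed h3 h4
  have hx : IsNumbering r x.comp :=
    h5.colors (fun c n hc => ((rotClosed_isNumbering r).2 c n).2 hc) (by simp) x (by simp)
  obtain ⟨k, hk⟩ := exists_rot_zpow_eq hx
  have hQ : ∀ c, IsNumbering r c → IsNumbering r ((rot ^ k) c) := fun c hc =>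
    ((rotClosed_isNumbering r).2 c k).2 hc
  refine ⟨Word.relabel ⇑(rot ^ k) c, ?_,
    by simpa using h3.relabel (ρ' := rot) _ (zpow_apply_comm rot k) hQ, n,
    by simpa using hn, u.map (Strand.relabel ⇑(rot ^ k)), x.relabel ⇑(rot ^ k),
    v.map (Strand.relabel ⇑(rot ^ k)), ?_, hk⟩
  · rw [← h4]
    exact relabel_relabel ..
  · rw [← relabel_take]
    simpa using h5.relabel (ρ' := rot) _ (zpow_apply_comm rot k) hQ

theorem numberedBundle_eq (r : ℕ) (up : Bool) :
    numberedBundle r up = bundle ⟨up, List.finRange r⟩ := by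
  cases up <;> simp [numberedBundle, bundle]

theorem comp_eq_of_bundle_eq {x y : Strand (List X)} (hup : x.up = y.up)
    (h : bundle x = bundle y) : x.comp = y.comp := by
  obtain ⟨b, c⟩ := x
  obtain ⟨_, c'⟩ := y
  obtain rfl : b = _ := hup
  have hinj : Function.Injective (Strand.mk (X := X) b) := fun _ _ h => by simpa using h
  have := List.map_injective_iff.2 hinj h
  cases b <;> simpa using this

theorem mul_take (dir : Bool) (r : ℕ) (w : Word (List X)) (n : ℕ) :
    (mul dir r w).take (mul dir r (w.take n)).length = mul dir r (w.take n) := by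
  conv_lhs => enter [2]; rw [← List.take_append_drop n w, mul_append]
  simp

theorem length_mul_take {dir : Bool} {r : ℕ} {c : Word (List X)} {u : List (Strand (List X))}
    {n : ℕ} (h : LRuns dir r [] (c.take n) u) : (mul dir r (c.take n)).length =
      (multiplex dir r ((Word.relabel (fun _ => (0 : Fin 1)) c).take n)).length := by
  have := congrArg List.length (relabel_mul h (by simp))
  rwa [length_relabel, relabel_take] at this

/-- The diagrams `L(D; r)` are the multiplexings of numbered colourings. -/
theorem IsMultiplexing.exists_isNumberedColouring {dir : Bool} {r : ℕ} {D : KnotDiagram}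
    {E : LinkDiagram r} (h : IsMultiplexing dir D E) :
    ∃ c, IsNumberedColouring dir D c ∧ E.word = mul dir r c := by
  obtain ⟨hE, n, p, s, U, V, hs, hr, hU⟩ := h
  obtain ⟨c, T, hc, h1, h2, h3⟩ := exists_mul_of_runs (S := []) (by simp) D.closed E.closed hE
  obtain rfl : T = [] := by
    have := h1.forget
    rw [hc] at this
    simpa using this.det D.closed
  obtain ⟨hn, u, x, v, h4, hu, hx⟩ := hs.exists_colour D.closed h1 hc
  have hlen := CRuns.length_colors h4 (by simp)
  have h5 := runs_mul h4 (by simp)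
  rw [h2, ← hc, ← length_mul_take h4, mul_take] at hr
  have h6 := hr.det h5
  rw [bundles_append, bundles_cons, List.append_assoc] at h6
  obtain ⟨-, h7⟩ := List.append_inj h6
    (by rw [length_bundles fun y hy => hlen y (by simp [hy]), hU, hu])
  obtain ⟨h8, -⟩ := List.append_inj h7
    (by rw [numberedBundle_eq, length_bundle, length_bundle, hlen x (by simp)]; simp)
  rw [numberedBundle_eq] at h8
  have h9 : x.comp = List.finRange r := (comp_eq_of_bundle_eq hx.symm h8).symm
  have hends : ∀ l ∈ c, ∀ y ∈ l.elem.ends, IsNumbering r y.comp :=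
    h1.forall_ends fun n' hn' u' hu' => D.forall_colour (w' := []) (by simp [hc]) h1 (by simp)
      (rotClosed_isNumbering r).2 hn h4 (s := x) (by simp) (h9 ▸ .refl _) hn' hu'
  have h10 := h1.of_forall_ends hends
  refine ⟨c, ⟨hc, h10, n, hn, u, x, v, ?_, h9⟩, h2⟩
  obtain ⟨m, hm⟩ := h10.exists_take n
  rwa [h4.det (hm.mono (rotClosed_isNumbering r).1)]

theorem IsNumberedColouring.lRuns {dir : Bool} {r : ℕ} {D : KnotDiagram}
    {c : Word (List (Fin r))} (h : IsNumberedColouring dir D c) : LRuns dir r [] c [] :=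
  h.2.1.mono (rotClosed_isNumbering r).1

/-- The circles of a multiplexing are told apart by the numbers: naming the strands after their
circles gives another colouring of the same diagram, which is determined by its colour at the base
point. -/
theorem IsNumberedColouring.exists_classWord_eq {dir : Bool} {r : ℕ} {D : KnotDiagram}
    {c : Word (List (Fin r))} (h : IsNumberedColouring dir D c) :
    ∃ g, classWord (mul dir r c) = Word.relabel g (mul dir r c) := by
  obtain ⟨n, hn, u, x, v, hu, hx⟩ := h.2.2
  have hr : Runs [] (mul dir r c) [] := runs_mul h.lRuns (by simp)
  obtain ⟨c', T, hc', h1, h2, -⟩ := exists_mul_of_runs (S := []) (by simp) D.closed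
    (runs_classWord hr) ((relabel_classWord _).trans ((relabel_mul h.lRuns (by simp)).trans
      (by rw [h.1])))
  obtain rfl : T = [] := by
    have := h1.forget
    rw [hc'] at this
    simpa using this.det D.closed
  obtain ⟨u', y, v', hm, hl⟩ := hu.exists_take_split h1 (hc'.trans h.1.symm)
  have hy : y.comp.length = r := CRuns.length_colors hm (by simp) _ (by simp)
  refine ⟨fun i => y.comp[i.1], ?_⟩
  rw [h2, D.relabel_eq h.1 hc' h.2.1 h1 (List.map fun i => y.comp[i.1])
    (fun l => (rotR_map _ l).symm) hn hu hm hl ?_, mul_relabel]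
  rw [hx]
  exact List.ext_getElem (by simp [hy]) fun i h1 h2 => by simp

/-- The multiplexing of a knot diagram with a numbered colouring as a link diagram. -/
def IsNumberedColouring.linkDiagram {dir : Bool} {r : ℕ} {D : KnotDiagram}
    {c : Word (List (Fin r))} (h : IsNumberedColouring dir D c) : LinkDiagram r where
  word := mul dir r c
  closed := runs_mul h.lRuns (by simp)
  comp_nonempty i := by
    obtain ⟨n, -, u, x, v, hu, hx⟩ := h.2.2
    have h1 := runs_mul (hu.mono (rotClosed_isNumbering r).1) (by simp)
    have h2 : (⟨x.up, i⟩ : Strand (Fin r)) ∈ bundles (u ++ x :: v) := by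
      simp [(bundle_perm x).mem_iff, strands, hx]
    obtain ⟨p, hp⟩ := List.mem_iff_getElem?.1 h2
    exact ⟨_, p, _, ⟨_, by rwa [mul_take], hp⟩, rfl⟩
  comp_connected t p s t' p' s' hs hs' hss := by
    obtain ⟨g, hg⟩ := h.exists_classWord_eq
    exact eqvGen_joined_of_classWord_eq (runs_mul h.lRuns (by simp)) hg hs hs' hss

theorem IsNumberedColouring.isMultiplexing {dir : Bool} {r : ℕ} {D : KnotDiagram}
    {c : Word (List (Fin r))} (h : IsNumberedColouring dir D c) :
    IsMultiplexing dir D h.linkDiagram := by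
  obtain ⟨n, hn, u, x, v, hu, hx⟩ := h.2.2
  refine ⟨(relabel_mul h.lRuns (by simp)).trans (by rw [h.1]), n, u.length,
    x.relabel fun _ => (0 : Fin 1), bundles u, bundles v,
    ⟨(u ++ x :: v).map (Strand.relabel fun _ => 0), ?_, by simp⟩, ?_, ?_⟩
  · rw [← h.1, ← relabel_take]
    exact hu.forget
  · have hu' := hu.mono (rotClosed_isNumbering r).1
    have h1 := runs_mul hu' (by simp)
    rw [← h.1, ← length_mul_take hu']
    change Runs [] ((mul dir r c).take _) _
    rw [mul_take, numberedBundle_eq, ← hx]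
    simpa using h1
  · exact length_bundles fun y hy =>
      CRuns.length_colors (hu.mono (rotClosed_isNumbering r).1) (by simp) y (by simp [hy])

/-- The multiplexings of equivalent knot diagrams are equivalent. -/
theorem IsMultiplexing.equiv {dir : Bool} {r : ℕ} (hr : r ≠ 0) {D D' : KnotDiagram}
    {E E' : LinkDiagram r} (hD : D ≈ D') (h : IsMultiplexing dir D E)
    (h' : IsMultiplexing dir D' E') : E ≈ E' := by
  have : NeZero r := ⟨hr⟩
  obtain ⟨c, hc, hE⟩ := h.exists_isNumberedColouring
  obtain ⟨c', hc', hE'⟩ := h'.exists_isNumberedColouring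
  obtain ⟨b, h1, h2, h3⟩ :=
    (exists_lift_of_eqvGen (rotClosed_isNumbering r) hD).1 c hc.2.1 hc.1
  obtain ⟨n, hn, u, x, v, hu, hx⟩ := hc'.2.2
  have hlen : b.length = c'.length := by
    simpa using congrArg List.length (h2.trans hc'.1.symm)
  obtain ⟨u', y, v', hm, hl⟩ := hu.exists_take_split h1 (h2.trans hc'.1.symm)
  have hy : IsNumbering r y.comp :=
    hm.colors (fun c n hc => ((rotClosed_isNumbering r).2 c n).2 hc) (by simp) _ (by simp)
  obtain ⟨k, hk⟩ := exists_rot_zpow_eq hy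
  have h4 : c' = Word.relabel ⇑(rot ^ k) b :=
    D'.relabel_eq h2 hc'.1 h1 hc'.2.1 ⇑(rot ^ k) (zpow_apply_comm rot k)
      (hlen ▸ hn) hm hu hl.symm (hx.trans hk.symm)
  have h5 := (tequiv_mul_relabel_rot (h1.mono (rotClosed_isNumbering r).1) k).2
  rw [← h4] at h5
  change Relation.EqvGen Move E.word E'.word
  rw [hE, hE']
  exact h3.trans h5

end VirtualLinks

theorem theorem1p1 (r : ℕ) (hr : 2 ≤ r) (dir : Bool) :
    (∀ D : VirtualLinks.KnotDiagram, ∃ E : VirtualLinks.LinkDiagram r,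
      VirtualLinks.IsMultiplexing dir D E) ∧
    (∀ (D : VirtualLinks.KnotDiagram) (E E' : VirtualLinks.LinkDiagram r),
      VirtualLinks.IsMultiplexing dir D E → VirtualLinks.IsMultiplexing dir D E' → E ≈ E') ∧
    (∀ D D' : VirtualLinks.KnotDiagram, D ≈ D' → ∀ E E' : VirtualLinks.LinkDiagram r,
      VirtualLinks.IsMultiplexing dir D E → VirtualLinks.IsMultiplexing dir D' E' → E ≈ E') ∧
    (∃! L : VirtualLinks.VirtualKnot → VirtualLinks.VirtualLink r,
      ∀ (D : VirtualLinks.KnotDiagram) (E : VirtualLinks.LinkDiagram r),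
        VirtualLinks.IsMultiplexing dir D E → L ⟦D⟧ = ⟦E⟧) := by
  have hr' : r ≠ 0 := by omega
  have hex : ∀ D : VirtualLinks.KnotDiagram, ∃ E : VirtualLinks.LinkDiagram r,
      VirtualLinks.IsMultiplexing dir D E := fun D =>
    have ⟨_, hc⟩ := D.exists_isNumberedColouring dir r
    ⟨hc.linkDiagram, hc.isMultiplexing⟩
  refine ⟨hex, fun D E E' h h' => h.equiv hr' (Setoid.refl D) h',
    fun D D' hD E E' h h' => h.equiv hr' hD h', ?_⟩
  choose F hF using hex
  refine ⟨Quotient.lift (fun D => ⟦F D⟧) fun D D' hD =>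
    Quotient.sound ((hF D).equiv hr' hD (hF D')), fun D E hE =>
    Quotient.sound ((hF D).equiv hr' (Setoid.refl D) hE), fun L hL => funext fun K => ?_⟩
  induction K using Quotient.inductionOn with
  | h D => exact hL D (F D) (hF D)
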